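/- Conventions: $A,B,C\in\{0,1\}$, repeated indices are summed, $\varepsilon_{01}=\varepsilon^{01}=1$ is antisymmetric, $x_A=x^B\varepsilon_{BA}$ (so $x_0=-x^1$, $x_1=x^0$), and derivatives have their index raised by $\partial/\partial x_A:=\varepsilon^{AB}\,\partial/\partial x^B$ (so $\partial/\partial x_0=\partial/\partial x^1$, $\partial/\partial x_1=-\partial/\partial x^0$). Products of one-forms in a metric are symmetrised. Let $\mathcal M$ be a complex manifold of complex dimension four. A (complexified) hyper-Hermitian metric on an open set $U\subset\mathcal M$ is a holomorphic, symmetric, nondegenerate complex bilinear form $g$ on $T\mathcal M|_U$ for which there are holomorphic $(1,1)$ tensors $I,J,K$ on $U$ with $I^2=J^2=K^2=-1$ and $IJ=-JI=K$ such that, for all $a,b,c\in\mathbb C$ with $a^2+b^2+c^2=1$, the tensor $\mathcal J=aI+bJ+cK$ has vanishing Nijenhuis tensor $\mathcal J^2[X,Y]-\mathcal J[\mathcal JX,Y]-\mathcal J[X,\mathcal JY]+[\mathcal JX,\mathcal JY]$ and satisfies $g(\mathcal JX,\mathcal JY)=g(X,Y)$. (i) Let $(x^A,w^A)=(x^0,x^1,w^0,w^1)$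 be local holomorphic coordinates on an open set $U\subset\mathcal M$ and let $\Theta_0,\Theta_1$ be holomorphic functions on $U$ satisfying $$\frac{\partial^2\Theta_C}{\partial x_A\,\partial w^A}+\frac{\partial\Theta_B}{\partial x^A}\,\frac{\partial^2\Theta_C}{\partial x_A\,\partial x_B}=0,\qquad C=0,1.$$ Then $$ds^2=dx_A\,dw^A+\frac{\partial\Theta_A}{\partial x^B}\,dw^B\,dw^A$$ is a hyper-Hermitian metric on $U$ (for which the coordinates are null: $ds^2(\partial_{x^A},\partial_{x^B})=0$). (ii) Conversely, every hyper-Hermitian metric locally arises in this way up to a conformal factor: if $g$ is a hyper-Hermitian metric on an open set $U\subset\mathcal M$ and $p\in U$, then there are holomorphic coordinates $(x^A,w^A)$ on a neighbourhood $U'\subset U$ of $p$, holomorphic functions $\Theta_0,\Theta_1$ on $U'$ satisfying the system in (i), and a nowhere vanishing holomorphic function $\Omega$ on $U'$ such that $g=\Omega\,ds^2$ on $U'$ with $ds^2$ as in (i). -/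

import Mathlib

open scoped Manifold ContDiff
open Bundle Set

noncomputable section

/-! ### Two-component index conventions and flat coordinate space -/

/-- Coordinate space `ℂ⁴`; a point is written `(x, w)` with `x = (x⁰, x¹)`, `w = (w⁰, w¹)`. -/
abbrev C4 : Type := (Fin 2 → ℂ) × (Fin 2 → ℂ)

/-- The symplectic form `ε`, with `ε₀₁ = ε⁰¹ = 1`, used for both `ε_{AB}` and `ε^{AB}`. -/
def eps (A B : Fin 2) : ℂ := !![0, 1; -1, 0] A B

/-- The coordinate covector `dx^A` on `ℂ⁴`. -/
def dxUp (A : Fin 2) : C4 →L[ℂ] ℂ :=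
  (ContinuousLinearMap.proj A).comp (ContinuousLinearMap.fst ℂ (Fin 2 → ℂ) (Fin 2 → ℂ))

/-- The coordinate covector `dw^A` on `ℂ⁴`. -/
def dwUp (A : Fin 2) : C4 →L[ℂ] ℂ :=
  (ContinuousLinearMap.proj A).comp (ContinuousLinearMap.snd ℂ (Fin 2 → ℂ) (Fin 2 → ℂ))

/-- `dx_A`, where `x_A = x^B ε_{BA}`; so `dx_0 = -dx¹` and `dx_1 = dx⁰`. -/
def dxDown (A : Fin 2) : C4 →L[ℂ] ℂ := ∑ B, eps B A • dxUp B

/-- The partial derivative `∂f/∂x^A`. -/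
def partialX (A : Fin 2) (f : C4 → ℂ) (z : C4) : ℂ := fderiv ℂ f z (Pi.single A 1, 0)

/-- The partial derivative `∂f/∂w^A`. -/
def partialW (A : Fin 2) (f : C4 → ℂ) (z : C4) : ℂ := fderiv ℂ f z (0, Pi.single A 1)

/-- `∂f/∂x_A`, the derivative with its index raised: `ε^{AB} ∂f/∂x^B`. -/
def partialXRaised (A : Fin 2) (f : C4 → ℂ) (z : C4) : ℂ := ∑ B, eps A B * partialX B f z

/-- The system
`∂²Θ_C/∂x_A∂w^A + (∂Θ_B/∂x^A) (∂²Θ_C/∂x_A∂x_B) = 0`, `C = 0, 1`, at every point of `V`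
(summation over repeated indices). -/
def SolvesHyperEq (Θ : Fin 2 → C4 → ℂ) (V : Set C4) : Prop :=
  ∀ z ∈ V, ∀ C : Fin 2,
    (∑ A, partialXRaised A (partialW A (Θ C)) z) +
      ∑ A, ∑ B, partialX A (Θ B) z * partialXRaised A (partialXRaised B (Θ C)) z = 0

/-- The symmetrised product `(α ⊗ β + β ⊗ α) / 2` of two covectors. -/
def symProd (α β : C4 →L[ℂ] ℂ) : C4 →L[ℂ] C4 →L[ℂ] ℂ :=
  (1 / 2 : ℂ) • (α.smulRight β + β.smulRight α)

/-- The symmetric bilinear form `dx_A dw^A + (∂Θ_A/∂x^B) dw^B dw^A` at the point `z` of `ℂ⁴`. -/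
def coordMetric (Θ : Fin 2 → C4 → ℂ) (z : C4) : C4 →L[ℂ] C4 →L[ℂ] ℂ :=
  (∑ A, symProd (dxDown A) (dwUp A)) +
    ∑ A, ∑ B, partialX B (Θ A) z • symProd (dwUp B) (dwUp A)

/-! ### Hyper-Hermitian structures on complex four-manifolds -/

section Manifold

variable {M : Type*} [TopologicalSpace M] [ChartedSpace C4 M]

/-- Fields of complex bilinear forms on the holomorphic tangent spaces of `M`. -/
abbrev BilinField (M : Type*) [TopologicalSpace M] [ChartedSpace C4 M] : Type _ :=
  ∀ p : M, TangentSpace 𝓘(ℂ, C4) p →L[ℂ] TangentSpace 𝓘(ℂ, C4) p →L[ℂ] ℂ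

/-- Fields of complex linear endomorphisms (`(1,1)` tensors) of the tangent spaces of `M`. -/
abbrev EndField (M : Type*) [TopologicalSpace M] [ChartedSpace C4 M] : Type _ :=
  ∀ p : M, TangentSpace 𝓘(ℂ, C4) p →L[ℂ] TangentSpace 𝓘(ℂ, C4) p

/-- Vector fields on `M`. -/
abbrev VecField (M : Type*) [TopologicalSpace M] [ChartedSpace C4 M] : Type _ :=
  ∀ p : M, TangentSpace 𝓘(ℂ, C4) p

/-- The vector field `X` is holomorphic on `V`. -/
def HolVecOn [IsManifold 𝓘(ℂ, C4) ω M] (X : VecField M) (V : Set M) : Prop :=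
  MDifferentiableOn 𝓘(ℂ, C4) (𝓘(ℂ, C4)).tangent
    (fun p => (⟨p, X p⟩ : TangentBundle 𝓘(ℂ, C4) M)) V

/-- The `(1,1)` tensor field `J` is holomorphic on `U`. -/
def HolEndOn [IsManifold 𝓘(ℂ, C4) ω M] (J : EndField M) (U : Set M) : Prop :=
  MDifferentiableOn 𝓘(ℂ, C4) (𝓘(ℂ, C4).prod 𝓘(ℂ, C4 →L[ℂ] C4))
    (fun p => TotalSpace.mk' (C4 →L[ℂ] C4)
      (E := fun p : M => TangentSpace 𝓘(ℂ, C4) p →L[ℂ] TangentSpace 𝓘(ℂ, C4) p) p (J p)) U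

/-- The field of bilinear forms `g` is holomorphic on `U`. -/
def HolBilinOn [IsManifold 𝓘(ℂ, C4) ω M] (g : BilinField M) (U : Set M) : Prop :=
  MDifferentiableOn 𝓘(ℂ, C4) (𝓘(ℂ, C4).prod 𝓘(ℂ, C4 →L[ℂ] C4 →L[ℂ] ℂ))
    (fun p => TotalSpace.mk' (C4 →L[ℂ] C4 →L[ℂ] ℂ)
      (E := fun p : M =>
        TangentSpace 𝓘(ℂ, C4) p →L[ℂ] TangentSpace 𝓘(ℂ, C4) p →L[ℂ] ℂ) p (g p)) U

/-- The Nijenhuis expression `J²[X,Y] - J[JX,Y] - J[X,JY] + [JX,JY]` at `p`. -/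
def nijenhuis (J : EndField M) (X Y : VecField M) (p : M) : TangentSpace 𝓘(ℂ, C4) p :=
  J p (J p (VectorField.mlieBracket 𝓘(ℂ, C4) X Y p))
    - J p (VectorField.mlieBracket 𝓘(ℂ, C4) (fun q => J q (X q)) Y p)
    - J p (VectorField.mlieBracket 𝓘(ℂ, C4) X (fun q => J q (Y q)) p)
    + VectorField.mlieBracket 𝓘(ℂ, C4) (fun q => J q (X q)) (fun q => J q (Y q)) p

/-- Integrability on `U`: the Nijenhuis tensor vanishes on all locally defined holomorphic
vector fields. -/
def IntegrableOnSet [IsManifold 𝓘(ℂ, C4) ω M] (J : EndField M) (U : Set M) : Prop :=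
  ∀ V : Set M, IsOpen V → V ⊆ U → ∀ X Y : VecField M, HolVecOn X V → HolVecOn Y V →
    ∀ p ∈ V, nijenhuis J X Y p = 0

/-- The member `a I + b J + c K` of the family of (complexified) almost complex structures. -/
def quatComb (I J K : EndField M) (a b c : ℂ) : EndField M :=
  fun p => a • I p + b • J p + c • K p

/-- `(I, J, K)` is a (complexified) hypercomplex structure on `U`: three holomorphic `(1,1)`
tensors that satisfy the quaternion relations and for which every `a I + b J + c K` with
`a² + b² + c² = 1` is integrable. -/
structure IsHypercomplexOn [IsManifold 𝓘(ℂ, C4) ω M] (I J K : EndField M) (U : Set M) :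
    Prop where
  hol_I : HolEndOn I U
  hol_J : HolEndOn J U
  hol_K : HolEndOn K U
  sq_I : ∀ p ∈ U, ∀ v, I p (I p v) = -v
  sq_J : ∀ p ∈ U, ∀ v, J p (J p v) = -v
  sq_K : ∀ p ∈ U, ∀ v, K p (K p v) = -v
  mul_IJ : ∀ p ∈ U, ∀ v, I p (J p v) = K p v
  mul_JI : ∀ p ∈ U, ∀ v, J p (I p v) = -K p v
  integrable : ∀ a b c : ℂ, a ^ 2 + b ^ 2 + c ^ 2 = 1 → IntegrableOnSet (quatComb I J K a b c) U

/-- `g` is a (complexified) hyper-Hermitian metric on `U`: a holomorphic, symmetric,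
nondegenerate field of bilinear forms that is preserved by all the almost complex structures
`a I + b J + c K`, `a² + b² + c² = 1`, of some hypercomplex structure on `U`. -/
structure IsHyperHermitianOn [IsManifold 𝓘(ℂ, C4) ω M] (g : BilinField M) (U : Set M) :
    Prop where
  hol : HolBilinOn g U
  symm : ∀ p ∈ U, ∀ u v, g p u v = g p v u
  nondegenerate : ∀ p ∈ U, ∀ u, (∀ v, g p u v = 0) → u = 0
  exists_hypercomplex : ∃ I J K : EndField M, IsHypercomplexOn I J K U ∧
    ∀ a b c : ℂ, a ^ 2 + b ^ 2 + c ^ 2 = 1 → ∀ p ∈ U, ∀ u v,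
      g p (quatComb I J K a b c p u) (quatComb I J K a b c p v) = g p u v

/-- The field of bilinear forms on `M` which in the local coordinates `e = (x^A, w^A)` is
`dx_A dw^A + (∂Θ_A/∂x^B) dw^B dw^A` (to be used on the domain `e.source`). -/
def chartMetric (e : OpenPartialHomeomorph M C4) (Θ : Fin 2 → C4 → ℂ) : BilinField M :=
  fun p =>
    let L : C4 →L[ℂ] C4 := mfderiv 𝓘(ℂ, C4) 𝓘(ℂ, C4) e p
    ((coordMetric Θ (e p)).bilinearComp L L : C4 →L[ℂ] C4 →L[ℂ] ℂ)

end Manifold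

end

/-! Both directions rest on the frame ∂_A = ∂/∂x^A, W_A = ∂/∂w^A + (∂Θ_B/∂x^A) ∂/∂x_B. In it ds² has
constant coefficients: it is, up to a factor, the tensor product of two area forms on ℂ², one for
the index A and one for the pair (∂, W). Complexified imaginary unit quaternions act on the pair (∂,
W) as traceless 2×2 matrices of determinant one, so they preserve ds² (`coordMetric_shear`,
`coordMetric_flatEnd`). The system says exactly that [W_0, W_1] = 0 (`sum_hyperEq_eq`). Since [∂_A,
W_B] is moreover symmetric in A and B, the torsion of the connection that makes the frame parallel
has just the symmetry that kills every Nijenhuis tensor (`flatEnd_nijenhuis`). This gives (i).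

For (ii), consider the pencil I + iμJ - μK of integrable structures, whose i-eigenbundle consists of
the vectors q + μJq with Iq = iq. Integrability makes this rank two bundle involutive, so the
Frobenius theorem with parameter μ yields a ℂ²-valued function w(z, μ), holomorphic near μ = 0, that
the bundle annihilates (`exists_twistor_function`). Expand it as w + μx + μ²θ + μ³χ + ... .
Comparing powers of μ gives qw = 0, qx = -(Jq)w, qθ = -(Jq)x, qχ = -(Jq)θ. The first two relations
make (x, w) a coordinate system in which suitable eigenvectors q_A are ∂_A; the third gives Jq_A =
-W_A with θ as potential; the fourth becomes ∂_A χ = W_A θ. Equality of the mixed derivatives of χ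
then eliminates χ and leaves the system (`solvesHyperEq_of_potential`,
`exists_adapted_coordinates`). Finally, a symmetric form invariant under I and J is determined in
this frame by one scalar, which is the conformal factor (`bilin_eq_smul_coordMetric`).

The analytic input is twofold: complex differentiability on an open set implies analyticity, by
Cauchy's estimates (`DifferentiableOn.analyticAt_complex`), and the holomorphic Frobenius theorem,
by Picard iteration along rays (`exists_first_integrals`). -/

noncomputable section

/-! ### Holomorphic maps on finite-dimensional complex spaces -/

section Holomorphic

open Filter Topology Metric

variable {E F : Type*} [NormedAddCommGroup E] [NormedSpace ℂ E] [NormedAddCommGroup F]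
  [NormedSpace ℂ F]

/-- Cauchy's estimate for the derivative at the centre of a ball. -/
theorem norm_fderiv_le_of_norm_le_on_ball {f : E → F} {c : E} {R C : ℝ} (hR : 0 < R)
    (hf : DifferentiableOn ℂ f (ball c R)) (hC : ∀ z ∈ ball c R, ‖f z‖ ≤ C) :
    ‖fderiv ℂ f c‖ ≤ 2 * C / R := by
  refine Complex.norm_fderiv_le_div_of_mapsTo_ball hf (fun z hz => ?_) hR
  rw [mem_closedBall, dist_eq_norm]
  linarith [norm_sub_le (f z) (f c), hC z hz, hC c (mem_ball_self hR)]

/-- A uniform limit of holomorphic maps on an open set is holomorphic. -/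
theorem TendstoUniformlyOn.differentiableOn_complex [CompleteSpace F] {f : ℕ → E → F}
    {g : E → F} {U : Set E} (hU : IsOpen U) (hf : ∀ n, DifferentiableOn ℂ (f n) U)
    (hfg : TendstoUniformlyOn f g atTop U) : DifferentiableOn ℂ g U := by
  intro x hx
  obtain ⟨r, hr, hrU⟩ := Metric.isOpen_iff.1 hU x hx
  have hr2 : 0 < r / 2 := by positivity
  have hsub : ∀ y ∈ ball x (r / 2), ball y (r / 2) ⊆ U := fun y hy => by
    refine (ball_subset_ball' ?_).trans hrU
    have := mem_ball.1 hy
    linarith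
  have hbU : ball x (r / 2) ⊆ U := (ball_subset_ball (by linarith)).trans hrU
  -- Cauchy's estimate for the differences `f m - f n` on balls of radius r/2 transfers the uniform
  -- Cauchy property to the derivatives; the limit may then be differentiated term by term.
  have hcau : UniformCauchySeqOn (fun n => fderiv ℂ (f n)) atTop (ball x (r / 2)) := by
    have h0 := hfg.uniformCauchySeqOn
    rw [Metric.uniformCauchySeqOn_iff] at h0 ⊢
    intro ε hε
    obtain ⟨N, hN⟩ := h0 (ε * r / 8) (by positivity)
    refine ⟨N, fun m hm n hn y hy => ?_⟩
    have hd : ∀ k, DifferentiableAt ℂ (f k) y := fun k =>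
      (hf k).differentiableAt (hU.mem_nhds (hbU hy))
    have h1 := norm_fderiv_le_of_norm_le_on_ball (f := f m - f n) (c := y) (C := ε * r / 8) hr2
      (((hf m).sub (hf n)).mono (hsub y hy)) (fun z hz => by
        have := hN m hm n hn z (hsub y hy hz)
        rw [dist_eq_norm] at this
        exact this.le)
    rw [fderiv_sub (hd m) (hd n)] at h1
    rw [dist_eq_norm]
    refine h1.trans_lt ?_
    rw [div_lt_iff₀ hr2]
    nlinarith [mul_pos hε hr]
  have hlim : ∀ y ∈ ball x (r / 2), ∃ l, Tendsto (fun n => fderiv ℂ (f n) y) atTop (𝓝 l) :=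
    fun y hy => cauchySeq_tendsto_of_complete (hcau.cauchySeq hy)
  choose! g' hg' using hlim
  exact (hasFDerivAt_of_tendstoUniformlyOn isOpen_ball
    (hcau.tendstoUniformlyOn_of_tendsto hg')
    (fun n y hy => ((hf n).differentiableAt (hU.mem_nhds (hbU hy))).hasFDerivAt)
    (fun y hy => hfg.tendsto_at (hbU hy)) (mem_ball_self hr2)).differentiableAt
    |>.differentiableWithinAt

/-- A linear map on a finite-dimensional space is the tuple of its values on a basis, so a family of
such maps can be tested one vector at a time. -/
theorem differentiableOn_clm_of_apply {D : Type*} [NormedAddCommGroup D] [NormedSpace ℂ D]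
    [FiniteDimensional ℂ E] {f : D → E →L[ℂ] F} {s : Set D}
    (h : ∀ y, DifferentiableOn ℂ (fun x => f x y) s) : DifferentiableOn ℂ f s := by
  let d := Module.finrank ℂ E
  have hd : d = Module.finrank ℂ (Fin d → ℂ) := (Module.finrank_fin_fun ℂ).symm
  let e₁ := ContinuousLinearEquiv.ofFinrankEq hd
  let e₂ := (e₁.arrowCongr (1 : F ≃L[ℂ] F)).trans (ContinuousLinearEquiv.piRing (Fin d))
  rw [← Function.id_comp f, ← e₂.symm_comp_self]
  exact e₂.symm.differentiable.comp_differentiableOn (differentiableOn_pi.mpr fun i => h _)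

/-- The derivative of a holomorphic map is holomorphic. -/
theorem DifferentiableOn.fderiv_complex [FiniteDimensional ℂ E] [CompleteSpace F] {f : E → F}
    {U : Set E} (hU : IsOpen U) (hf : DifferentiableOn ℂ f U) :
    DifferentiableOn ℂ (fderiv ℂ f) U := by
  refine differentiableOn_clm_of_apply fun v => ?_
  suffices H : ∀ x ∈ U, ∃ W, IsOpen W ∧ x ∈ W ∧
      DifferentiableOn ℂ (fun y => fderiv ℂ f y v) W from fun x hx => by
    obtain ⟨W, hW, hxW, h⟩ := H x hx
    exact (h.differentiableAt (hW.mem_nhds hxW)).differentiableWithinAt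
  intro x hx
  have hcont : ContinuousAt f x := hf.continuousOn.continuousAt (hU.mem_nhds hx)
  obtain ⟨r, hr, hrU, hb⟩ : ∃ r > 0, ball x r ⊆ U ∧ ∀ y ∈ ball x r, ‖f y‖ ≤ ‖f x‖ + 1 := by
    have h1 : ∀ᶠ y in 𝓝 x, y ∈ U ∧ ‖f y‖ ≤ ‖f x‖ + 1 :=
      (hU.eventually_mem hx).and ((hcont.norm.eventually (gt_mem_nhds (lt_add_one _))).mono
        fun y hy => hy.le)
    obtain ⟨r, hr, h⟩ := Metric.eventually_nhds_iff_ball.1 h1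
    exact ⟨r, hr, fun y hy => (h y hy).1, fun y hy => (h y hy).2⟩
  have hdiff : ∀ y ∈ ball x r, DifferentiableAt ℂ f y := fun y hy =>
    hf.differentiableAt (hU.mem_nhds (hrU hy))
  -- The radii shrink from 4s to s: `f` is bounded on radius 4s, its derivative on 3s, the
  -- derivative is Lipschitz on 2s, and the conclusion holds on s.
  set s := r / 4 with hs
  have hs0 : 0 < s := by positivity
  have hball : ∀ {y z : E} {a b : ℝ}, y ∈ ball x a → z ∈ ball y b → a + b ≤ r → z ∈ ball x r :=
    fun {y z a b} hy hz hab => by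
      rw [mem_ball] at *
      linarith [dist_triangle z y x]
  set C := 2 * (‖f x‖ + 1) / s with hC
  have hC0 : 0 ≤ C := by positivity
  have hD1 : ∀ y ∈ ball x (3 * s), ‖fderiv ℂ f y‖ ≤ C := fun y hy =>
    norm_fderiv_le_of_norm_le_on_ball hs0
      (fun z hz => (hdiff z (hball hy hz (by linarith))).differentiableWithinAt)
      (fun z hz => hb z (hball hy hz (by linarith)))
  have hlip : ∀ y ∈ ball x (3 * s), ∀ z ∈ ball x (3 * s), ‖f y - f z‖ ≤ C * ‖y - z‖ :=
    fun y hy z hz => (convex_ball x (3 * s)).norm_image_sub_le_of_norm_hasFDerivWithin_le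
      (fun w hw => ((hdiff w (ball_subset_ball (by linarith) hw)).hasFDerivAt.hasFDerivWithinAt))
      hD1 hz hy
  have hlip' : ∀ y ∈ ball x (2 * s), ∀ z ∈ ball x (2 * s),
      ‖fderiv ℂ f y - fderiv ℂ f z‖ ≤ 2 * (C * ‖y - z‖) / s := by
    intro y hy z hz
    have hy' : ∀ w ∈ ball (0 : E) s, y + w ∈ ball x (3 * s) := fun w hw => by
      rw [mem_ball, dist_eq_norm] at *
      have : y + w - x = (y - x) + (w - 0) := by abel
      rw [this]
      linarith [norm_add_le (y - x) (w - 0)]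
    have hz' : ∀ w ∈ ball (0 : E) s, z + w ∈ ball x (3 * s) := fun w hw => by
      rw [mem_ball, dist_eq_norm] at *
      have : z + w - x = (z - x) + (w - 0) := by abel
      rw [this]
      linarith [norm_add_le (z - x) (w - 0)]
    have hsub3 : ball x (3 * s) ⊆ ball x r := ball_subset_ball (by linarith)
    -- Cauchy's estimate for the difference of two translates of `f`, itself small because `f` is
    -- Lipschitz, gives a Lipschitz bound for the derivative without a second derivative.
    have key := norm_fderiv_le_of_norm_le_on_ball (f := fun w => f (y + w) - f (z + w)) (c := 0)
      (C := C * ‖y - z‖) hs0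
      (fun w hw => (((hdiff _ (hsub3 (hy' w hw))).comp w (by fun_prop)).sub
        ((hdiff _ (hsub3 (hz' w hw))).comp w (by fun_prop))).differentiableWithinAt)
      (fun w hw => (hlip _ (hy' w hw) _ (hz' w hw)).trans_eq (by
        congr 2; abel))
    have e1 : HasFDerivAt (fun w => f (y + w)) (fderiv ℂ f y) 0 := by
      have h := (hdiff _ (hsub3 (hy' 0 (mem_ball_self hs0)))).hasFDerivAt
      have h' := h.comp (0 : E) ((hasFDerivAt_id (𝕜 := ℂ) (0 : E)).const_add y)
      rwa [add_zero, ContinuousLinearMap.comp_id] at h'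
    have e2 : HasFDerivAt (fun w => f (z + w)) (fderiv ℂ f z) 0 := by
      have h := (hdiff _ (hsub3 (hz' 0 (mem_ball_self hs0)))).hasFDerivAt
      have h' := h.comp (0 : E) ((hasFDerivAt_id (𝕜 := ℂ) (0 : E)).const_add z)
      rwa [add_zero, ContinuousLinearMap.comp_id] at h'
    rwa [(e1.fun_sub e2).fderiv] at key
  have hqd : ∀ y ∈ ball x s, ∀ w : E, y + w ∈ ball x (2 * s) →
      ‖f (y + w) - f y - fderiv ℂ f y w‖ ≤ 2 * (C * ‖w‖) / s * ‖w‖ := by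
    intro y hy w hw
    have hyw : y ∈ ball x (2 * s) := ball_subset_ball (by linarith) hy
    have hseg : segment ℝ y (y + w) ⊆ ball x (2 * s) := (convex_ball _ _).segment_subset hyw hw
    have h := (convex_segment y (y + w)).norm_image_sub_le_of_norm_hasFDerivWithin_le'
      (𝕜 := ℂ) (f := f) (f' := fderiv ℂ f) (φ := fderiv ℂ f y) (C := 2 * (C * ‖w‖) / s)
      (fun z hz => (hdiff z (ball_subset_ball (by linarith) (hseg hz))).hasFDerivAt.hasFDerivWithinAt)
      (fun z hz => by
        refine (hlip' z (hseg hz) y hyw).trans ?_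
        have : ‖z - y‖ ≤ ‖w‖ := by
          obtain ⟨t, ht, rfl⟩ := (segment_eq_image' ℝ y (y + w)) ▸ hz
          simp only [add_sub_cancel_left, norm_smul, Real.norm_eq_abs, abs_of_nonneg ht.1]
          nlinarith [norm_nonneg w, ht.2]
        gcongr)
      (left_mem_segment ℝ y (y + w)) (right_mem_segment ℝ y (y + w))
    simpa using h
  refine ⟨ball x s, isOpen_ball, mem_ball_self hs0, ?_⟩
  -- difference quotients with step `δ n`
  obtain ⟨δ, hδ0, hδs, hδ⟩ : ∃ δ : ℕ → ℝ, (∀ n, 0 < δ n) ∧ (∀ n, δ n * ‖v‖ < s) ∧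
      Tendsto δ atTop (𝓝 0) := by
    refine ⟨fun n => s / (‖v‖ + 1) * (1 / ((n : ℝ) + 1)), fun n => by positivity, fun n => ?_, ?_⟩
    · have h1 : (1 : ℝ) / ((n : ℝ) + 1) ≤ 1 := by
        rw [div_le_one (by positivity)]; linarith [n.cast_nonneg (α := ℝ)]
      have h2 : s / (‖v‖ + 1) * (1 / ((n : ℝ) + 1)) ≤ s / (‖v‖ + 1) :=
        mul_le_of_le_one_right (by positivity) h1
      calc _ ≤ s / (‖v‖ + 1) * ‖v‖ := by gcongr
        _ < s := by
          rw [div_mul_eq_mul_div, div_lt_iff₀ (by positivity)]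
          nlinarith
    · simpa using tendsto_one_div_add_atTop_nhds_zero_nat.const_mul (s / (‖v‖ + 1))
  have hmem : ∀ n, ∀ y ∈ ball x s, y + (δ n : ℂ) • v ∈ ball x (2 * s) := fun n y hy => by
    rw [mem_ball, dist_eq_norm] at *
    have h1 : y + (δ n : ℂ) • v - x = (y - x) + (δ n : ℂ) • v := by abel
    have h2 : ‖(δ n : ℂ) • v‖ = δ n * ‖v‖ := by
      rw [norm_smul, Complex.norm_real, Real.norm_eq_abs, abs_of_pos (hδ0 n)]
    rw [h1]
    linarith [norm_add_le (y - x) ((δ n : ℂ) • v), hδs n]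
  -- Each difference quotient is holomorphic, and the quadratic remainder bound `hqd` puts it
  -- uniformly within a multiple of `δ n` of y ↦ Df(y) v.
  refine TendstoUniformlyOn.differentiableOn_complex
    (f := fun n y => (δ n : ℂ)⁻¹ • (f (y + (δ n : ℂ) • v) - f y)) isOpen_ball (fun n y hy => ?_) ?_
  · refine DifferentiableAt.differentiableWithinAt ?_
    have h1 := hdiff _ (ball_subset_ball (by linarith) (hmem n y hy))
    have h2 := hdiff y (ball_subset_ball (by linarith) hy)
    exact ((h1.comp (f := fun y => y + (δ n : ℂ) • v) y (by fun_prop)).sub h2).const_smul _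
  · rw [Metric.tendstoUniformlyOn_iff]
    intro ε hε
    have hlim : Tendsto (fun n => 2 * C / s * ‖v‖ ^ 2 * δ n) atTop (𝓝 0) := by
      simpa using hδ.const_mul (2 * C / s * ‖v‖ ^ 2)
    filter_upwards [hlim.eventually (gt_mem_nhds hε)] with n hn y hy
    have h1 := hqd y hy _ (hmem n y hy)
    have h2 : ‖(δ n : ℂ)‖ = δ n := by
      rw [Complex.norm_real, Real.norm_eq_abs, abs_of_pos (hδ0 n)]
    have h3 : (δ n : ℂ) ≠ 0 := by exact_mod_cast (hδ0 n).ne'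
    have h4 : fderiv ℂ f y v - (δ n : ℂ)⁻¹ • (f (y + (δ n : ℂ) • v) - f y)
        = -((δ n : ℂ)⁻¹ • (f (y + (δ n : ℂ) • v) - f y - fderiv ℂ f y ((δ n : ℂ) • v))) := by
      rw [map_smul, smul_sub _ (_ - _), inv_smul_smul₀ h3]; abel
    rw [dist_eq_norm, h4, norm_neg, norm_smul, norm_inv, h2]
    refine lt_of_le_of_lt ?_ hn
    rw [norm_smul, h2] at h1
    rw [inv_mul_le_iff₀ (hδ0 n)]
    refine h1.trans_eq ?_
    field_simp

end Holomorphic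

/-! ### Analyticity of complex differentiable maps -/

section Holomorphic

open Filter Topology Metric

variable {E F : Type*} [NormedAddCommGroup E] [NormedSpace ℂ E] [NormedAddCommGroup F]
  [NormedSpace ℂ F]

theorem DifferentiableOn.contDiffOn_nat_complex [FiniteDimensional ℂ E] [CompleteSpace F]
    {U : Set E} (hU : IsOpen U) (n : ℕ) :
    ∀ {f : E → F}, DifferentiableOn ℂ f U → ContDiffOn ℂ n f U := by
  induction n with
  | zero => intro f hf; simpa using hf.continuousOn
  | succ n ih =>
    intro f hf
    refine contDiffOn_succ_of_fderiv_apply (n := (n : ℕ)) hf (fun h => by simp at h) fun y => ?_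
    refine (ih ((hf.fderiv_complex hU).clm_apply (differentiableOn_const y))).congr fun x hx => ?_
    rw [fderivWithin_of_isOpen hU hx]

theorem DifferentiableOn.iteratedFDeriv_complex [FiniteDimensional ℂ E] [CompleteSpace F]
    {f : E → F} {U : Set E} (hU : IsOpen U) (hf : DifferentiableOn ℂ f U) (n : ℕ) :
    DifferentiableOn ℂ (iteratedFDeriv ℂ n f) U := fun x hx =>
  (((hf.contDiffOn_nat_complex hU (n + 1)).contDiffAt (hU.mem_nhds hx)).differentiableAt_iteratedFDeriv
    (m := n) (by exact_mod_cast n.lt_succ_self)).differentiableWithinAt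

/-- Each differentiation costs δ of the radius and, by Cauchy's estimate, a factor 2/δ. -/
theorem norm_iteratedFDeriv_le_of_norm_le_on_ball [FiniteDimensional ℂ E] [CompleteSpace F]
    {f : E → F} {x : E} {R M δ : ℝ} (hδ : 0 < δ) (hf : DifferentiableOn ℂ f (ball x R))
    (hM : ∀ z ∈ ball x R, ‖f z‖ ≤ M) (n : ℕ) :
    ∀ y ∈ ball x (R - n * δ), ‖iteratedFDeriv ℂ n f y‖ ≤ M * (2 / δ) ^ n := by
  induction n with
  | zero => intro y hy; simpa using hM y (by simpa using hy)
  | succ n ih =>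
    intro y hy
    rw [← norm_fderiv_iteratedFDeriv]
    have hsub : ball y δ ⊆ ball x (R - n * δ) := ball_subset_ball' (by
      have := mem_ball.1 hy; push_cast at this; linarith)
    have hsub' : ball x (R - n * δ) ⊆ ball x R :=
      ball_subset_ball (by nlinarith [n.cast_nonneg (α := ℝ)])
    refine (norm_fderiv_le_of_norm_le_on_ball hδ
      (((hf.iteratedFDeriv_complex isOpen_ball n).mono hsub').mono hsub)
      (fun z hz => ih z (hsub hz))).trans_eq ?_
    rw [pow_succ]; ring

theorem iteratedDeriv_comp_line [FiniteDimensional ℂ E] [CompleteSpace F] {f : E → F} {U : Set E}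
    (hU : IsOpen U) (hf : DifferentiableOn ℂ f U) (x y : E) (n : ℕ) :
    ∀ t : ℂ, x + t • y ∈ U →
      iteratedDeriv n (fun t : ℂ => f (x + t • y)) t
        = iteratedFDeriv ℂ n f (x + t • y) (fun _ => y) := by
  induction n with
  | zero => intro t _; simp
  | succ n ih =>
    intro t ht
    have hopen : IsOpen {t : ℂ | x + t • y ∈ U} := hU.preimage (by fun_prop)
    rw [iteratedDeriv_succ]
    have hev : iteratedDeriv n (fun t : ℂ => f (x + t • y))
        =ᶠ[𝓝 t] fun t => iteratedFDeriv ℂ n f (x + t • y) (fun _ => y) := by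
      filter_upwards [hopen.mem_nhds ht] with s hs using ih s hs
    rw [hev.deriv_eq]
    have h1 := ((hf.iteratedFDeriv_complex hU n).differentiableAt (hU.mem_nhds ht)).hasFDerivAt
    have h2 : HasDerivAt (fun t : ℂ => x + t • y) y t := by
      simpa using ((hasDerivAt_id t).smul_const y).const_add x
    have h3 := h1.comp_hasDerivAt t h2
    have h4 := (ContinuousMultilinearMap.apply ℂ (fun _ : Fin n => E) F (fun _ => y)).hasFDerivAt.comp_hasDerivAt t h3
    rw [iteratedFDeriv_succ_apply_left]
    exact h4.deriv

/-- A map that is complex differentiable on an open subset of a finite-dimensional space is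
analytic there. -/
theorem DifferentiableOn.analyticAt_complex [FiniteDimensional ℂ E] [CompleteSpace F] {f : E → F}
    {U : Set E} (hU : IsOpen U) (hf : DifferentiableOn ℂ f U) {x : E} (hx : x ∈ U) :
    AnalyticAt ℂ f x := by
  have hcont : ContinuousAt f x := hf.continuousOn.continuousAt (hU.mem_nhds hx)
  obtain ⟨R, hR, hRU, hb⟩ : ∃ r > 0, ball x r ⊆ U ∧ ∀ y ∈ ball x r, ‖f y‖ ≤ ‖f x‖ + 1 := by
    have h1 : ∀ᶠ y in 𝓝 x, y ∈ U ∧ ‖f y‖ ≤ ‖f x‖ + 1 :=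
      (hU.eventually_mem hx).and ((hcont.norm.eventually (gt_mem_nhds (lt_add_one _))).mono
        fun y hy => hy.le)
    obtain ⟨r, hr, h⟩ := Metric.eventually_nhds_iff_ball.1 h1
    exact ⟨r, hr, fun y hy => (h y hy).1, fun y hy => (h y hy).2⟩
  set M := ‖f x‖ + 1
  have hM0 : 0 ≤ M := by positivity
  replace hf := hf.mono hRU
  set e := Real.exp 1
  have he : 1 ≤ e := Real.one_le_exp zero_le_one
  let p : FormalMultilinearSeries ℂ E F := fun n => (n.factorial : ℂ)⁻¹ • iteratedFDeriv ℂ n f x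
  have hp : ∀ n, ‖p n‖ ≤ M * e * (2 * e / R) ^ n := by
    intro n
    -- With δ = R/(n+1), n differentiations use less than R of the radius, so the bound survives at
    -- the centre. Since (n+1)^n / n! ≤ e^(n+1), it becomes geometric after division by n!.
    have h1 := norm_iteratedFDeriv_le_of_norm_le_on_ball (δ := R / (n + 1)) (by positivity) hf hb n x
      (mem_ball_self (by
        rw [sub_pos, mul_div_assoc', div_lt_iff₀ (by positivity)]; nlinarith))
    have h2 := Real.pow_div_factorial_le_exp ((n : ℝ) + 1) (by positivity) n
    have h3 : ‖p n‖ = (n.factorial : ℝ)⁻¹ * ‖iteratedFDeriv ℂ n f x‖ := by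
      simp [p, norm_smul]
    have h4 : Real.exp ((n : ℝ) + 1) = e * e ^ n := by
      rw [Real.exp_add, mul_comm, ← Real.exp_nat_mul, mul_one]
    rw [h4] at h2
    rw [h3]
    calc _ ≤ (n.factorial : ℝ)⁻¹ * (M * (2 / (R / (n + 1))) ^ n) := by gcongr
      _ = M * (2 / R) ^ n * (((n : ℝ) + 1) ^ n / n.factorial) := by
          rw [show 2 / (R / ((n : ℝ) + 1)) = (2 / R) * (n + 1) by field_simp, mul_pow]; ring
      _ ≤ M * (2 / R) ^ n * (e * e ^ n) := by gcongr
      _ = _ := by rw [show 2 * e / R = 2 / R * e by ring, mul_pow]; ring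
  have hr0 : 0 < R / (2 * e) := by positivity
  let r : NNReal := ⟨R / (2 * e), hr0.le⟩
  refine HasFPowerSeriesAt.analyticAt (p := p) ⟨(r : ENNReal), ?_, ?_, ?_⟩
  · refine p.le_radius_of_bound (M * e) fun n => ?_
    have hrr : (r : ℝ) = R / (2 * e) := rfl
    calc _ ≤ M * e * (2 * e / R) ^ n * (r : ℝ) ^ n := by gcongr; exact hp n
      _ = M * e := by
        rw [mul_assoc, ← mul_pow, hrr]
        have : 2 * e / R * (R / (2 * e)) = 1 := by field_simp
        rw [this, one_pow, mul_one]
  · exact_mod_cast hr0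
  · intro y hy
    have hy1 : ‖y‖ < R / (2 * e) := by
      rw [Metric.eball_coe, mem_ball_zero_iff] at hy
      exact hy
    have hy2 : 2 * ‖y‖ < R := by
      rw [lt_div_iff₀ (by positivity)] at hy1
      nlinarith [norm_nonneg y]
    have hmem : ∀ t ∈ ball (0 : ℂ) 2, x + t • y ∈ ball x R := fun t ht => by
      rw [mem_ball_zero_iff] at ht
      rw [mem_ball, dist_eq_norm, add_sub_cancel_left, norm_smul]
      nlinarith [norm_nonneg y]
    -- The restriction to the complex line through x in the direction y is holomorphic for |t| < 2,
    -- so the one-variable Taylor series sums to f(x + y) at t = 1.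
    have hg : DifferentiableOn ℂ (fun t : ℂ => f (x + t • y)) (ball 0 2) :=
      hf.comp (f := fun t : ℂ => x + t • y) (by fun_prop) hmem
    have h1 := Complex.hasSum_taylorSeries_on_ball hg (z := 1) (by simp)
    have h2 : ∀ n, iteratedDeriv n (fun t : ℂ => f (x + t • y)) 0
        = iteratedFDeriv ℂ n f x (fun _ => y) := fun n => by
      have := iteratedDeriv_comp_line isOpen_ball hf x y n 0 (hmem 0 (by simp))
      simpa using this
    simpa [h2, p] using h1

theorem eventually_differentiableAt_of_analyticAt [CompleteSpace F] {f : E → F} {x : E}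
    (hf : AnalyticAt ℂ f x) : ∀ᶠ y in 𝓝 x, DifferentiableAt ℂ f y :=
  hf.eventually_analyticAt.mono fun _ h => h.differentiableAt

open MeasureTheory in
/-- An integral over `[0, 1]` that depends holomorphically on a parameter. -/
theorem differentiableOn_integral_of_differentiableOn [FiniteDimensional ℂ E] [CompleteSpace F]
    {g : ℂ × E → F} {W : Set (ℂ × E)} {U : Set E} (hW : IsOpen W) (hU : IsOpen U)
    (hg : DifferentiableOn ℂ g W) (hWU : ∀ t ∈ Icc (0 : ℝ) 1, ∀ z ∈ U, ((t : ℂ), z) ∈ W) :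
    DifferentiableOn ℂ (fun z => ∫ t in (0 : ℝ)..1, g (t, z)) U := by
  intro z₀ hz₀
  have := FiniteDimensional.proper ℂ E
  obtain ⟨r, hr, hrU⟩ := Metric.nhds_basis_closedBall.mem_iff.1 (hU.mem_nhds hz₀)
  let g' : E → ℝ → E →L[ℂ] F := fun z t => (fderiv ℂ g ((t : ℂ), z)).comp (.inr ℂ ℂ E)
  have hcg : ContinuousOn (fun q : ℝ × E => fderiv ℂ g ((q.1 : ℂ), q.2)) (Icc 0 1 ×ˢ U) :=
    (hg.fderiv_complex hW).continuousOn.comp (by fun_prop) fun q hq => hWU _ hq.1 _ hq.2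
  have hcz : ∀ z ∈ U, ContinuousOn (fun t : ℝ => g ((t : ℂ), z)) (Icc 0 1) := fun z hz =>
    hg.continuousOn.comp (by fun_prop) fun t ht => hWU t ht z hz
  obtain ⟨C, hC⟩ : ∃ C, ∀ q ∈ Icc (0 : ℝ) 1 ×ˢ closedBall z₀ r,
      ‖(fderiv ℂ g ((q.1 : ℂ), q.2))‖ ≤ C :=
    (isCompact_Icc.prod (isCompact_closedBall z₀ r)).exists_bound_of_continuousOn
      (hcg.mono (prod_mono_right hrU))
  have hCb : ∀ t ∈ Ioc (0 : ℝ) 1, ∀ z ∈ closedBall z₀ r, ‖g' z t‖ ≤ C * ‖ContinuousLinearMap.inr ℂ ℂ E‖ :=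
    fun t ht z hz => (ContinuousLinearMap.opNorm_comp_le _ _).trans
      (by gcongr; exact hC (t, z) ⟨Ioc_subset_Icc_self ht, hz⟩)
  have hmeas : ∀ {φ : ℝ → F}, ContinuousOn φ (Icc 0 1) →
      IntegrableOn φ (Ioc 0 1) := fun h =>
    (h.integrableOn_compact isCompact_Icc).mono_set Ioc_subset_Icc_self
  have hmeas' : ∀ {φ : ℝ → E →L[ℂ] F}, ContinuousOn φ (Icc 0 1) → IntegrableOn φ (Ioc 0 1) :=
    fun h => (h.integrableOn_compact isCompact_Icc).mono_set Ioc_subset_Icc_self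
  have key := hasFDerivAt_integral_of_dominated_of_fderiv_le (𝕜 := ℂ)
    (μ := volume.restrict (Ioc (0 : ℝ) 1)) (F := fun z t => g ((t : ℂ), z)) (F' := g') (x₀ := z₀)
    (bound := fun _ => C * ‖ContinuousLinearMap.inr ℂ ℂ E‖)
    (closedBall_mem_nhds z₀ hr)
    (by
      filter_upwards [hU.mem_nhds hz₀] with z hz
      exact (hmeas (hcz z hz)).aestronglyMeasurable)
    (hmeas (hcz z₀ hz₀))
    (hmeas' (φ := g' z₀) (by
      have h : ContinuousOn (fun t : ℝ => fderiv ℂ g ((t : ℂ), z₀)) (Icc 0 1) :=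
        hcg.comp (f := fun t : ℝ => (t, z₀)) (by fun_prop) fun t ht => ⟨ht, hz₀⟩
      exact h.clm_comp (continuousOn_const (c := ContinuousLinearMap.inr ℂ ℂ E)))).aestronglyMeasurable
    (by
      filter_upwards [ae_restrict_mem measurableSet_Ioc] with t ht z hz using hCb t ht z hz)
    (integrable_const _)
    (by
      filter_upwards [ae_restrict_mem measurableSet_Ioc] with t ht z hz
      have h1 := (hg.differentiableAt (hW.mem_nhds
        (hWU t (Ioc_subset_Icc_self ht) z (hrU hz)))).hasFDerivAt
      exact h1.comp z (hasFDerivAt_prodMk_right (t : ℂ) z))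
  simp only [intervalIntegral.integral_of_le zero_le_one]
  exact key.differentiableAt.differentiableWithinAt

end Holomorphic

/-! ### Picard iteration along rays -/

section Frobenius

open Filter Topology Metric

variable {E G : Type*} [NormedAddCommGroup E] [NormedSpace ℂ E] [NormedAddCommGroup G]

theorem norm_ray_le {t : ℝ} (ht : t ∈ Icc (0 : ℝ) 1) (z : E × G) :
    ‖(((t : ℂ) • z.1, z.2) : E × G)‖ ≤ ‖z‖ := by
  rw [Prod.norm_def, Prod.norm_def]
  refine max_le_max ?_ le_rfl
  rw [norm_smul, Complex.norm_real, Real.norm_eq_abs, abs_of_nonneg ht.1]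
  exact mul_le_of_le_one_left (norm_nonneg _) ht.2

theorem ray_mem_ball {t r : ℝ} (ht : t ∈ Icc (0 : ℝ) 1) {z : E × G} (hz : z ∈ ball (0 : E × G) r) :
    (((t : ℂ) • z.1, z.2) : E × G) ∈ ball (0 : E × G) r := by
  rw [mem_ball_zero_iff] at *
  exact (norm_ray_le ht z).trans_lt hz

variable [NormedSpace ℂ G]

/-- The Picard operator of the total differential equation `D_u F(u, v) = f (u, F(u, v))`,
`F(0, v) = v`, integrated along rays. -/
def picardRay (f : E × G → E →L[ℂ] G) (F : E × G → G) (z : E × G) : G :=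
  z.2 + ∫ t in (0 : ℝ)..1, f ((t : ℂ) • z.1, F ((t : ℂ) • z.1, z.2)) z.1

variable [FiniteDimensional ℂ E] [FiniteDimensional ℂ G]

/-- On a small ball the operator preserves holomorphic maps bounded by 3R/4 and halves uniform
distances, so its iterates converge uniformly to a holomorphic fixed point. Involutivity plays no
role yet: the fixed point solves the equation only in the radial direction. -/
theorem exists_picardRay_fixedPoint {f : E × G → E →L[ℂ] G} {R M L : ℝ} (hR : 0 < R)
    (hf : DifferentiableOn ℂ f (ball 0 R)) (hM : ∀ z ∈ ball (0 : E × G) R, ‖f z‖ ≤ M)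
    (hL0 : 0 ≤ L)
    (hL : ∀ z ∈ ball (0 : E × G) R, ∀ z' ∈ ball (0 : E × G) R, ‖f z - f z'‖ ≤ L * ‖z - z'‖) :
    ∃ r, 0 < r ∧ r ≤ R ∧ ∃ F : E × G → G, DifferentiableOn ℂ F (ball 0 r) ∧
      (∀ z ∈ ball (0 : E × G) r, ‖F z‖ < R) ∧ ∀ z ∈ ball (0 : E × G) r, F z = picardRay f F z := by
  have : CompleteSpace G := FiniteDimensional.complete ℂ G
  have hM0 : 0 ≤ M := (norm_nonneg _).trans (hM 0 (mem_ball_self hR))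
  have hLR : 0 ≤ L * R := by positivity
  -- This radius gives r ≤ R/4 and Mr ≤ R/4, which keep the iterates inside the domain of `f`, and
  -- Lr ≤ 1/2, which is the contraction factor.
  set r := R / (4 * (1 + M + L * R)) with hr
  have hr0 : 0 < r := by positivity
  have hmul : r * (4 * (1 + M + L * R)) = R := by rw [hr]; field_simp
  have hrR : r ≤ R / 4 := by nlinarith [mul_nonneg hr0.le hM0, mul_nonneg hr0.le hLR]
  have hrM : M * r ≤ R / 4 := by nlinarith [mul_nonneg hr0.le hLR]
  have hrL : L * r ≤ 1 / 2 := by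
    have : L * r * R ≤ 1 / 2 * R := by nlinarith [mul_nonneg hr0.le hM0]
    exact le_of_mul_le_mul_right this hR
  let Inv : (E × G → G) → Prop := fun F =>
    DifferentiableOn ℂ F (ball 0 r) ∧ ∀ z ∈ ball (0 : E × G) r, ‖F z‖ ≤ 3 * R / 4
  have hmemR : ∀ F, Inv F → ∀ z ∈ ball (0 : E × G) r, (z.1, F z) ∈ ball (0 : E × G) R := by
    intro F hF z hz
    rw [mem_ball_zero_iff, Prod.norm_def, max_lt_iff]
    have h1 := norm_fst_le z
    have h2 := hF.2 z hz
    rw [mem_ball_zero_iff] at hz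
    constructor <;> dsimp only <;> linarith
  have hdiffg : ∀ F, Inv F → DifferentiableOn ℂ
      (fun q : ℂ × (E × G) => f (q.1 • q.2.1, F (q.1 • q.2.1, q.2.2)) q.2.1)
      {q | (q.1 • q.2.1, q.2.2) ∈ ball (0 : E × G) r} := by
    intro F hF
    have h1 : DifferentiableOn ℂ (fun q : ℂ × (E × G) => F (q.1 • q.2.1, q.2.2))
        {q | (q.1 • q.2.1, q.2.2) ∈ ball (0 : E × G) r} :=
      hF.1.comp (f := fun q : ℂ × (E × G) => (q.1 • q.2.1, q.2.2)) (by fun_prop) fun q hq => hq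
    have h2 : DifferentiableOn ℂ
        (fun q : ℂ × (E × G) => f (q.1 • q.2.1, F (q.1 • q.2.1, q.2.2)))
        {q | (q.1 • q.2.1, q.2.2) ∈ ball (0 : E × G) r} :=
      hf.comp (f := fun q : ℂ × (E × G) => (q.1 • q.2.1, F (q.1 • q.2.1, q.2.2)))
        (DifferentiableOn.prodMk (by fun_prop) h1) fun q hq => hmemR F hF _ hq
    exact h2.clm_apply (by fun_prop)
  have hWopen : IsOpen {q : ℂ × (E × G) | (q.1 • q.2.1, q.2.2) ∈ ball (0 : E × G) r} :=
    isOpen_ball.preimage (by fun_prop)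
  have hint : ∀ F, Inv F → ∀ z ∈ ball (0 : E × G) r, IntervalIntegrable
      (fun t : ℝ => f ((t : ℂ) • z.1, F ((t : ℂ) • z.1, z.2)) z.1) MeasureTheory.volume 0 1 := by
    intro F hF z hz
    refine ContinuousOn.intervalIntegrable ?_
    rw [uIcc_of_le zero_le_one]
    exact (hdiffg F hF).continuousOn.comp (f := fun t : ℝ => ((t : ℂ), z)) (by fun_prop)
      fun t ht => ray_mem_ball ht hz
  have hstep : ∀ F, Inv F → Inv (picardRay f F) := by
    refine fun F hF => ⟨differentiableOn_snd.add
      (differentiableOn_integral_of_differentiableOn hWopen isOpen_ball (hdiffg F hF)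
        fun t ht z hz => ray_mem_ball ht hz), fun z hz => ?_⟩
    have h1 : ‖∫ t in (0 : ℝ)..1, f ((t : ℂ) • z.1, F ((t : ℂ) • z.1, z.2)) z.1‖
        ≤ M * r * |1 - 0| := by
      refine intervalIntegral.norm_integral_le_of_norm_le_const fun t ht => ?_
      rw [uIoc_of_le zero_le_one] at ht
      refine (ContinuousLinearMap.le_opNorm _ _).trans ?_
      have h2 := norm_fst_le z
      rw [mem_ball_zero_iff] at hz
      gcongr
      · exact hM _ (hmemR F hF _ (ray_mem_ball (Ioc_subset_Icc_self ht) (by simpa using hz)))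
      · linarith
    have h2 := norm_snd_le z
    rw [mem_ball_zero_iff] at hz
    rw [sub_zero, abs_one, mul_one] at h1
    refine (norm_add_le _ _).trans ?_
    linarith
  have hcontr : ∀ F F', Inv F → Inv F' → ∀ c, (∀ z ∈ ball (0 : E × G) r, ‖F z - F' z‖ ≤ c) →
      ∀ z ∈ ball (0 : E × G) r, ‖picardRay f F z - picardRay f F' z‖ ≤ c / 2 := by
    intro F F' hF hF' c hc z hz
    have hc0 : 0 ≤ c := (norm_nonneg _).trans (hc z hz)
    have h1 : picardRay f F z - picardRay f F' z = ∫ t in (0 : ℝ)..1,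
        (f ((t : ℂ) • z.1, F ((t : ℂ) • z.1, z.2)) z.1
          - f ((t : ℂ) • z.1, F' ((t : ℂ) • z.1, z.2)) z.1) := by
      rw [intervalIntegral.integral_sub (hint F hF z hz) (hint F' hF' z hz)]
      simp only [picardRay]; abel
    have h2 : ‖picardRay f F z - picardRay f F' z‖ ≤ L * c * r * |1 - 0| := by
      rw [h1]
      refine intervalIntegral.norm_integral_le_of_norm_le_const fun t ht => ?_
      rw [uIoc_of_le zero_le_one] at ht
      have hzt := ray_mem_ball (Ioc_subset_Icc_self ht) hz
      rw [← sub_apply]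
      refine (ContinuousLinearMap.le_opNorm _ _).trans ?_
      have h3 := hL _ (hmemR F hF _ hzt) _ (hmemR F' hF' _ hzt)
      have h4 := hc _ hzt
      have h5 := norm_fst_le z
      rw [mem_ball_zero_iff] at hz
      rw [Prod.mk_sub_mk, sub_self, Prod.norm_def, norm_zero,
        max_eq_right (norm_nonneg _)] at h3
      gcongr
      · exact h3.trans (by gcongr)
      · linarith
    rw [sub_zero, abs_one, mul_one] at h2
    nlinarith
  let F : ℕ → E × G → G := fun n => (picardRay f)^[n] Prod.snd
  have hFs : ∀ n, F (n + 1) = picardRay f (F n) := fun n => Function.iterate_succ_apply' _ _ _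
  have hInv : ∀ n, Inv (F n) := by
    intro n
    induction n with
    | zero =>
      refine ⟨differentiableOn_snd, fun z hz => ?_⟩
      have h2 := norm_snd_le z
      rw [mem_ball_zero_iff] at hz
      change ‖z.2‖ ≤ _
      linarith
    | succ n ih => rw [hFs]; exact hstep _ ih
  have hdist : ∀ n, ∀ z ∈ ball (0 : E × G) r, ‖F n z - F (n + 1) z‖ ≤ 3 * R / 2 / 2 ^ n := by
    intro n
    induction n with
    | zero =>
      intro z hz
      have := norm_sub_le (F 0 z) (F 1 z)
      have h1 := (hInv 0).2 z hz
      have h2 := (hInv 1).2 z hz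
      rw [pow_zero, div_one, zero_add]
      linarith
    | succ n ih =>
      intro z hz
      have := hcontr _ _ (hInv n) (hInv (n + 1)) _ ih z hz
      rw [← hFs, ← hFs] at this
      refine this.trans_eq ?_
      rw [pow_succ]; field_simp
  have hcs : ∀ z ∈ ball (0 : E × G) r, ∃ l, Tendsto (fun n => F n z) atTop (𝓝 l) := fun z hz =>
    cauchySeq_tendsto_of_complete (cauchySeq_of_le_geometric_two (C := 3 * R) fun n => by
      rw [dist_eq_norm]; exact hdist n z hz)
  choose! Fl hFl using hcs
  have hlim : ∀ n, ∀ z ∈ ball (0 : E × G) r, ‖F n z - Fl z‖ ≤ 3 * R / 2 ^ n := fun n z hz => by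
    rw [← dist_eq_norm]
    exact dist_le_of_le_geometric_two_of_tendsto (C := 3 * R) (fun n => by
      rw [dist_eq_norm]; exact hdist n z hz) (hFl z hz) n
  have hto0 : Tendsto (fun n : ℕ => 3 * R / 2 ^ n) atTop (𝓝 0) := by
    have := (tendsto_pow_atTop_nhds_zero_of_lt_one (r := (1 / 2 : ℝ)) (by norm_num)
      (by norm_num)).const_mul (3 * R)
    simpa [div_eq_mul_inv] using this
  have hInvl : Inv Fl := by
    refine ⟨TendstoUniformlyOn.differentiableOn_complex isOpen_ball (fun n => (hInv n).1) ?_,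
      fun z hz => le_of_tendsto (hFl z hz).norm (Eventually.of_forall fun n => (hInv n).2 z hz)⟩
    rw [Metric.tendstoUniformlyOn_iff]
    intro ε hε
    filter_upwards [hto0.eventually (gt_mem_nhds hε)] with n hn z hz
    rw [dist_comm, dist_eq_norm]
    exact (hlim n z hz).trans_lt hn
  refine ⟨r, hr0, by linarith, Fl, hInvl.1, fun z hz => (hInvl.2 z hz).trans_lt (by linarith),
    fun z hz => ?_⟩
  refine tendsto_nhds_unique ((hFl z hz).comp (tendsto_add_atTop_nat 1)) ?_
  rw [tendsto_iff_norm_sub_tendsto_zero]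
  refine squeeze_zero (fun _ => norm_nonneg _) (fun n => ?_) (by simpa using hto0.div_const 2)
  simp only [Function.comp_apply, hFs]
  exact hcontr _ _ (hInv n) hInvl _ (hlim n) z hz

end Frobenius

/-! ### From radial solutions to the Frobenius theorem -/

section Frobenius

open Filter Topology Metric

variable {E G : Type*} [NormedAddCommGroup E] [NormedSpace ℂ E] [NormedAddCommGroup G]
  [NormedSpace ℂ G]

theorem hasDerivAt_ray (u : E) (v : G) (s : ℝ) :
    HasDerivAt (fun s : ℝ => (((s : ℂ) • u, v) : E × G)) (u, 0) s := by
  have h1 : HasDerivAt (fun s : ℝ => (s : ℂ)) 1 s := Complex.ofRealCLM.hasDerivAt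
  have h2 := h1.smul_const u
  rw [one_smul] at h2
  exact h2.prodMk (hasDerivAt_const s v)

variable [FiniteDimensional ℂ G]

/-- Along rays, a fixed point of the Picard operator solves the total differential equation. -/
theorem fderiv_radial_of_picardRay {f : E × G → E →L[ℂ] G} {F : E × G → G} {R r : ℝ}
    (hrR : r ≤ R) (hf : DifferentiableOn ℂ f (ball 0 R)) (hF : DifferentiableOn ℂ F (ball 0 r))
    (hFR : ∀ z ∈ ball (0 : E × G) r, ‖F z‖ < R)
    (hfix : ∀ z ∈ ball (0 : E × G) r, F z = picardRay f F z) :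
    ∀ z ∈ ball (0 : E × G) r, fderiv ℂ F z (z.1, 0) = f (z.1, F z) z.1 := by
  have : CompleteSpace G := FiniteDimensional.complete ℂ G
  rintro ⟨u, v⟩ hz
  have hmem : ∀ z ∈ ball (0 : E × G) r, (z.1, F z) ∈ ball (0 : E × G) R := fun z hz => by
    rw [mem_ball_zero_iff, Prod.norm_def, max_lt_iff]
    exact ⟨(norm_fst_le z).trans_lt ((mem_ball_zero_iff.1 hz).trans_le hrR), hFR z hz⟩
  let S : Set ℝ := {s | ((s : ℂ) • u, v) ∈ ball (0 : E × G) r}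
  have hS : IsOpen S := isOpen_ball.preimage (by fun_prop)
  have hIcc : Icc (0 : ℝ) 1 ⊆ S := fun t ht => ray_mem_ball ht hz
  have h1S : (1 : ℝ) ∈ S := hIcc (by simp)
  let φ : ℝ → G := fun s => f ((s : ℂ) • u, F ((s : ℂ) • u, v)) u
  have hφ : ContinuousOn φ S := by
    have h1 : ContinuousOn (fun s : ℝ => F ((s : ℂ) • u, v)) S :=
      hF.continuousOn.comp (f := fun s : ℝ => ((s : ℂ) • u, v)) (by fun_prop) fun s hs => hs
    have h2 : ContinuousOn (fun s : ℝ => f ((s : ℂ) • u, F ((s : ℂ) • u, v))) S :=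
      hf.continuousOn.comp (f := fun s : ℝ => ((s : ℂ) • u, F ((s : ℂ) • u, v)))
        (ContinuousOn.prodMk (by fun_prop) h1) fun s hs => hmem _ hs
    exact h2.clm_apply continuousOn_const
  have hF1 : HasDerivAt (fun s : ℝ => F ((s : ℂ) • u, v)) (fderiv ℂ F (u, v) (u, 0)) 1 := by
    have h1 := (hF.differentiableAt (isOpen_ball.mem_nhds hz)).hasFDerivAt.restrictScalars ℝ
    have h2 := hasDerivAt_ray u v 1
    have h3 : (((1 : ℝ) : ℂ) • u, v) = (u, v) := by simp
    rw [← h3] at h1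
    have h4 := HasFDerivAt.comp_hasDerivAt (1 : ℝ) h1 h2
    simpa [Function.comp_def] using h4
  have hF2 : HasDerivAt (fun s : ℝ => v + ∫ t in (0 : ℝ)..s, φ t) (φ 1) 1 := by
    refine (intervalIntegral.integral_hasDerivAt_right ?_ ?_ ?_).const_add v
    · refine (hφ.mono ?_).intervalIntegrable
      rwa [uIcc_of_le zero_le_one]
    · exact hφ.stronglyMeasurableAtFilter hS _ h1S
    · exact hφ.continuousAt (hS.mem_nhds h1S)
  -- Rescaling the integration variable turns the ray integral ending at (su, v) into an integral of
  -- `φ` over [0, s], which can be differentiated in s.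
  have heq : (fun s : ℝ => F ((s : ℂ) • u, v)) =ᶠ[𝓝 1] fun s => v + ∫ t in (0 : ℝ)..s, φ t := by
    filter_upwards [hS.mem_nhds h1S] with s hs
    rw [hfix _ hs, picardRay]
    dsimp only
    congr 1
    have := intervalIntegral.smul_integral_comp_mul_right (a := 0) (b := 1) φ s
    rw [zero_mul, one_mul] at this
    rw [← this, ← intervalIntegral.integral_smul]
    refine intervalIntegral.integral_congr fun t _ => ?_
    simp only [φ]
    rw [smul_smul, ← Complex.ofReal_mul, map_smul, Complex.coe_smul]
  have := (hF1.unique (hF2.congr_of_eventuallyEq heq))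
  simpa [φ] using this

variable [FiniteDimensional ℂ E]

/-- **Frobenius theorem** for total differential equations: an involutive equation
`D_u F(u, v) = f (u, F(u, v))` has a holomorphic solution with `F(0, v) = v`. -/
theorem exists_solution_total_differential_equation {f : E × G → E →L[ℂ] G}
    (hf : AnalyticAt ℂ f 0)
    (hinv : ∀ᶠ z in 𝓝 (0 : E × G), ∀ h k, fderiv ℂ f z (h, f z h) k = fderiv ℂ f z (k, f z k) h) :
    ∃ F : E × G → G, AnalyticAt ℂ F 0 ∧ (∀ᶠ z in 𝓝 (0 : E × G), z.1 = 0 → F z = z.2) ∧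
      ∀ᶠ z in 𝓝 (0 : E × G), ∀ h, fderiv ℂ F z (h, 0) = f (z.1, F z) h := by
  have : CompleteSpace G := FiniteDimensional.complete ℂ G
  obtain ⟨L, s, hs, hLs⟩ := (hf.contDiffAt (n := 1)).exists_lipschitzOnWith
  obtain ⟨R, hR, hball⟩ := Metric.eventually_nhds_iff_ball.1
    ((eventually_differentiableAt_of_analyticAt hf).and (hinv.and ((eventually_mem_set.2 hs).and
      (hf.continuousAt.norm.eventually (gt_mem_nhds (lt_add_one ‖f 0‖))))))
  have hfd : DifferentiableOn ℂ f (ball 0 R) := fun z hz => (hball z hz).1.differentiableWithinAt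
  have hlip : ∀ z ∈ ball (0 : E × G) R, ∀ z' ∈ ball (0 : E × G) R,
      ‖f z - f z'‖ ≤ L * ‖z - z'‖ := fun z hz z' hz' =>
    hLs.norm_sub_le (hball z hz).2.2.1 (hball z' hz').2.2.1
  have hfL : ∀ z ∈ ball (0 : E × G) R, ‖fderiv ℂ f z‖ ≤ L := fun z hz =>
    norm_fderiv_le_of_lipschitzOn ℂ (isOpen_ball.mem_nhds hz)
      (hLs.mono fun z hz => (hball z hz).2.2.1)
  obtain ⟨r, hr, hrR, F, hF, hFR, hfix⟩ := exists_picardRay_fixedPoint hR hfd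
    (fun z hz => (hball z hz).2.2.2.le) L.2 hlip
  have hrad := fderiv_radial_of_picardRay hrR hfd hF hFR hfix
  have hmem : ∀ z ∈ ball (0 : E × G) r, (z.1, F z) ∈ ball (0 : E × G) R := fun z hz => by
    rw [mem_ball_zero_iff, Prod.norm_def, max_lt_iff]
    exact ⟨(norm_fst_le z).trans_lt ((mem_ball_zero_iff.1 hz).trans_le hrR), hFR z hz⟩
  have hFan : ∀ z ∈ ball (0 : E × G) r, AnalyticAt ℂ F z := fun z hz =>
    hF.analyticAt_complex isOpen_ball hz
  refine ⟨F, hFan 0 (mem_ball_self hr), ?_, ?_⟩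
  · filter_upwards [isOpen_ball.mem_nhds (mem_ball_self hr)] with z hz hz1
    rw [hfix z hz, picardRay]
    simp [hz1]
  filter_upwards [isOpen_ball.mem_nhds (mem_ball_self hr)] with z₀ hz₀ h
  -- the defect of the equation in the direction `h`
  let A : E × G → G := fun z => fderiv ℂ F z (h, 0) - f (z.1, F z) h
  have hdF : ∀ z ∈ ball (0 : E × G) r, HasFDerivAt F (fderiv ℂ F z) z := fun z hz =>
    (hF.differentiableAt (isOpen_ball.mem_nhds hz)).hasFDerivAt
  have hddF : ∀ z ∈ ball (0 : E × G) r,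
      HasFDerivAt (fderiv ℂ F) (fderiv ℂ (fderiv ℂ F) z) z := fun z hz =>
    ((hF.fderiv_complex isOpen_ball).differentiableAt (isOpen_ball.mem_nhds hz)).hasFDerivAt
  have hdf : ∀ z ∈ ball (0 : E × G) r, HasFDerivAt (fun z => f (z.1, F z))
      ((fderiv ℂ f (z.1, F z)).comp ((ContinuousLinearMap.fst ℂ E G).prod (fderiv ℂ F z))) z :=
    fun z hz => HasFDerivAt.comp (f := fun z : E × G => (z.1, F z)) z
      (hfd.differentiableAt (isOpen_ball.mem_nhds (hmem z hz))).hasFDerivAt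
      (hasFDerivAt_fst.prodMk (hdF z hz))
  have hdA : ∀ z ∈ ball (0 : E × G) r, HasFDerivAt A
      ((fderiv ℂ (fderiv ℂ F) z).flip (h, 0) -
        ((fderiv ℂ f (z.1, F z)).comp
          ((ContinuousLinearMap.fst ℂ E G).prod (fderiv ℂ F z))).flip h) z := fun z hz => by
    have h1 := (hddF z hz).clm_apply (hasFDerivAt_const ((h, 0) : E × G) z)
    have h2 := (hdf z hz).clm_apply (hasFDerivAt_const h z)
    simpa using h1.fun_sub h2
  have hsymm : ∀ z ∈ ball (0 : E × G) r, ∀ a b,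
      fderiv ℂ (fderiv ℂ F) z a b = fderiv ℂ (fderiv ℂ F) z b a := fun z hz a b =>
    ((hFan z hz).contDiffAt (n := 2)).isSymmSndFDerivAt (by simp) a b
  -- The defect satisfies a linear transport equation along rays. Differentiating the radial
  -- equation in the direction `h` produces it; symmetry of D²F and involutivity of `f` cancel all
  -- terms free of the defect.
  have hAeq : ∀ z ∈ ball (0 : E × G) r, fderiv ℂ A z (z.1, 0)
      = fderiv ℂ f (z.1, F z) (0, A z) z.1 - A z := by
    intro z hz
    -- differentiate the radial equation in the direction `h`
    have e1 : HasFDerivAt (fun z : E × G => ((z.1, 0) : E × G))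
        ((ContinuousLinearMap.fst ℂ E G).prod 0) z :=
      hasFDerivAt_fst.prodMk (hasFDerivAt_const _ _)
    have e2 := (hddF z hz).clm_apply e1
    have e3 := (hdf z hz).clm_apply (hasFDerivAt_fst (𝕜 := ℂ) (p := z))
    have e4 : (fun z : E × G => fderiv ℂ F z (z.1, 0)) =ᶠ[𝓝 z] fun z => f (z.1, F z) z.1 := by
      filter_upwards [isOpen_ball.mem_nhds hz] with w hw using hrad w hw
    have e5 := DFunLike.congr_fun (e2.unique (e3.congr_of_eventuallyEq e4)) (h, 0)
    simp only [add_apply, ContinuousLinearMap.comp_apply, ContinuousLinearMap.flip_apply,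
      ContinuousLinearMap.prod_apply, zero_apply, ContinuousLinearMap.coe_fst'] at e5
    have e6 := (hball _ (hmem z hz)).2.1 z.1 h
    rw [(hdA z hz).fderiv]
    simp only [sub_apply, ContinuousLinearMap.comp_apply, ContinuousLinearMap.flip_apply,
      ContinuousLinearMap.prod_apply, ContinuousLinearMap.coe_fst']
    have e7 : fderiv ℂ F z (h, 0) = A z + f (z.1, F z) h := by simp [A]
    have e8 : ((h, fderiv ℂ F z (h, 0)) : E × G) = (0, A z) + (h, f (z.1, F z) h) := by
      simp [e7]
    rw [e8, map_add, add_apply, e7] at e5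
    rw [hrad z hz, e6, hsymm z hz]
    rw [← sub_eq_zero] at e5 ⊢
    refine Eq.trans ?_ e5
    abel
  obtain ⟨u, v⟩ := z₀
  -- The factor t absorbs the term -A of the transport equation: `ψ` solves a homogeneous linear
  -- equation with ψ(0) = 0, so it vanishes by Grönwall's inequality, and its value at t = 1 is the
  -- defect.
  let ψ : ℝ → G := fun t => (t : ℂ) • A ((t : ℂ) • u, v)
  have hψ : ∀ t ∈ Icc (0 : ℝ) 1,
      HasDerivAt ψ (fderiv ℂ f ((t : ℂ) • u, F ((t : ℂ) • u, v)) (0, ψ t) u) t := by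
    intro t ht
    have hz := ray_mem_ball ht hz₀
    have h1 := HasFDerivAt.comp_hasDerivAt t
      ((hdA _ hz).differentiableAt.hasFDerivAt.restrictScalars ℝ) (hasDerivAt_ray u v t)
    have h2 : HasDerivAt (fun s : ℝ => (s : ℂ)) 1 t := Complex.ofRealCLM.hasDerivAt
    have h3 := h2.smul h1
    refine h3.congr_deriv ?_
    have h4 := hAeq _ hz
    have h5 : (((t : ℂ) • u, 0) : E × G) = (t : ℂ) • (u, 0) := by simp
    have h6 : ((0, ψ t) : E × G) = (t : ℂ) • (0, A ((t : ℂ) • u, v)) := by simp [ψ]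
    simp only [h5, map_smul] at h4
    rw [h6, map_smul, smul_apply, ContinuousLinearMap.coe_restrictScalars', h4, one_smul,
      Function.comp_apply]
    abel
  have hzero := eq_zero_of_abs_deriv_le_mul_abs_self_of_eq_zero_right (f := ψ) (a := 0) (b := 1)
    (K := L * ‖u‖) (fun t ht => (hψ t ht).continuousAt.continuousWithinAt)
    (fun t ht => (hψ t (Ico_subset_Icc_self ht)).hasDerivWithinAt) (by simp [ψ])
    (fun t ht => by
      have hz := hmem _ (ray_mem_ball (Ico_subset_Icc_self ht) hz₀)
      refine (ContinuousLinearMap.le_opNorm _ _).trans ?_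
      have h1 := (fderiv ℂ f ((t : ℂ) • u, F ((t : ℂ) • u, v))).le_opNorm (0, ψ t)
      rw [Prod.norm_mk, norm_zero, max_eq_right (norm_nonneg _)] at h1
      have h2 := hfL _ hz
      calc _ ≤ (L * ‖ψ t‖) * ‖u‖ := by gcongr; exact h1.trans (by gcongr)
        _ = _ := by ring)
    1 (by simp)
  simpa [ψ, A, sub_eq_zero] using hzero

/-- **Frobenius theorem**: an involutive distribution, given as the graph of `f`, has a full set of
holomorphic first integrals. -/
theorem exists_first_integrals {f : E × G → E →L[ℂ] G} (hf : AnalyticAt ℂ f 0)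
    (hinv : ∀ᶠ z in 𝓝 (0 : E × G), ∀ h k, fderiv ℂ f z (h, f z h) k = fderiv ℂ f z (k, f z k) h) :
    ∃ W : E × G → G, AnalyticAt ℂ W 0 ∧ (∀ᶠ z in 𝓝 (0 : E × G), z.1 = 0 → W z = z.2) ∧
      ∀ᶠ z in 𝓝 (0 : E × G), ∀ h, fderiv ℂ W z (h, f z h) = 0 := by
  have : CompleteSpace G := FiniteDimensional.complete ℂ G
  have : CompleteSpace E := FiniteDimensional.complete ℂ E
  obtain ⟨F, hF, hF0, hFd⟩ := exists_solution_total_differential_equation hf hinv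
  -- The map `Ψ` straightens the foliation: it carries the slices v = const to the leaves, so the
  -- second component of its local inverse is constant along the leaves.
  let Ψ : E × G → E × G := fun z => (z.1, F z)
  have hΨ : AnalyticAt ℂ Ψ 0 := analyticAt_fst.prod hF
  have hΨ0 : Ψ 0 = 0 := by
    have := hF0.self_of_nhds rfl
    simp [Ψ, this]
  have hdF0 : ∀ b : G, fderiv ℂ F 0 (0, b) = b := by
    intro b
    have h1 : HasFDerivAt (fun v : G => F (0, v)) ((fderiv ℂ F 0).comp (.inr ℂ E G)) 0 :=
      HasFDerivAt.comp (f := fun v : G => ((0, v) : E × G)) 0 hF.differentiableAt.hasFDerivAt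
        (hasFDerivAt_prodMk_right 0 0)
    have h2 : (fun v : G => F (0, v)) =ᶠ[𝓝 0] id := by
      have h3 : Tendsto (fun v : G => ((0, v) : E × G)) (𝓝 0) (𝓝 0) :=
        Continuous.tendsto' (by fun_prop) _ _ rfl
      filter_upwards [h3.eventually hF0] with v hv using hv rfl
    exact DFunLike.congr_fun (h1.unique ((hasFDerivAt_id 0).congr_of_eventuallyEq h2)) b
  let Λ : E × G →L[ℂ] E × G := (ContinuousLinearMap.fst ℂ E G).prod (fderiv ℂ F 0)
  have hΛ : HasFDerivAt Ψ Λ 0 := hasFDerivAt_fst.prodMk hF.differentiableAt.hasFDerivAt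
  have hinj : Function.Injective (Λ : E × G →ₗ[ℂ] E × G) := by
    rw [injective_iff_map_eq_zero]
    rintro ⟨a, b⟩ hab
    have h1 : a = 0 := congrArg Prod.fst hab
    have h2 : fderiv ℂ F 0 (a, b) = 0 := congrArg Prod.snd hab
    rw [h1, hdF0] at h2
    simp [h1, h2]
  let e : (E × G) ≃L[ℂ] (E × G) :=
    (LinearEquiv.ofInjectiveEndo (Λ : E × G →ₗ[ℂ] E × G) hinj).toContinuousLinearEquiv
  have he : HasFDerivAt Ψ (e : E × G →L[ℂ] E × G) 0 := by
    exact hΛ.congr_fderiv (by ext <;> rfl)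
  have hΨc : ContDiffAt ℂ ω Ψ 0 := hΨ.contDiffAt
  let H := hΨc.toOpenPartialHomeomorph Ψ he (by simp)
  have h0s : (0 : E × G) ∈ H.source := hΨc.mem_toOpenPartialHomeomorph_source he (by simp)
  have hHΨ : ∀ z, H z = Ψ z := fun z => rfl
  have hHs0 : H.symm 0 = 0 := by
    have := H.left_inv h0s
    rwa [hHΨ, hΨ0] at this
  have h0t : (0 : E × G) ∈ H.target := by
    have := H.map_source h0s
    rwa [hHΨ, hΨ0] at this
  have hsymm : AnalyticAt ℂ H.symm 0 := by
    have := hΨc.to_localInverse he (by simp)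
    rw [hΨ0] at this
    exact this.analyticAt
  have hcs : Tendsto H.symm (𝓝 0) (𝓝 0) := by
    have := hsymm.continuousAt.tendsto
    rwa [hHs0] at this
  let W : E × G → G := fun z => (H.symm z).2
  have hW : AnalyticAt ℂ W 0 := analyticAt_snd.comp hsymm
  refine ⟨W, hW, ?_, ?_⟩
  · filter_upwards [hF0, H.open_source.mem_nhds h0s] with z hz hzs hz1
    have h1 := H.left_inv hzs
    have h2 : H z = z := by rw [hHΨ]; exact Prod.ext rfl (hz hz1)
    simp only [W]
    rw [h2] at h1
    rw [h1]
  · have hWd := eventually_differentiableAt_of_analyticAt hW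
    filter_upwards [hWd, hcs.eventually (eventually_differentiableAt_of_analyticAt hF),
      hcs.eventually hFd, H.open_target.mem_nhds h0t] with y hWy hFy hFdy hyt h
    set z := H.symm y with hzdef
    have hy : Ψ z = y := H.right_inv hyt
    have hzs : z ∈ H.source := H.map_target hyt
    have h1 : (fun z => W (Ψ z)) =ᶠ[𝓝 z] Prod.snd := by
      filter_upwards [H.open_source.mem_nhds hzs] with w hw
      exact congrArg Prod.snd (H.left_inv hw)
    have h2 : HasFDerivAt Ψ ((ContinuousLinearMap.fst ℂ E G).prod (fderiv ℂ F z)) z :=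
      hasFDerivAt_fst.prodMk hFy.hasFDerivAt
    rw [← hy] at hWy
    have h3 := (hWy.hasFDerivAt.comp z h2).unique
      ((hasFDerivAt_snd (𝕜 := ℂ) (p := z)).congr_of_eventuallyEq h1)
    have h4 := DFunLike.congr_fun h3 (h, 0)
    have h5 := hFdy h
    change fderiv ℂ F z (h, 0) = f (Ψ z) h at h5
    rw [← hy]
    simpa [h5] using h4

end Frobenius

/-! ### The null pencil and its holomorphic first integrals -/

section TwistorFunction

open Filter Topology

/-- The member `I + iμJ - μIJ` of the family of almost complex structures, whose eigenspace for the
eigenvalue `i` is `{q + μ J q | I q = i q}`. -/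
def nullPencil (I J : C4 → C4 →L[ℂ] C4) (μ : ℂ) (z : C4) : C4 →L[ℂ] C4 :=
  I z + (Complex.I * μ) • J z - μ • (I z).comp (J z)

/-- The quaternion relations for a pair of endomorphisms. -/
structure IsQuaternionicPair {V : Type*} [NormedAddCommGroup V] [NormedSpace ℂ V]
    (I J : V →L[ℂ] V) : Prop where
  sq_I : ∀ v, I (I v) = -v
  sq_J : ∀ v, J (J v) = -v
  anticomm : ∀ v, J (I v) = -I (J v)

namespace IsQuaternionicPair

variable {V : Type*} [NormedAddCommGroup V] [NormedSpace ℂ V] {I J : V →L[ℂ] V}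

/-- The coefficients 1, iμ, -μ of I, J, IJ have squares with sum 1, so the pencil consists of
imaginary unit quaternions. -/
theorem pencil_sq (h : IsQuaternionicPair I J) (μ : ℂ) (v : V) :
    (I + (Complex.I * μ) • J - μ • I.comp J) ((I + (Complex.I * μ) • J - μ • I.comp J) v) = -v := by
  simp only [sub_apply, add_apply, smul_apply, ContinuousLinearMap.comp_apply, map_sub, map_add,
    map_smul, h.sq_I, h.sq_J, h.anticomm, map_neg]
  match_scalars <;> ring_nf
  simp

/-- J exchanges the two eigenspaces of I, so Jq has eigenvalue -i; the terms with iμJ and -μIJ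
compensate for this. -/
theorem pencil_eigenvector (h : IsQuaternionicPair I J) (μ : ℂ) {q : V}
    (hq : I q = Complex.I • q) :
    (I + (Complex.I * μ) • J - μ • I.comp J) (q + μ • J q) = Complex.I • (q + μ • J q) := by
  have h1 : I (J q) = -(Complex.I • J q) := by
    have := h.anticomm q
    rw [hq, map_smul] at this
    rw [this, neg_neg]
  simp only [sub_apply, add_apply, smul_apply, ContinuousLinearMap.comp_apply, map_add,
    map_smul, h.sq_J, h1, hq, map_neg]
  match_scalars <;> ring_nf

end IsQuaternionicPair

/-- Infinitesimal integrability of the pencil at a point: the Lie bracket of two local sections of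
the `i`-eigenbundle of each member is a section. -/
def PencilInvolutiveAt (I J : C4 → C4 →L[ℂ] C4) (z : C4) : Prop :=
  ∀ (μ : ℂ) (X Y : C4 → C4),
    (∀ᶠ y in 𝓝 z, DifferentiableAt ℂ X y ∧ nullPencil I J μ y (X y) = Complex.I • X y) →
    (∀ᶠ y in 𝓝 z, DifferentiableAt ℂ Y y ∧ nullPencil I J μ y (Y y) = Complex.I • Y y) →
    nullPencil I J μ z (VectorField.lieBracket ℂ X Y z)
      = Complex.I • VectorField.lieBracket ℂ X Y z

/-- The `i`-eigenspaces of an analytic family of endomorphisms `N` of `E × E'` with `N² = -1` and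
`N 0 = diag(i, -i)` are graphs of an analytic family of maps. -/
theorem exists_graph_of_eigenspace {P V : Type*} [NormedAddCommGroup P] [NormedSpace ℂ P]
    [NormedAddCommGroup V] [NormedSpace ℂ V] [FiniteDimensional ℂ V]
    {N : P → V × V →L[ℂ] V × V} (hN : AnalyticAt ℂ N 0)
    (hN2 : ∀ᶠ p in 𝓝 0, ∀ v, N p (N p v) = -v)
    (hN0 : ∀ v, N 0 v = (Complex.I • v.1, -(Complex.I • v.2))) :
    ∃ f : P → V →L[ℂ] V, AnalyticAt ℂ f 0 ∧
      ∀ᶠ p in 𝓝 0, (∀ h, N p (h, f p h) = Complex.I • (h, f p h)) ∧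
        ∀ v, N p v = Complex.I • v → v.2 = f p v.1 := by
  have : CompleteSpace V := FiniteDimensional.complete ℂ V
  -- `Q` is the projection onto the i-eigenspace, with blocks `A`, `B` on the first factor. Near 0
  -- the block `A` is invertible, and the eigenspace is the graph of B A⁻¹.
  let Q : P → V × V →L[ℂ] V × V := fun p =>
    (1 / 2 : ℂ) • (ContinuousLinearMap.id ℂ (V × V) - Complex.I • N p)
  have hQ : AnalyticAt ℂ Q 0 := by
    simp only [Q]
    fun_prop
  have hcomp : ∀ (L : V × V →L[ℂ] V) (M : V →L[ℂ] V × V),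
      AnalyticAt ℂ (fun p => L.comp ((Q p).comp M)) 0 := fun L M =>
    ((ContinuousLinearMap.compL ℂ V (V × V) V L).analyticAt _).comp
      ((((ContinuousLinearMap.compL ℂ V (V × V) (V × V)).flip M).analyticAt _).comp hQ)
  let A : P → V →L[ℂ] V := fun p =>
    (ContinuousLinearMap.fst ℂ V V).comp ((Q p).comp (ContinuousLinearMap.inl ℂ V V))
  let B : P → V →L[ℂ] V := fun p =>
    (ContinuousLinearMap.snd ℂ V V).comp ((Q p).comp (ContinuousLinearMap.inl ℂ V V))
  let D : P → V →L[ℂ] V := fun p =>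
    (ContinuousLinearMap.snd ℂ V V).comp ((Q p).comp (ContinuousLinearMap.inr ℂ V V))
  have hA : AnalyticAt ℂ A 0 := hcomp _ _
  have hB : AnalyticAt ℂ B 0 := hcomp _ _
  have hD : AnalyticAt ℂ D 0 := hcomp _ _
  have hQ0 : ∀ v, Q 0 v = (v.1, 0) := fun v => by
    simp only [Q, smul_apply, sub_apply, ContinuousLinearMap.id_apply, hN0]
    ext1
    · simp only [Prod.smul_fst, Prod.fst_sub, smul_smul, Complex.I_mul_I]
      match_scalars; norm_num
    · simp only [Prod.smul_snd, Prod.snd_sub, smul_neg, smul_smul, Complex.I_mul_I]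
      match_scalars; norm_num
  have hA0 : A 0 = 1 := by ext v; simp [A, hQ0]
  have hD0 : D 0 = 0 := by ext v; simp [D, hQ0]
  have hAu : ∀ᶠ p in 𝓝 0, IsUnit (A p) := by
    refine hA.continuousAt.eventually (Units.isOpen.mem_nhds ?_)
    rw [hA0]; exact isUnit_one
  have hDs : ∀ᶠ p in 𝓝 0, ‖D p‖ < 1 := by
    refine hD.continuousAt.norm.eventually (gt_mem_nhds ?_)
    change ‖D 0‖ < 1
    rw [hD0, norm_zero]; exact one_pos
  let f : P → V →L[ℂ] V := fun p => B p * Ring.inverse (A p)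
  have hAinv : AnalyticAt ℂ (fun p => Ring.inverse (A p)) 0 := by
    have h1 : AnalyticAt ℂ Ring.inverse (A 0) := by
      rw [hA0]; exact analyticAt_inverse (𝕜 := ℂ) (A := V →L[ℂ] V) 1
    exact h1.comp hA
  have hNQ : ∀ {p}, (∀ v, N p (N p v) = -v) → ∀ v, N p (Q p v) = Complex.I • Q p v := by
    intro p h2 v
    simp only [Q, smul_apply, sub_apply, ContinuousLinearMap.id_apply, map_smul, map_sub, h2]
    match_scalars <;> ring_nf
    norm_num
  refine ⟨f, hB.mul hAinv, ?_⟩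
  filter_upwards [hN2, hAu, hDs] with p h2 hu hd
  have hgraph : ∀ h, N p (h, f p h) = Complex.I • (h, f p h) := by
    intro h
    have h1 : ((h, f p h) : V × V) = Q p (Ring.inverse (A p) h, 0) := by
      ext1
      · have := DFunLike.congr_fun (Ring.mul_inverse_cancel (A p) hu) h
        exact this.symm
      · rfl
    rw [h1]
    exact hNQ h2 _
  refine ⟨hgraph, fun v hv => ?_⟩
  -- An eigenvector off the graph would give an eigenvector (0, b) with b ≠ 0. It is fixed by `Q`,
  -- hence b is fixed by the corner block `D`, which has norm less than 1.
  set b := v.2 - f p v.1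
  have h1 : ((0, b) : V × V) = v - (v.1, f p v.1) := by ext1 <;> simp [b]
  have h3 : N p (0, b) = Complex.I • (0, b) := by rw [h1, map_sub, hv, hgraph, smul_sub]
  have h4 : Q p (0, b) = (0, b) := by
    simp only [Q, smul_apply, sub_apply, ContinuousLinearMap.id_apply, h3, smul_smul,
      Complex.I_mul_I]
    match_scalars; norm_num
  have h5 : D p b = b := congrArg Prod.snd h4
  have h6 : b = 0 := by
    by_contra hb
    have hb' : 0 < ‖b‖ := norm_pos_iff.2 hb
    have h7 := (D p).le_opNorm b
    rw [h5] at h7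
    nlinarith
  exact sub_eq_zero.1 h6

/-- A hypercomplex structure admits, near a point, a holomorphic family of pairs of first integrals
of the `i`-eigenbundles of the null pencil. -/
theorem exists_twistor_function {I J : C4 → C4 →L[ℂ] C4} (hI : AnalyticAt ℂ I 0)
    (hJ : AnalyticAt ℂ J 0) (hq : ∀ᶠ z in 𝓝 0, IsQuaternionicPair (I z) (J z))
    (hI0 : ∀ v, I 0 v = (Complex.I • v.1, -(Complex.I • v.2)))
    (hint : ∀ᶠ z in 𝓝 0, PencilInvolutiveAt I J z) :
    ∃ w : C4 × ℂ → (Fin 2 → ℂ), AnalyticAt ℂ w 0 ∧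
      (∀ᶠ q in 𝓝 (0 : C4 × ℂ), q.1.1 = 0 → w q = q.1.2) ∧
      ∀ᶠ q in 𝓝 (0 : C4 × ℂ), ∀ ξ, I q.1 ξ = Complex.I • ξ →
        fderiv ℂ w q (ξ + q.2 • J q.1 ξ, 0) = 0 := by
  let C2 := Fin 2 → ℂ
  let pr : C2 × (C2 × ℂ) →L[ℂ] C4 := (ContinuousLinearMap.fst ℂ C2 (C2 × ℂ)).prod
    ((ContinuousLinearMap.fst ℂ C2 ℂ).comp (ContinuousLinearMap.snd ℂ C2 (C2 × ℂ)))
  let l : C2 × (C2 × ℂ) →L[ℂ] ℂ :=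
    (ContinuousLinearMap.snd ℂ C2 ℂ).comp (ContinuousLinearMap.snd ℂ C2 (C2 × ℂ))
  have hpr0 : Tendsto pr (𝓝 0) (𝓝 0) := pr.continuous.tendsto' _ _ (map_zero _)
  let N : C2 × (C2 × ℂ) → C4 →L[ℂ] C4 := fun p => nullPencil I J (l p) (pr p)
  have hIpr : AnalyticAt ℂ (fun p => I (pr p)) 0 :=
    AnalyticAt.comp (by simpa using hI) (pr.analyticAt 0)
  have hJpr : AnalyticAt ℂ (fun p => J (pr p)) 0 :=
    AnalyticAt.comp (by simpa using hJ) (pr.analyticAt 0)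
  have hN : AnalyticAt ℂ N 0 := by
    have hl := l.analyticAt (0 : C2 × (C2 × ℂ))
    have hIJ : AnalyticAt ℂ (fun p => I (pr p) * J (pr p)) 0 := hIpr.mul hJpr
    exact (hIpr.add ((analyticAt_const.mul hl).smul hJpr)).sub (hl.smul hIJ)
  obtain ⟨f, hf, hfN⟩ := exists_graph_of_eigenspace (N := N) hN
    (by filter_upwards [hpr0.eventually hq] with p hp v using hp.pencil_sq _ v)
    (fun v => by simpa [N, nullPencil, pr, l] using! hI0 v)
  have hfd := eventually_differentiableAt_of_analyticAt hf
  -- The parameter μ is counted among the transverse coordinates with slope zero: leaves lie at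
  -- constant μ, and the Frobenius theorem delivers holomorphic dependence on μ as well.
  let f' : C2 × (C2 × ℂ) → C2 →L[ℂ] C2 × ℂ := fun p => (ContinuousLinearMap.inl ℂ C2 ℂ).comp (f p)
  have hf' : AnalyticAt ℂ f' 0 :=
    ((ContinuousLinearMap.compL ℂ C2 C2 (C2 × ℂ) (ContinuousLinearMap.inl ℂ C2 ℂ)).analyticAt _).comp
      hf
  have hdf' : ∀ p, DifferentiableAt ℂ f p → ∀ a k, fderiv ℂ f' p a k = (fderiv ℂ f p a k, 0) := by
    intro p hp a k
    have h1 := (ContinuousLinearMap.compL ℂ C2 C2 (C2 × ℂ)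
      (ContinuousLinearMap.inl ℂ C2 ℂ)).hasFDerivAt.comp p hp.hasFDerivAt
    have h2 : fderiv ℂ f' p = _ := h1.fderiv
    rw [h2]
    rfl
  obtain ⟨W, hW, hW0, hWd⟩ := exists_first_integrals hf' (by
    filter_upwards [hfN, hfN.eventually_nhds, hfd.eventually_nhds, hpr0.eventually hint] with
      p hp hp' hpd hpi h k
    have hpd0 := hpd.self_of_nhds
    let ι : C4 → C2 × (C2 × ℂ) := fun y => (y.1, (y.2, l p))
    have hι : Continuous ι := by fun_prop
    have hιp : ι (pr p) = p := rfl
    have hιd : ∀ y, HasFDerivAt ι ((ContinuousLinearMap.fst ℂ C2 C2).prod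
        ((ContinuousLinearMap.snd ℂ C2 C2).prod 0)) y := fun y =>
      hasFDerivAt_fst.prodMk (hasFDerivAt_snd.prodMk (hasFDerivAt_const _ _))
    have hιt : Tendsto ι (𝓝 (pr p)) (𝓝 p) := hι.tendsto' _ _ hιp
    let X : C2 → C4 → C4 := fun h y => (h, f (ι y) h)
    have hX : ∀ h y, DifferentiableAt ℂ f (ι y) → HasFDerivAt (X h)
        ((0 : C4 →L[ℂ] C2).prod (((fderiv ℂ f (ι y)).comp ((ContinuousLinearMap.fst ℂ C2 C2).prod
        ((ContinuousLinearMap.snd ℂ C2 C2).prod 0))).flip h)) y := fun h y hy => by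
      have h1 := (hy.hasFDerivAt.comp y (hιd y)).clm_apply (hasFDerivAt_const h y)
      refine (hasFDerivAt_const h y).prodMk ?_
      simpa [Function.comp_def] using h1
    have hXe : ∀ h, ∀ᶠ y in 𝓝 (pr p), DifferentiableAt ℂ (X h) y ∧
        nullPencil I J (l p) y (X h y) = Complex.I • X h y := fun h => by
      filter_upwards [hιt.eventually hp', hιt.eventually hpd] with y hy hyd
      exact ⟨(hX h y hyd).differentiableAt, hy.1 h⟩
    -- The bracket of two such sections has vanishing x-component and lies in the eigenbundle, which
    -- is a graph over the x-directions; hence it is zero, which is the involutivity condition for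
    -- `f`.
    have hbr := hpi (l p) (X h) (X k) (hXe h) (hXe k)
    have h1 := hp.2 _ hbr
    rw [VectorField.lieBracket, (hX h (pr p) hpd0).fderiv, (hX k (pr p) hpd0).fderiv] at h1
    rw [hdf' p hpd0, hdf' p hpd0]
    simp only [ContinuousLinearMap.prod_apply, zero_apply, ContinuousLinearMap.flip_apply,
      ContinuousLinearMap.comp_apply, Prod.mk_sub_mk, sub_self, map_zero, hιp] at h1
    have h2 := sub_eq_zero.1 h1
    exact Prod.ext h2 rfl)
  let τ : C4 × ℂ →L[ℂ] C2 × (C2 × ℂ) :=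
    ((ContinuousLinearMap.fst ℂ C2 C2).comp (ContinuousLinearMap.fst ℂ C4 ℂ)).prod
      (((ContinuousLinearMap.snd ℂ C2 C2).comp (ContinuousLinearMap.fst ℂ C4 ℂ)).prod
        (ContinuousLinearMap.snd ℂ C4 ℂ))
  have hτ0 : Tendsto τ (𝓝 0) (𝓝 0) := τ.continuous.tendsto' _ _ (map_zero _)
  have hWτ : AnalyticAt ℂ (fun q => W (τ q)) 0 :=
    AnalyticAt.comp (by simpa using hW) (τ.analyticAt 0)
  refine ⟨fun q => (W (τ q)).1, analyticAt_fst.comp hWτ, ?_, ?_⟩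
  · filter_upwards [hτ0.eventually hW0] with q hq0 hq1
    exact congrArg Prod.fst (hq0 hq1)
  · filter_upwards [hτ0.eventually hWd, hτ0.eventually hfN,
      hτ0.eventually (eventually_differentiableAt_of_analyticAt hW),
      (continuous_fst.tendsto' (0 : C4 × ℂ) 0 rfl).eventually hq] with q h1 h2 h3 h4 ξ hξ
    have h5 := h2.2 _ (h4.pencil_eigenvector q.2 hξ)
    have h6 : HasFDerivAt (fun q => (W (τ q)).1) ((ContinuousLinearMap.fst ℂ C2 ℂ).comp
        ((fderiv ℂ W (τ q)).comp τ)) q :=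
      hasFDerivAt_fst.comp q (h3.hasFDerivAt.comp q τ.hasFDerivAt)
    rw [h6.fderiv]
    have h7 := h1 (ξ + q.2 • J q.1 ξ).1
    have h8 : τ (ξ + q.2 • J q.1 ξ, 0) = ((ξ + q.2 • J q.1 ξ).1, f' (τ q) (ξ + q.2 • J q.1 ξ).1) :=
      Prod.ext rfl (Prod.ext h5 rfl)
    rw [ContinuousLinearMap.comp_apply, ContinuousLinearMap.comp_apply, h8, h7, map_zero]

end TwistorFunction

/-! ### The system as commutativity of the frame fields W_A -/

section HyperEquation

open Filter Topology

/-- The vector field `∂/∂w^A + (∂Θ_B/∂x^A) ∂/∂x_B`. -/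
def hyperFrame (Θ : Fin 2 → C4 → ℂ) (A : Fin 2) (z : C4) : C4 :=
  (![-partialX A (Θ 1) z, partialX A (Θ 0) z], Pi.single A 1)

theorem fderiv_fderiv_apply_const {f : C4 → ℂ} {z : C4} (hf : AnalyticAt ℂ f z) (u v : C4) :
    fderiv ℂ (fun y => fderiv ℂ f y v) z u = fderiv ℂ (fderiv ℂ f) z u v := by
  have h := hf.fderiv.differentiableAt.hasFDerivAt.clm_apply (hasFDerivAt_const v z)
  rw [h.fderiv]
  simp

/-- Contracting the ε symbols leaves W_0(∂_1 Θ_C) - W_1(∂_0 Θ_C). Up to sign these are the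
components of [W_0, W_1], so the system says that W_0 and W_1 commute. -/
theorem sum_hyperEq_eq {Θ : Fin 2 → C4 → ℂ} {z : C4} (C : Fin 2) (hΘ : AnalyticAt ℂ (Θ C) z) :
    ((∑ A, partialXRaised A (partialW A (Θ C)) z) +
      ∑ A, ∑ B, partialX A (Θ B) z * partialXRaised A (partialXRaised B (Θ C)) z) =
    fderiv ℂ (fderiv ℂ (Θ C)) z (Pi.single 1 1, 0) (hyperFrame Θ 0 z) -
      fderiv ℂ (fderiv ℂ (Θ C)) z (Pi.single 0 1, 0) (hyperFrame Θ 1 z) := by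
  have hW : ∀ A, hyperFrame Θ A z = (0, Pi.single A 1)
      + partialX A (Θ 0) z • (Pi.single 1 1, 0) - partialX A (Θ 1) z • (Pi.single 0 1, 0) := by
    intro A
    refine Prod.ext ?_ ?_
    · ext i; fin_cases i <;> simp [hyperFrame]
    · simp [hyperFrame]
  have e0 : partialXRaised 0 (Θ C) = partialX 1 (Θ C) := by
    ext y; simp [partialXRaised, eps]
  have e1 : partialXRaised 1 (Θ C) = fun y => -partialX 0 (Θ C) y := by
    ext y; simp [partialXRaised, eps]
  have hneg : ∀ A, partialX A (fun y => -partialX 0 (Θ C) y) z = -partialX A (partialX 0 (Θ C)) z :=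
    fun A => by
      simp only [partialX]
      rw [fderiv_fun_neg]
      rfl
  have hxx : ∀ A B, partialX A (partialX B (Θ C)) z
      = fderiv ℂ (fderiv ℂ (Θ C)) z (Pi.single A 1, 0) (Pi.single B 1, 0) := fun A B =>
    fderiv_fderiv_apply_const hΘ _ _
  have hxw : ∀ A B, partialX A (partialW B (Θ C)) z
      = fderiv ℂ (fderiv ℂ (Θ C)) z (Pi.single A 1, 0) (0, Pi.single B 1) := fun A B =>
    fderiv_fderiv_apply_const hΘ _ _
  have hsymm := (hΘ.contDiffAt (n := 2)).isSymmSndFDerivAt (by simp)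
    (Pi.single 0 1, 0) (Pi.single 1 1, 0)
  simp only [Fin.sum_univ_two, e0, e1, hW, map_add, map_sub, map_smul, smul_eq_mul]
  simp only [partialXRaised, Fin.sum_univ_two, hneg, hxx, hxw, eps, Matrix.of_apply,
    Matrix.cons_val_zero, Matrix.cons_val_one, Matrix.cons_val', Matrix.cons_val_fin_one, hsymm]
  ring

/-- If `∂_A χ = W_A θ` for `W_A = ∂/∂w^A + ∂_A θ^B ∂/∂x^B`, then `θ` gives a solution of the
system. -/
theorem solvesHyperEq_of_potential {θ χ : C4 → Fin 2 → ℂ} {T : Set C4} (hT : IsOpen T)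
    (hθ : ∀ y ∈ T, AnalyticAt ℂ θ y) (hχ : ∀ y ∈ T, AnalyticAt ℂ χ y)
    (h : ∀ y ∈ T, ∀ A : Fin 2, fderiv ℂ χ y (Pi.single A 1, 0)
      = fderiv ℂ θ y (fderiv ℂ θ y (Pi.single A 1, 0), Pi.single A 1)) :
    SolvesHyperEq ![fun y => θ y 1, fun y => -θ y 0] T := by
  intro y hy C
  set Θ : Fin 2 → C4 → ℂ := ![fun y => θ y 1, fun y => -θ y 0] with hΘdef
  have hcoord : ∀ i, ∀ y ∈ T, AnalyticAt ℂ (fun y => θ y i) y := fun i y hy =>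
    ((ContinuousLinearMap.proj (R := ℂ) (φ := fun _ : Fin 2 => ℂ) i).analyticAt _).comp (hθ y hy)
  have hΘ : AnalyticAt ℂ (Θ C) y := by
    fin_cases C
    · exact hcoord 1 y hy
    · exact (hcoord 0 y hy).neg
  rw [sum_hyperEq_eq C hΘ]
  have hproj : ∀ i, ∀ y ∈ T, ∀ v, fderiv ℂ (fun y => θ y i) y v = fderiv ℂ θ y v i :=
    fun i y hy v => by
      have := ((ContinuousLinearMap.proj (R := ℂ) (φ := fun _ : Fin 2 => ℂ) i).hasFDerivAt).comp y
        (hθ y hy).differentiableAt.hasFDerivAt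
      rw [show fderiv ℂ (fun y => θ y i) y = _ from this.fderiv]
      rfl
  have hframe : ∀ A, hyperFrame Θ A y = (fderiv ℂ θ y (Pi.single A 1, 0), Pi.single A 1) := by
    intro A
    refine Prod.ext ?_ rfl
    have h0 : partialX A (Θ 0) y = fderiv ℂ θ y (Pi.single A 1, 0) 1 := hproj 1 y hy _
    have h1 : partialX A (Θ 1) y = -fderiv ℂ θ y (Pi.single A 1, 0) 0 := by
      rw [← hproj 0 y hy]
      change fderiv ℂ (fun y => -θ y 0) y _ = _
      rw [fderiv_fun_neg]; rfl
    ext i; fin_cases i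
    · simp [hyperFrame, h1]
    · simp [hyperFrame, h0]
  -- differentiate the relation in the direction of `x^B`
  have hdd : ∀ A B : Fin 2, fderiv ℂ (fderiv ℂ χ) y (Pi.single B 1, 0) (Pi.single A 1, 0)
      = fderiv ℂ θ y (fderiv ℂ (fderiv ℂ θ) y (Pi.single B 1, 0) (Pi.single A 1, 0), 0)
        + fderiv ℂ (fderiv ℂ θ) y (Pi.single B 1, 0) (hyperFrame Θ A y) := by
    intro A B
    have h1 := (hχ y hy).fderiv.differentiableAt.hasFDerivAt.clm_apply
      (hasFDerivAt_const ((Pi.single A 1, 0) : C4) y)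
    have hD := (hθ y hy).fderiv.differentiableAt.hasFDerivAt
    have h2 := hD.clm_apply (hasFDerivAt_const ((Pi.single A 1, 0) : C4) y)
    have h3 := hD.clm_apply (h2.prodMk (hasFDerivAt_const (Pi.single A 1 : Fin 2 → ℂ) y))
    have h4 : (fun y => fderiv ℂ χ y (Pi.single A 1, 0)) =ᶠ[𝓝 y]
        fun y => fderiv ℂ θ y (fderiv ℂ θ y (Pi.single A 1, 0), Pi.single A 1) := by
      filter_upwards [hT.mem_nhds hy] with y hy using h y hy A
    have h5 := DFunLike.congr_fun (h1.unique (h3.congr_of_eventuallyEq h4)) (Pi.single B 1, 0)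
    rw [hframe]
    simpa using h5
  have hsχ := ((hχ y hy).contDiffAt (n := 2)).isSymmSndFDerivAt (by simp)
    (Pi.single 0 1, 0) (Pi.single 1 1, 0)
  have hsθ := ((hθ y hy).contDiffAt (n := 2)).isSymmSndFDerivAt (by simp)
    (Pi.single 0 1, 0) (Pi.single 1 1, 0)
  -- The left sides agree because D²χ is symmetric, and the terms with Dθ applied to D²θ agree
  -- because D²θ is. What remains is the symmetry of W_A ∂_B θ in A and B.
  rw [hdd, hdd, hsθ] at hsχ
  have key := add_left_cancel hsχ
  have hproj2 : ∀ i (u v : C4), fderiv ℂ (fderiv ℂ (fun y => θ y i)) y u v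
      = fderiv ℂ (fderiv ℂ θ) y u v i := by
    intro i u v
    rw [← fderiv_fderiv_apply_const (hcoord i y hy)]
    have h1 : (fun y => fderiv ℂ (fun y => θ y i) y v) =ᶠ[𝓝 y] fun y => fderiv ℂ θ y v i := by
      filter_upwards [hT.mem_nhds hy] with y hy using hproj i y hy v
    rw [h1.fderiv_eq]
    have h2 := (hθ y hy).fderiv.differentiableAt.hasFDerivAt.clm_apply (hasFDerivAt_const v y)
    have h3 := ((ContinuousLinearMap.proj (R := ℂ) (φ := fun _ : Fin 2 => ℂ) i).hasFDerivAt).comp y h2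
    rw [show fderiv ℂ (fun y => fderiv ℂ θ y v i) y = _ from h3.fderiv]
    simp
  rw [sub_eq_zero]
  fin_cases C
  · change fderiv ℂ (fderiv ℂ (fun y => θ y 1)) y _ _ = fderiv ℂ (fderiv ℂ (fun y => θ y 1)) y _ _
    rw [hproj2, hproj2, key]
  · have hn : fderiv ℂ (Θ 1) = fun y => -fderiv ℂ (fun y => θ y 0) y := by
      ext1 y; exact fderiv_fun_neg
    change fderiv ℂ (fderiv ℂ (Θ 1)) y _ _ = fderiv ℂ (fderiv ℂ (Θ 1)) y _ _
    rw [hn, fderiv_fun_neg]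
    simp only [neg_apply, hproj2, key]

end HyperEquation

/-! ### Expansion of a first integral in the pencil parameter -/

section TaylorCoefficients

open Filter Topology

variable {V F : Type*} [NormedAddCommGroup V] [NormedSpace ℂ V] [NormedAddCommGroup F]
  [NormedSpace ℂ F]

theorem hasFDerivAt_slice {g : V × ℂ → F} {z : V} (hg : DifferentiableAt ℂ g (z, 0)) :
    HasFDerivAt (fun z => g (z, 0)) ((fderiv ℂ g (z, 0)).comp (.inl ℂ V ℂ)) z :=
  hg.hasFDerivAt.comp z (hasFDerivAt_prodMk_left z 0)

/-- The derivative with respect to the parameter. -/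
def paramDeriv (g : V × ℂ → F) (q : V × ℂ) : F := fderiv ℂ g q (0, 1)

variable [CompleteSpace F]

theorem AnalyticAt.paramDeriv {g : V × ℂ → F} {q : V × ℂ} (hg : AnalyticAt ℂ g q) :
    AnalyticAt ℂ (paramDeriv g) q :=
  ((ContinuousLinearMap.apply ℂ F ((0, 1) : V × ℂ)).analyticAt _).comp hg.fderiv

theorem hasFDerivAt_fderiv_apply_const {g : V × ℂ → F} {q : V × ℂ} (hg : AnalyticAt ℂ g q)
    (v : V × ℂ) :
    HasFDerivAt (fun q => fderiv ℂ g q v) ((fderiv ℂ (fderiv ℂ g) q).flip v) q := by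
  have h := hg.fderiv.differentiableAt.hasFDerivAt.clm_apply (hasFDerivAt_const v q)
  simpa using h

theorem fderiv_paramDeriv {g : V × ℂ → F} {q : V × ℂ} (hg : AnalyticAt ℂ g q) (v : V × ℂ) :
    fderiv ℂ (paramDeriv g) q v = fderiv ℂ (fderiv ℂ g) q (0, 1) v := by
  rw [show fderiv ℂ (paramDeriv g) q = _ from (hasFDerivAt_fderiv_apply_const hg (0, 1)).fderiv,
    ContinuousLinearMap.flip_apply]
  exact (hg.contDiffAt (n := 2)).isSymmSndFDerivAt (by simp) _ _

/-- Differentiate with respect to the parameter a relation along the pencil `ξ + μ J ξ`. -/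
theorem pencil_relation_paramDeriv {I J : V → V →L[ℂ] V} {g g' : V × ℂ → F} {c : ℂ}
    (hg : AnalyticAt ℂ g 0) (hg' : AnalyticAt ℂ g' 0)
    (h : ∀ᶠ q in 𝓝 (0 : V × ℂ), ∀ ξ, I q.1 ξ = Complex.I • ξ →
      fderiv ℂ g q (ξ + q.2 • J q.1 ξ, 0) + c • fderiv ℂ g' q (J q.1 ξ, 0) = 0) :
    ∀ᶠ q in 𝓝 (0 : V × ℂ), ∀ ξ, I q.1 ξ = Complex.I • ξ →
      fderiv ℂ (paramDeriv g) q (ξ + q.2 • J q.1 ξ, 0) + (fderiv ℂ g q (J q.1 ξ, 0)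
        + c • fderiv ℂ (paramDeriv g') q (J q.1 ξ, 0)) = 0 := by
  filter_upwards [h.eventually_nhds, hg.eventually_analyticAt, hg'.eventually_analyticAt] with
    q hq hgq hgq' ξ hξ
  have hline : HasDerivAt (fun s : ℂ => ((q.1, s) : V × ℂ)) (0, 1) q.2 :=
    (hasDerivAt_const q.2 q.1).prodMk (hasDerivAt_id q.2)
  have hcont : Tendsto (fun s : ℂ => ((q.1, s) : V × ℂ)) (𝓝 q.2) (𝓝 q) :=
    hline.continuousAt.tendsto
  have hz : (fun s : ℂ => fderiv ℂ g (q.1, s) (ξ + s • J q.1 ξ, 0)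
      + c • fderiv ℂ g' (q.1, s) (J q.1 ξ, 0)) =ᶠ[𝓝 q.2] fun _ => 0 := by
    filter_upwards [hcont.eventually hq] with s hs using hs ξ hξ
  have h1 : HasDerivAt (fun s : ℂ => fderiv ℂ g (q.1, s)) (fderiv ℂ (fderiv ℂ g) q (0, 1)) q.2 :=
    HasFDerivAt.comp_hasDerivAt (f := fun s : ℂ => ((q.1, s) : V × ℂ)) q.2
      hgq.fderiv.differentiableAt.hasFDerivAt hline
  have h2 : HasDerivAt (fun s : ℂ => fderiv ℂ g' (q.1, s)) (fderiv ℂ (fderiv ℂ g') q (0, 1)) q.2 :=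
    HasFDerivAt.comp_hasDerivAt (f := fun s : ℂ => ((q.1, s) : V × ℂ)) q.2
      hgq'.fderiv.differentiableAt.hasFDerivAt hline
  have h3 : HasDerivAt (fun s : ℂ => ((ξ + s • J q.1 ξ, 0) : V × ℂ)) (J q.1 ξ, 0) q.2 := by
    have := (((hasDerivAt_id q.2).smul_const (J q.1 ξ)).const_add ξ).prodMk
      (hasDerivAt_const q.2 (0 : ℂ))
    simpa using this
  have h4 := (h1.clm_apply h3).add
    ((h2.clm_apply (hasDerivAt_const q.2 ((J q.1 ξ, 0) : V × ℂ))).const_smul c)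
  have h5 := h4.unique ((hasDerivAt_const q.2 (0 : F)).congr_of_eventuallyEq hz)
  rw [fderiv_paramDeriv hgq, fderiv_paramDeriv hgq', ← add_assoc]
  simpa using h5

/-- The first Taylor coefficients in `μ` of a function annihilated by the pencil `ξ + μ J ξ`. -/
theorem exists_taylor_coefficients {I J : V → V →L[ℂ] V} {w : V × ℂ → F} (hw : AnalyticAt ℂ w 0)
    (h : ∀ᶠ q in 𝓝 (0 : V × ℂ), ∀ ξ, I q.1 ξ = Complex.I • ξ →
      fderiv ℂ w q (ξ + q.2 • J q.1 ξ, 0) = 0) :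
    ∃ x θ χ : V → F, AnalyticAt ℂ x 0 ∧ AnalyticAt ℂ θ 0 ∧ AnalyticAt ℂ χ 0 ∧
      ∀ᶠ z in 𝓝 (0 : V), ∀ ξ, I z ξ = Complex.I • ξ →
        fderiv ℂ (fun z => w (z, 0)) z ξ = 0 ∧
        fderiv ℂ x z ξ = -fderiv ℂ (fun z => w (z, 0)) z (J z ξ) ∧
        fderiv ℂ θ z ξ = -fderiv ℂ x z (J z ξ) ∧ fderiv ℂ χ z ξ = -fderiv ℂ θ z (J z ξ) := by
  have hw1 := hw.paramDeriv
  have hw2 := hw1.paramDeriv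
  have hw3 := hw2.paramDeriv
  -- The n-th μ-derivative of the relation carries n copies of the Jξ-term by Leibniz's rule, hence
  -- c = 0, 1, 2 (for c = 0 the second function is a dummy). The factors 1/2 and 1/6 below turn
  -- these multiplicities into 1.
  have r1 := pencil_relation_paramDeriv (c := 0) (J := J) hw hw (by simpa using h)
  simp only [zero_smul, add_zero] at r1
  have r2 := pencil_relation_paramDeriv (c := 1) (J := J) hw1 hw (by simpa using r1)
  have r3 := pencil_relation_paramDeriv (c := 2) (J := J) hw2 hw1 (by
    filter_upwards [r2] with q hq ξ hξ
    have := hq ξ hξ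
    rwa [one_smul, ← two_smul ℂ] at this)
  have hsl : Tendsto (fun z : V => ((z, 0) : V × ℂ)) (𝓝 0) (𝓝 0) :=
    Continuous.tendsto' (by fun_prop) _ _ rfl
  have han : ∀ g : V × ℂ → F, AnalyticAt ℂ g 0 → AnalyticAt ℂ (fun z => g (z, 0)) 0 := fun g hg =>
    hg.comp (f := fun z : V => ((z, 0) : V × ℂ)) (analyticAt_id.prod analyticAt_const)
  refine ⟨fun z => paramDeriv w (z, 0), fun z => (1 / 2 : ℂ) • paramDeriv (paramDeriv w) (z, 0),
    fun z => (1 / 6 : ℂ) • paramDeriv (paramDeriv (paramDeriv w)) (z, 0), han _ hw1,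
    (han _ hw2).fun_const_smul, (han _ hw3).fun_const_smul, ?_⟩
  filter_upwards [hsl.eventually h, hsl.eventually r1, hsl.eventually r2, hsl.eventually r3,
    hsl.eventually (eventually_differentiableAt_of_analyticAt hw),
    hsl.eventually (eventually_differentiableAt_of_analyticAt hw1),
    hsl.eventually (eventually_differentiableAt_of_analyticAt hw2),
    hsl.eventually (eventually_differentiableAt_of_analyticAt hw3)] with z a0 a1 a2 a3 d0 d1 d2 d3
    ξ hξ
  have b0 := a0 ξ hξ
  have b1 := a1 ξ hξ
  have b2 := a2 ξ hξ
  have b3 := a3 ξ hξ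
  simp only [zero_smul, add_zero, one_smul] at b0 b1 b2 b3
  rw [(hasFDerivAt_slice d0).fderiv, (hasFDerivAt_slice d1).fderiv,
    ((hasFDerivAt_slice d2).fun_const_smul (1 / 2 : ℂ)).fderiv,
    ((hasFDerivAt_slice d3).fun_const_smul (1 / 6 : ℂ)).fderiv]
  simp only [smul_apply, ContinuousLinearMap.comp_apply, ContinuousLinearMap.inl_apply]
  refine ⟨b0, eq_neg_of_add_eq_zero_left b1, ?_, ?_⟩
  · rw [eq_neg_of_add_eq_zero_left b2]
    module
  · rw [eq_neg_of_add_eq_zero_left b3]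
    module

end TaylorCoefficients

/-! ### Coordinates adapted to a hypercomplex structure -/

section NormalForm

open Filter Topology

/-- J maps the i-eigenspace of I onto the (-i)-eigenspace, so the eigenprojections of ξ provide the
two vectors. -/
theorem IsQuaternionicPair.exists_eq_add {V : Type*} [NormedAddCommGroup V] [NormedSpace ℂ V]
    {I J : V →L[ℂ] V} (h : IsQuaternionicPair I J) (ξ : V) :
    ∃ q q', I q = Complex.I • q ∧ I q' = Complex.I • q' ∧ ξ = q + J q' := by
  refine ⟨(1 / 2 : ℂ) • (ξ - Complex.I • I ξ), -J ((1 / 2 : ℂ) • (ξ + Complex.I • I ξ)), ?_, ?_, ?_⟩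
  · simp only [map_smul, map_sub, h.sq_I]
    match_scalars <;> ring_nf
    norm_num
  · have h1 : ∀ v, I (J v) = -J (I v) := fun v => by rw [h.anticomm, neg_neg]
    rw [map_neg, h1]
    simp only [map_smul, map_add, h.sq_I, map_neg]
    match_scalars <;> ring_nf
    norm_num
  · rw [map_neg, h.sq_J]
    module

theorem mem_contDiffGroupoid_of_analyticAt (H : OpenPartialHomeomorph C4 C4)
    (h1 : ∀ z ∈ H.source, AnalyticAt ℂ H z) (h2 : ∀ z ∈ H.target, AnalyticAt ℂ H.symm z) :
    H ∈ contDiffGroupoid ω 𝓘(ℂ, C4) := by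
  rw [contDiffGroupoid, mem_groupoid_of_pregroupoid]
  simp only [contDiffPregroupoid, modelWithCornersSelf_coe, modelWithCornersSelf_coe_symm,
    Function.id_comp, Function.comp_id, preimage_id, range_id, inter_univ]
  exact ⟨fun z hz => (h1 z hz).contDiffAt.contDiffWithinAt,
    fun z hz => (h2 z hz).contDiffAt.contDiffWithinAt⟩

/-- Local coordinates adapted to a hypercomplex structure. -/
theorem exists_adapted_coordinates {I J : C4 → C4 →L[ℂ] C4} (hI : AnalyticAt ℂ I 0)
    (hJ : AnalyticAt ℂ J 0) (hq : ∀ᶠ z in 𝓝 0, IsQuaternionicPair (I z) (J z))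
    (hI0 : ∀ v, I 0 v = (Complex.I • v.1, -(Complex.I • v.2))) (hJ0 : ∀ v, J 0 v = (-v.2, v.1))
    (hint : ∀ᶠ z in 𝓝 0, PencilInvolutiveAt I J z) {N : Set C4} (hN : N ∈ 𝓝 (0 : C4)) :
    ∃ ψ : OpenPartialHomeomorph C4 C4, 0 ∈ ψ.source ∧ ψ.source ⊆ N ∧
      (∀ z ∈ ψ.source, AnalyticAt ℂ ψ z) ∧ (∀ z ∈ ψ.target, AnalyticAt ℂ ψ.symm z) ∧
      ∃ Θ : Fin 2 → C4 → ℂ, (∀ A, DifferentiableOn ℂ (Θ A) ψ.target) ∧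
        SolvesHyperEq Θ ψ.target ∧ ∀ z ∈ ψ.source, ∀ A : Fin 2, ∃ q, I z q = Complex.I • q ∧
          fderiv ℂ ψ z q = (Pi.single A 1, 0) ∧ fderiv ℂ ψ z (J z q) = -hyperFrame Θ A (ψ z) := by
  obtain ⟨W, hW, hW0, hWd⟩ := exists_twistor_function hI hJ hq hI0 hint
  obtain ⟨x, θ, χ, hx, hθ, hχ, hrel⟩ := exists_taylor_coefficients hW hWd
  let w : C4 → Fin 2 → ℂ := fun z => W (z, 0)
  have hsl : Tendsto (fun z : C4 => ((z, 0) : C4 × ℂ)) (𝓝 0) (𝓝 0) :=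
    Continuous.tendsto' (by fun_prop) _ _ rfl
  have hw : AnalyticAt ℂ w 0 :=
    hW.comp (f := fun z : C4 => ((z, 0) : C4 × ℂ)) (analyticAt_id.prod analyticAt_const)
  have hw0 : ∀ᶠ z in 𝓝 (0 : C4), z.1 = 0 → w z = z.2 := hsl.eventually hW0
  replace hrel : ∀ᶠ z in 𝓝 (0 : C4), ∀ ξ, I z ξ = Complex.I • ξ →
      fderiv ℂ w z ξ = 0 ∧ fderiv ℂ x z ξ = -fderiv ℂ w z (J z ξ) ∧
      fderiv ℂ θ z ξ = -fderiv ℂ x z (J z ξ) ∧ fderiv ℂ χ z ξ = -fderiv ℂ θ z (J z ξ) := hrel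
  -- At the origin dw vanishes on the first factor and is the identity on the second, while the
  -- relation qx = -(Jq)w makes dx equal to -1 on the first. The differential is therefore block
  -- triangular and invertible.
  let Ψ : C4 → C4 := fun z => (x z, w z)
  have hΨ : AnalyticAt ℂ Ψ 0 := hx.prod hw
  have hdΨ : ∀ z, DifferentiableAt ℂ x z → DifferentiableAt ℂ w z → ∀ v,
      fderiv ℂ Ψ z v = (fderiv ℂ x z v, fderiv ℂ w z v) := fun z h1 h2 v => by
    rw [show fderiv ℂ Ψ z = _ from (h1.hasFDerivAt.prodMk h2.hasFDerivAt).fderiv]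
    rfl
  have hdw0 : ∀ b : Fin 2 → ℂ, fderiv ℂ w 0 (0, b) = b := by
    intro b
    have h1 : HasFDerivAt (fun v : Fin 2 → ℂ => w (0, v)) ((fderiv ℂ w 0).comp (.inr ℂ _ _)) 0 :=
      HasFDerivAt.comp (f := fun v : Fin 2 → ℂ => ((0, v) : C4)) 0 hw.differentiableAt.hasFDerivAt
        (hasFDerivAt_prodMk_right 0 0)
    have h2 : (fun v : Fin 2 → ℂ => w (0, v)) =ᶠ[𝓝 0] id := by
      have h3 : Tendsto (fun v : Fin 2 → ℂ => ((0, v) : C4)) (𝓝 0) (𝓝 0) :=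
        Continuous.tendsto' (by fun_prop) _ _ rfl
      filter_upwards [h3.eventually hw0] with v hv using hv rfl
    exact DFunLike.congr_fun (h1.unique ((hasFDerivAt_id 0).congr_of_eventuallyEq h2)) b
  have hrel0 : ∀ a : Fin 2 → ℂ, fderiv ℂ w 0 (a, 0) = 0 ∧ fderiv ℂ x 0 (a, 0) = -a := by
    intro a
    have h1 := hrel.self_of_nhds (a, 0) (by rw [hI0]; ext1 <;> simp)
    refine ⟨h1.1, ?_⟩
    rw [h1.2.1, hJ0]
    simp [hdw0]
  have hinj : Function.Injective (fderiv ℂ Ψ 0 : C4 →ₗ[ℂ] C4) := by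
    rw [injective_iff_map_eq_zero]
    rintro ⟨a, b⟩ hab
    have h0 : ((a, b) : C4) = (a, 0) + (0, b) := by simp
    have h1 : fderiv ℂ Ψ 0 (a, b) = 0 := hab
    rw [hdΨ 0 hx.differentiableAt hw.differentiableAt, Prod.mk_eq_zero] at h1
    have h2 := h1.2
    rw [h0, map_add, (hrel0 a).1, zero_add, hdw0] at h2
    have h3 := h1.1
    rw [h2, (hrel0 a).2, neg_eq_zero] at h3
    rw [h2, h3]; rfl
  let e : C4 ≃L[ℂ] C4 :=
    (LinearEquiv.ofInjectiveEndo (fderiv ℂ Ψ 0 : C4 →ₗ[ℂ] C4) hinj).toContinuousLinearEquiv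
  have he : HasFDerivAt Ψ (e : C4 →L[ℂ] C4) 0 :=
    hΨ.differentiableAt.hasFDerivAt.congr_fderiv (ContinuousLinearMap.ext fun _ => rfl)
  have hΨc : ContDiffAt ℂ ω Ψ 0 := hΨ.contDiffAt
  let H := hΨc.toOpenPartialHomeomorph Ψ he (by simp)
  have h0s : (0 : C4) ∈ H.source := hΨc.mem_toOpenPartialHomeomorph_source he (by simp)
  -- Invertibility of the differential near the origin, not only at it, makes the inverse analytic
  -- on the whole target.
  have hunit : ∀ᶠ z in 𝓝 (0 : C4), fderiv ℂ Ψ z ∈ range ((↑) : (C4 ≃L[ℂ] C4) → C4 →L[ℂ] C4) :=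
    hΨ.fderiv.continuousAt.eventually (ContinuousLinearEquiv.isOpen.mem_nhds
      ⟨e, ContinuousLinearMap.ext fun _ => rfl⟩)
  obtain ⟨N', hN', hN'o, h0N'⟩ := _root_.eventually_nhds_iff.1 ((eventually_mem_set.2 hN).and
    (hrel.and (hunit.and (hq.and (hx.eventually_analyticAt.and (hw.eventually_analyticAt.and
      (hθ.eventually_analyticAt.and hχ.eventually_analyticAt)))))))
  let ψ := H.restrOpen N' hN'o
  have hψs : ∀ z ∈ ψ.source, z ∈ H.source ∧ z ∈ N' := fun z hz => by
    simpa [ψ, OpenPartialHomeomorph.restrOpen_source] using hz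
  have hψ : ∀ z, ψ z = Ψ z := fun z => rfl
  have hψΨ : (ψ : C4 → C4) = Ψ := rfl
  have hψan : ∀ z ∈ ψ.source, AnalyticAt ℂ Ψ z := fun z hz =>
    (hN' z (hψs z hz).2).2.2.2.2.1.prod (hN' z (hψs z hz).2).2.2.2.2.2.1
  have hsymm : ∀ y ∈ ψ.target, AnalyticAt ℂ ψ.symm y := by
    intro y hy
    have hz := ψ.map_target hy
    obtain ⟨e', he'⟩ := (hN' _ (hψs _ hz).2).2.2.1
    refine (ψ.contDiffAt_symm (n := ω) hy (f₀' := e') ?_ (hψan _ hz).contDiffAt).analyticAt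
    rw [he']
    exact (hψan _ hz).differentiableAt.hasFDerivAt
  -- the frame of the `i`-eigenbundle dual to the coordinates `x`
  have hframe : ∀ z ∈ ψ.source, ∀ a : Fin 2 → ℂ, ∃ q, I z q = Complex.I • q ∧
      fderiv ℂ Ψ z q = (a, 0) ∧ fderiv ℂ Ψ z (J z q) = (-fderiv ℂ θ z q, -a) := by
    intro z hz a
    obtain ⟨-, hr, ⟨e', he'⟩, hqz, hxz, hwz, -, -⟩ := hN' z (hψs z hz).2
    have hd := hdΨ z hxz.differentiableAt hwz.differentiableAt
    obtain ⟨q, q', h1, h2, h3⟩ := hqz.exists_eq_add (e'.symm (a, 0))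
    have h4 : fderiv ℂ Ψ z (q + J z q') = (a, 0) := by rw [← h3, ← he']; simp
    -- The function w kills q, q' and the vector (a, 0), hence also Jq'; the relation for x then
    -- shows that x kills q', so q' is in the kernel of dΨ.
    have h5 : q' = 0 := by
      have h6 : fderiv ℂ w z (J z q') = 0 := by
        have h7 := congrArg Prod.snd (hd (q + J z q') ▸ h4)
        simpa [(hr q h1).1] using h7
      have h8 : fderiv ℂ Ψ z q' = 0 := by
        rw [hd, (hr q' h2).1, (hr q' h2).2.1, h6]; simp
      rw [← he'] at h8
      exact e'.map_eq_zero_iff.1 h8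
    rw [h5, map_zero, add_zero] at h4
    refine ⟨q, h1, h4, ?_⟩
    rw [hd] at h4 ⊢
    have h9 := (hr q h1).2
    have h10 : fderiv ℂ x z q = a := congrArg Prod.fst h4
    rw [h9.2.1, h10.symm, h9.1, neg_neg, neg_neg]
  let θ' : C4 → Fin 2 → ℂ := fun y => θ (ψ.symm y)
  let χ' : C4 → Fin 2 → ℂ := fun y => χ (ψ.symm y)
  have hpull : ∀ (g : C4 → Fin 2 → ℂ) (z : C4), z ∈ ψ.source → AnalyticAt ℂ g z → ∀ v,
      fderiv ℂ (fun y => g (ψ.symm y)) (Ψ z) (fderiv ℂ Ψ z v) = fderiv ℂ g z v := by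
    intro g z hz hg v
    have h1 : (fun z => g (ψ.symm (Ψ z))) =ᶠ[𝓝 z] g := by
      filter_upwards [ψ.open_source.mem_nhds hz] with u hu
      exact congrArg g (ψ.left_inv hu)
    have hs := hsymm _ (ψ.map_source hz)
    have hgs : DifferentiableAt ℂ (fun y => g (ψ.symm y)) (Ψ z) := by
      refine DifferentiableAt.comp (f := ψ.symm) (g := g) (Ψ z) ?_ hs.differentiableAt
      have : ψ.symm (Ψ z) = z := ψ.left_inv hz
      rw [this]
      exact hg.differentiableAt
    rw [← h1.fderiv_eq, show fderiv ℂ (fun z => g (ψ.symm (Ψ z))) z = _ from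
      (hgs.hasFDerivAt.comp z (hψan z hz).differentiableAt.hasFDerivAt).fderiv]
    rfl
  have hθ' : ∀ y ∈ ψ.target, AnalyticAt ℂ θ' y := fun y hy =>
    AnalyticAt.comp (hN' _ (hψs _ (ψ.map_target hy)).2).2.2.2.2.2.2.1 (hsymm y hy)
  have hχ' : ∀ y ∈ ψ.target, AnalyticAt ℂ χ' y := fun y hy =>
    AnalyticAt.comp (hN' _ (hψs _ (ψ.map_target hy)).2).2.2.2.2.2.2.2 (hsymm y hy)
  have hθi : ∀ i, ∀ y ∈ ψ.target, DifferentiableAt ℂ (fun y => θ' y i) y := fun i y hy =>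
    differentiableAt_pi.1 (hθ' y hy).differentiableAt i
  -- Setting Θ_0 = θ^1 and Θ_1 = -θ^0 gives (∂_A Θ_B) ∂/∂x_B = (∂_A θ^B) ∂/∂x^B.
  refine ⟨ψ, ⟨h0s, h0N'⟩, fun z hz => (hN' z (hψs z hz).2).1, hψan, hsymm,
    ![fun y => θ' y 1, fun y => -θ' y 0], ?_, ?_, ?_⟩
  · intro A y hy
    refine DifferentiableAt.differentiableWithinAt ?_
    fin_cases A
    · exact hθi 1 y hy
    · exact (hθi 0 y hy).neg
  -- In the new coordinates q_A is ∂_A and Jq_A is -W_A, so the last Taylor relation reads ∂_A χ =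
  -- W_A θ.
  · refine solvesHyperEq_of_potential ψ.open_target hθ' hχ' fun y hy A => ?_
    have hz := ψ.map_target hy
    obtain ⟨q, h1, h2, h3⟩ := hframe _ hz (Pi.single A 1)
    have hz' := (hN' _ (hψs _ hz).2).2
    have h4 := (hz'.1 q h1).2.2.2
    have e1 := hpull χ _ hz hz'.2.2.2.2.2.2 q
    have e2 := hpull θ _ hz hz'.2.2.2.2.2.1 q
    have e3 := hpull θ _ hz hz'.2.2.2.2.2.1 (J (ψ.symm y) q)
    have hy' : Ψ (ψ.symm y) = y := ψ.right_inv hy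
    rw [hy'] at e1 e2 e3
    rw [h2] at e1 e2
    rw [h3] at e3
    change fderiv ℂ χ' y _ = _ at e1
    change fderiv ℂ θ' y _ = _ at e2 e3
    rw [e1, h4, ← e3, e2, ← map_neg]
    simp
  · intro z hz A
    obtain ⟨q, h1, h2, h3⟩ := hframe z hz (Pi.single A 1)
    refine ⟨q, h1, h2, ?_⟩
    rw [hψΨ, h3]
    have hz' := (hN' _ (hψs _ hz).2).2
    have e2 := hpull θ _ hz hz'.2.2.2.2.2.1 q
    rw [h2] at e2
    change fderiv ℂ θ' (Ψ z) _ = _ at e2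
    have hy : Ψ z ∈ ψ.target := ψ.map_source hz
    have hproj : ∀ i, ∀ v, fderiv ℂ (fun y => θ' y i) (Ψ z) v = fderiv ℂ θ' (Ψ z) v i :=
      fun i v => by
        have := ((ContinuousLinearMap.proj (R := ℂ) (φ := fun _ : Fin 2 => ℂ) i).hasFDerivAt).comp
          (Ψ z) (hθ' _ hy).differentiableAt.hasFDerivAt
        rw [show fderiv ℂ (fun y => θ' y i) (Ψ z) = _ from this.fderiv]
        rfl
    have h10 : partialX A (fun y => θ' y 1) (Ψ z) = fderiv ℂ θ z q 1 := by
      rw [← e2]; exact hproj 1 _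
    have h11 : partialX A (fun y => -θ' y 0) (Ψ z) = -fderiv ℂ θ z q 0 := by
      rw [← e2, ← hproj 0, partialX, fderiv_fun_neg]; rfl
    refine Prod.ext ?_ rfl
    ext i; fin_cases i
    · simp [hyperFrame, h11]
    · simp [hyperFrame, h10]

end NormalForm

/-! ### The metric and the quaternions in the frame ∂_A, W_A -/

section FlatModel

open Filter Topology

/-- The linear map `w ↦ w^A (∂Θ_B/∂x^A) ∂/∂x_B`, the `x`-part of the frame `hyperFrame`. -/
def frameShift (Θ : Fin 2 → C4 → ℂ) (z : C4) : (Fin 2 → ℂ) →L[ℂ] (Fin 2 → ℂ) :=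
  ((fderiv ℂ (Θ 0) z).comp (ContinuousLinearMap.inl ℂ (Fin 2 → ℂ) (Fin 2 → ℂ))).smulRight
      (Pi.single 1 1)
    - ((fderiv ℂ (Θ 1) z).comp (ContinuousLinearMap.inl ℂ (Fin 2 → ℂ) (Fin 2 → ℂ))).smulRight
      (Pi.single 0 1)

theorem frameShift_apply (Θ : Fin 2 → C4 → ℂ) (z : C4) (a : Fin 2 → ℂ) :
    frameShift Θ z a = ![-fderiv ℂ (Θ 1) z (a, 0), fderiv ℂ (Θ 0) z (a, 0)] := by
  ext i; fin_cases i <;> simp [frameShift]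

theorem hyperFrame_eq_frameShift (Θ : Fin 2 → C4 → ℂ) (A : Fin 2) (z : C4) :
    hyperFrame Θ A z = (frameShift Θ z (Pi.single A 1), Pi.single A 1) := by
  simp [hyperFrame, frameShift_apply, partialX]

theorem AnalyticAt.frameShift {Θ : Fin 2 → C4 → ℂ} {z : C4} (hΘ : ∀ C, AnalyticAt ℂ (Θ C) z) :
    AnalyticAt ℂ (frameShift Θ) z := by
  have key : ∀ (C D : Fin 2), AnalyticAt ℂ (fun y =>
      ((fderiv ℂ (Θ C) y).comp (ContinuousLinearMap.inl ℂ (Fin 2 → ℂ) (Fin 2 → ℂ))).smulRight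
        (Pi.single D 1 : Fin 2 → ℂ)) z := fun C D => by
    have h := (((ContinuousLinearMap.smulRightL ℂ (Fin 2 → ℂ) (Fin 2 → ℂ)).flip
      (Pi.single D 1)).comp (((ContinuousLinearMap.compL ℂ (Fin 2 → ℂ) C4 ℂ).flip
      (ContinuousLinearMap.inl ℂ (Fin 2 → ℂ) (Fin 2 → ℂ))))).analyticAt (fderiv ℂ (Θ C) z)
    exact h.comp (hΘ C).fderiv
  exact (key 0 1).sub (key 1 0)

theorem fderiv_frameShift_apply {Θ : Fin 2 → C4 → ℂ} {z : C4} (hΘ : ∀ C, AnalyticAt ℂ (Θ C) z)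
    (ζ : C4) (a : Fin 2 → ℂ) :
    fderiv ℂ (frameShift Θ) z ζ a
      = ![-fderiv ℂ (fderiv ℂ (Θ 1)) z ζ (a, 0), fderiv ℂ (fderiv ℂ (Θ 0)) z ζ (a, 0)] := by
  have h1 : fderiv ℂ (frameShift Θ) z ζ a = fderiv ℂ (fun y => frameShift Θ y a) z ζ := by
    have h := (AnalyticAt.frameShift hΘ).differentiableAt.hasFDerivAt.clm_apply
      (hasFDerivAt_const a z)
    rw [h.fderiv]
    simp
  have h2 : HasFDerivAt (fun y => frameShift Θ y a) (ContinuousLinearMap.pi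
      ![-fderiv ℂ (fun y => fderiv ℂ (Θ 1) y (a, 0)) z,
        fderiv ℂ (fun y => fderiv ℂ (Θ 0) y (a, 0)) z]) z := by
    rw [hasFDerivAt_pi]
    have hd : ∀ C, HasFDerivAt (fun y => fderiv ℂ (Θ C) y (a, 0))
        (fderiv ℂ (fun y => fderiv ℂ (Θ C) y (a, 0)) z) z := fun C => by
      have := (hΘ C).fderiv
      exact DifferentiableAt.hasFDerivAt (this.differentiableAt.clm_apply (by fun_prop))
    intro i
    fin_cases i
    · simpa [frameShift_apply] using (hd 1).fun_neg
    · simpa [frameShift_apply] using hd 0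
  rw [h1, h2.fderiv]
  ext i; fin_cases i <;> simp [fderiv_fderiv_apply_const (hΘ _)]

theorem fderiv_fderiv_symm {f : C4 → ℂ} {z : C4} (hf : AnalyticAt ℂ f z) (u v : C4) :
    fderiv ℂ (fderiv ℂ f) z u v = fderiv ℂ (fderiv ℂ f) z v u :=
  (hf.contDiffAt (n := 2)).isSymmSndFDerivAt (by simp) u v

/-- The shift is an x-differential, so mixed partials commute. In terms of the frame, [∂_A, W_B] is
symmetric in A and B. -/
theorem fderiv_frameShift_symm {Θ : Fin 2 → C4 → ℂ} {z : C4} (hΘ : ∀ C, AnalyticAt ℂ (Θ C) z)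
    (a b : Fin 2 → ℂ) :
    fderiv ℂ (frameShift Θ) z (a, 0) b = fderiv ℂ (frameShift Θ) z (b, 0) a := by
  rw [fderiv_frameShift_apply hΘ, fderiv_frameShift_apply hΘ, fderiv_fderiv_symm (hΘ 0),
    fderiv_fderiv_symm (hΘ 1)]

theorem pi_fin_two_eq (a : Fin 2 → ℂ) :
    a = a 0 • (Pi.single 0 1 : Fin 2 → ℂ) + a 1 • (Pi.single 1 1 : Fin 2 → ℂ) := by
  ext i; fin_cases i <;> simp

/-- This is [W_0, W_1] = 0: the difference of the two sides is alternating in a, b ∈ ℂ², hence a^0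
b^1 - a^1 b^0 times the left side of the system, component by component. -/
theorem fderiv_frameShift_shift_symm {Θ : Fin 2 → C4 → ℂ} {V : Set C4} (hV : SolvesHyperEq Θ V)
    {z : C4} (hz : z ∈ V) (hΘ : ∀ C, AnalyticAt ℂ (Θ C) z) (a b : Fin 2 → ℂ) :
    fderiv ℂ (frameShift Θ) z (frameShift Θ z a, a) b
      = fderiv ℂ (frameShift Θ) z (frameShift Θ z b, b) a := by
  have key : ∀ C, fderiv ℂ (fderiv ℂ (Θ C)) z (frameShift Θ z a, a) (b, 0)
      = fderiv ℂ (fderiv ℂ (Θ C)) z (frameShift Θ z b, b) (a, 0) := by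
    intro C
    have h := hV z hz C
    rw [sum_hyperEq_eq C (hΘ C), hyperFrame_eq_frameShift, hyperFrame_eq_frameShift,
      fderiv_fderiv_symm (hΘ C), fderiv_fderiv_symm (hΘ C) (Pi.single 0 1, 0)] at h
    have e1 : ∀ c : Fin 2 → ℂ, (frameShift Θ z c, c)
        = c 0 • ((frameShift Θ z (Pi.single 0 1), Pi.single 0 1) : C4)
          + c 1 • ((frameShift Θ z (Pi.single 1 1), Pi.single 1 1) : C4) := fun c => by
      conv_lhs => rw [pi_fin_two_eq c]
      simp
    have e2 : ∀ c : Fin 2 → ℂ, (c, (0 : Fin 2 → ℂ))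
        = c 0 • ((Pi.single 0 1, 0) : C4) + c 1 • ((Pi.single 1 1, 0) : C4) := fun c => by
      conv_lhs => rw [pi_fin_two_eq c]
      simp
    rw [e1 a, e1 b, e2 a, e2 b]
    simp only [map_add, map_smul, add_apply, smul_apply,
      smul_eq_mul]
    linear_combination (a 0 * b 1 - a 1 * b 0) * h
  rw [fderiv_frameShift_apply hΘ, fderiv_frameShift_apply hΘ, key, key]

/-- The map `(a, b) ↦ a^A ∂/∂x^A + b^A W_A` (for `L` the shift of the frame). -/
def shear (L : (Fin 2 → ℂ) →L[ℂ] (Fin 2 → ℂ)) : C4 →L[ℂ] C4 :=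
  (ContinuousLinearMap.fst ℂ _ _ + L.comp (ContinuousLinearMap.snd ℂ _ _)).prod
    (ContinuousLinearMap.snd ℂ _ _)

/-- The endomorphism of `ℂ⁴` with `W ↦ p W + q ∂`, `∂ ↦ r W - p ∂` in the standard frame. -/
def frameEnd (p q r : ℂ) : C4 →L[ℂ] C4 :=
  ContinuousLinearMap.prod
    (-p • ContinuousLinearMap.fst ℂ _ _ + q • ContinuousLinearMap.snd ℂ _ _)
    (r • ContinuousLinearMap.fst ℂ _ _ + p • ContinuousLinearMap.snd ℂ _ _)

/-- The endomorphism field of `ℂ⁴` with `W_A ↦ p W_A + q ∂_A`, `∂_A ↦ r W_A - p ∂_A`. -/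
def flatEnd (Θ : Fin 2 → C4 → ℂ) (p q r : ℂ) (z : C4) : C4 →L[ℂ] C4 :=
  ((shear (frameShift Θ z)).comp (frameEnd p q r)).comp (shear (-frameShift Θ z))

theorem shear_apply (L : (Fin 2 → ℂ) →L[ℂ] (Fin 2 → ℂ)) (v : C4) :
    shear L v = (v.1 + L v.2, v.2) := rfl

theorem frameEnd_apply (p q r : ℂ) (v : C4) :
    frameEnd p q r v = (-p • v.1 + q • v.2, r • v.1 + p • v.2) := rfl

theorem shear_neg_shear (L : (Fin 2 → ℂ) →L[ℂ] (Fin 2 → ℂ)) (v : C4) :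
    shear (-L) (shear L v) = v := by
  simp [shear_apply]

theorem shear_shear_neg (L : (Fin 2 → ℂ) →L[ℂ] (Fin 2 → ℂ)) (v : C4) :
    shear L (shear (-L) v) = v := by
  simp [shear_apply]

theorem flatEnd_apply (Θ : Fin 2 → C4 → ℂ) (p q r : ℂ) (z v : C4) :
    flatEnd Θ p q r z v = shear (frameShift Θ z) (frameEnd p q r (shear (-frameShift Θ z) v)) :=
  rfl

theorem flatEnd_shear (Θ : Fin 2 → C4 → ℂ) (p q r : ℂ) (z v : C4) :
    flatEnd Θ p q r z (shear (frameShift Θ z) v)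
      = shear (frameShift Θ z) (frameEnd p q r v) := by
  rw [flatEnd_apply, shear_neg_shear]

theorem flatEnd_flatEnd (Θ : Fin 2 → C4 → ℂ) (p q r : ℂ) (h : p ^ 2 + q * r = -1) (z v : C4) :
    flatEnd Θ p q r z (flatEnd Θ p q r z v) = -v := by
  obtain ⟨u, rfl⟩ : ∃ u, v = shear (frameShift Θ z) u := ⟨_, (shear_shear_neg _ v).symm⟩
  rw [flatEnd_shear, flatEnd_shear, ← map_neg]
  congr 1
  simp only [frameEnd_apply]
  refine Prod.ext ?_ ?_ <;> ext i <;> simp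
  · linear_combination u.1 i * h
  · linear_combination u.2 i * h

/-- The derivative of a vector field transformed by `flatEnd`; the frame is parallel for
`D - Γ`, where `Γ(ζ, v) = (DL(ζ) v_w, 0)`. -/
theorem fderiv_flatEnd_apply {Θ : Fin 2 → C4 → ℂ} {z : C4} (hΘ : ∀ C, AnalyticAt ℂ (Θ C) z)
    (p q r : ℂ) {Y : C4 → C4} (hY : DifferentiableAt ℂ Y z) (ζ : C4) :
    fderiv ℂ (fun y => flatEnd Θ p q r y (Y y)) z ζ
      = flatEnd Θ p q r z (fderiv ℂ Y z ζ)
        + (fderiv ℂ (frameShift Θ) z ζ (flatEnd Θ p q r z (Y z)).2, 0)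
        - flatEnd Θ p q r z (fderiv ℂ (frameShift Θ) z ζ (Y z).2, 0) := by
  have hL := (AnalyticAt.frameShift hΘ).differentiableAt.hasFDerivAt
  have h2 := hY.hasFDerivAt.snd
  have hη := hY.hasFDerivAt.fst.sub (hL.clm_apply h2)
  have hb := (hη.const_smul r).add (h2.const_smul p)
  have ha := (hη.const_smul (-p)).add (h2.const_smul q)
  have hall := (ha.add (hL.clm_apply hb)).prodMk hb
  have heq : (fun y => flatEnd Θ p q r y (Y y)) = fun y =>
      ((-p • ((Y y).1 - frameShift Θ y (Y y).2) + q • (Y y).2)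
        + frameShift Θ y (r • ((Y y).1 - frameShift Θ y (Y y).2) + p • (Y y).2),
      (r • ((Y y).1 - frameShift Θ y (Y y).2) + p • (Y y).2)) := by
    ext y <;> simp [flatEnd_apply, shear_apply, frameEnd_apply, sub_eq_add_neg]
  rw [heq]
  refine (congrArg (fun D => D ζ) hall.fderiv).trans ?_
  simp only [flatEnd_apply, shear_apply, frameEnd_apply]
  refine Prod.ext ?_ ?_
  · simp
    module
  · simp
    module

/-- The endomorphism is parallel for the connection with parallel frame ∂_A, W_A, so the derivatives
of X and Y cancel and only the expression `T`, minus the torsion, survives. By the two symmetry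
lemmas `T` is a symmetric form in the index A times the area form in the pair (∂, W). A matrix of
determinant one preserves the area form, and a traceless one acts on it infinitesimally by zero;
these are the two identities `hT1`. -/
theorem flatEnd_nijenhuis {Θ : Fin 2 → C4 → ℂ} {V : Set C4} (hV : SolvesHyperEq Θ V)
    {z : C4} (hz : z ∈ V) (hΘ : ∀ C, AnalyticAt ℂ (Θ C) z) {p q r : ℂ}
    (h : p ^ 2 + q * r = -1) {X Y : C4 → C4} (hX : DifferentiableAt ℂ X z)
    (hY : DifferentiableAt ℂ Y z) :
    flatEnd Θ p q r z (flatEnd Θ p q r z (VectorField.lieBracket ℂ X Y z))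
      - flatEnd Θ p q r z (VectorField.lieBracket ℂ (fun y => flatEnd Θ p q r y (X y)) Y z)
      - flatEnd Θ p q r z (VectorField.lieBracket ℂ X (fun y => flatEnd Θ p q r y (Y y)) z)
      + VectorField.lieBracket ℂ (fun y => flatEnd Θ p q r y (X y))
        (fun y => flatEnd Θ p q r y (Y y)) z = 0 := by
  set L := frameShift Θ z with hL
  set D := fderiv ℂ (frameShift Θ) z with hD
  let T : C4 → C4 → C4 := fun u v => (D u v.2 - D v u.2, 0)
  have hT : ∀ a b c d : Fin 2 → ℂ, T (shear L (a, b)) (shear L (c, d))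
      = (D (a, 0) d - D (b, 0) c, 0) := by
    intro a b c d
    have e : ∀ a b : Fin 2 → ℂ, shear L (a, b) = (a, 0) + (L b, b) := fun a b => by
      simp [shear_apply]
    have h1 : ∀ a b, D (a, 0) b = D (b, 0) a := fderiv_frameShift_symm hΘ
    have h2 : ∀ a b, D (L a, a) b = D (L b, b) a := fderiv_frameShift_shift_symm hV hz hΘ
    refine Prod.ext ?_ rfl
    simp only [T, e, map_add, add_apply, Prod.snd_add, zero_add]
    rw [h2 b d, h1 c b]
    abel
  set 𝒥 := flatEnd Θ p q r z with h𝒥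
  have hsq : ∀ v, 𝒥 (𝒥 v) = -v := flatEnd_flatEnd Θ p q r h z
  have hT1 : ∀ u v, T (𝒥 u) (𝒥 v) = T u v ∧ T (𝒥 u) v + T u (𝒥 v) = 0 := by
    intro u v
    obtain ⟨⟨a, b⟩, rfl⟩ : ∃ u', u = shear L u' := ⟨_, (shear_shear_neg _ u).symm⟩
    obtain ⟨⟨c, d⟩, rfl⟩ : ∃ v', v = shear L v' := ⟨_, (shear_shear_neg _ v).symm⟩
    have hlin : ∀ (s t : ℂ) (a b c : Fin 2 → ℂ),
        D (s • a + t • b, 0) c = s • D (a, 0) c + t • D (b, 0) c := fun s t a b c => by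
      have : ((s • a + t • b, 0) : C4) = s • (a, 0) + t • (b, 0) := by simp
      rw [this, map_add, map_smul, map_smul]; rfl
    rw [h𝒥, flatEnd_shear, flatEnd_shear, frameEnd_apply, frameEnd_apply]
    simp only [← hL, hT]
    constructor
    · refine Prod.ext ?_ rfl
      simp only [hlin, map_add, map_smul]
      ext i
      simp
      linear_combination (D (b, 0) c i - D (a, 0) d i) * h
    · refine Prod.ext ?_ (by simp)
      simp only [hlin, map_add, map_smul, Prod.fst_add, Prod.fst_zero]
      module
  obtain ⟨hTa, hTb⟩ := hT1 (X z) (Y z)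
  simp only [VectorField.lieBracket, fderiv_flatEnd_apply hΘ p q r hX,
    fderiv_flatEnd_apply hΘ p q r hY, ← hD, ← h𝒥]
  have e1 : ((D (𝒥 (X z)) (𝒥 (Y z)).2, 0) : C4) - (D (𝒥 (Y z)) (𝒥 (X z)).2, 0)
      = T (𝒥 (X z)) (𝒥 (Y z)) := by simp [T]
  have e2 : ((D (𝒥 (X z)) (Y z).2, 0) : C4) - (D (Y z) (𝒥 (X z)).2, 0)
      = T (𝒥 (X z)) (Y z) := by simp [T]
  have e3 : ((D (X z) (𝒥 (Y z)).2, 0) : C4) - (D (𝒥 (Y z)) (X z).2, 0)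
      = T (X z) (𝒥 (Y z)) := by simp [T]
  have e4 : ((D (X z) (Y z).2, 0) : C4) - (D (Y z) (X z).2, 0) = T (X z) (Y z) := by simp [T]
  have e5 := congrArg 𝒥 hTb
  rw [map_add, ← e2, ← e3, map_sub, map_sub, map_zero] at e5
  rw [← e1, ← e4] at hTa
  simp only [map_sub, map_add, hsq]
  linear_combination (exp := 1) hTa - e5

set_option synthInstance.maxHeartbeats 200000 in
-- Passing to the frame absorbs the Θ-term, so the remaining algebraic properties of the metric
-- concern a constant form.
theorem coordMetric_shear (Θ : Fin 2 → C4 → ℂ) (z u v : C4) :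
    coordMetric Θ z (shear (frameShift Θ z) u) (shear (frameShift Θ z) v)
      = (1 / 2) * (u.1 0 * v.2 1 - u.1 1 * v.2 0 + (v.1 0 * u.2 1 - v.1 1 * u.2 0)) := by
  have e2 : ∀ (f : C4 → ℂ) (c : Fin 2 → ℂ), fderiv ℂ f z (c, 0)
      = c 0 * partialX 0 f z + c 1 * partialX 1 f z := fun f c => by
    have : (c, (0 : Fin 2 → ℂ))
        = c 0 • ((Pi.single 0 1, 0) : C4) + c 1 • ((Pi.single 1 1, 0) : C4) := by
      conv_lhs => rw [pi_fin_two_eq c]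
      simp
    rw [this, map_add, map_smul, map_smul]; rfl
  obtain ⟨a, b⟩ := u
  obtain ⟨c, d⟩ := v
  simp [coordMetric, symProd, dxDown, dxUp, dwUp, eps, shear_apply, frameShift_apply, e2,
    Fin.sum_univ_two, Matrix.vecHead, Matrix.vecTail]
  ring

theorem coordMetric_symm (Θ : Fin 2 → C4 → ℂ) (z u v : C4) :
    coordMetric Θ z u v = coordMetric Θ z v u := by
  rw [← shear_shear_neg (frameShift Θ z) u, ← shear_shear_neg (frameShift Θ z) v,
    coordMetric_shear, coordMetric_shear]
  ring

theorem coordMetric_nondegenerate (Θ : Fin 2 → C4 → ℂ) (z u : C4)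
    (h : ∀ v, coordMetric Θ z u v = 0) : u = 0 := by
  obtain ⟨⟨a, b⟩, rfl⟩ : ∃ u', u = shear (frameShift Θ z) u' := ⟨_, (shear_shear_neg _ u).symm⟩
  have h' := fun v => coordMetric_shear Θ z (a, b) v
  simp only [h] at h'
  have h1 := h' (0, ![0, 1])
  have h2 := h' (0, ![1, 0])
  have h3 := h' (![0, 1], 0)
  have h4 := h' (![1, 0], 0)
  simp at h1 h2 h3 h4
  have : ((a, b) : C4) = 0 := by
    refine Prod.ext ?_ ?_ <;> ext i <;> fin_cases i <;> simp_all
  rw [this, map_zero]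

/-- The condition on p, q, r says that the traceless matrix acting on the pair (∂, W) has
determinant one, so it preserves the area form that is one tensor factor of the metric. -/
theorem coordMetric_flatEnd (Θ : Fin 2 → C4 → ℂ) {p q r : ℂ} (h : p ^ 2 + q * r = -1)
    (z u v : C4) :
    coordMetric Θ z (flatEnd Θ p q r z u) (flatEnd Θ p q r z v) = coordMetric Θ z u v := by
  rw [← shear_shear_neg (frameShift Θ z) u, ← shear_shear_neg (frameShift Θ z) v, flatEnd_shear,
    flatEnd_shear, coordMetric_shear, coordMetric_shear]
  simp only [frameEnd_apply, Pi.add_apply, Pi.smul_apply, smul_eq_mul]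
  set a := shear (-frameShift Θ z) u
  set b := shear (-frameShift Θ z) v
  linear_combination (-(1/2) * (a.1 0 * b.2 1 - a.1 1 * b.2 0 + (b.1 0 * a.2 1 - b.1 1 * a.2 0))) * h

theorem differentiableAt_flatEnd {Θ : Fin 2 → C4 → ℂ} {z : C4}
    (hΘ : ∀ C, AnalyticAt ℂ (Θ C) z) (p q r : ℂ) {Y : C4 → C4}
    (hY : DifferentiableAt ℂ Y z) :
    DifferentiableAt ℂ (fun y => flatEnd Θ p q r y (Y y)) z := by
  have hL := (AnalyticAt.frameShift hΘ).differentiableAt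
  simp only [flatEnd_apply, shear_apply, frameEnd_apply, neg_apply]
  fun_prop

theorem differentiableAt_coordMetric {Θ : Fin 2 → C4 → ℂ} {z : C4}
    (hΘ : ∀ C, AnalyticAt ℂ (Θ C) z) {X Y : C4 → C4} (hX : DifferentiableAt ℂ X z)
    (hY : DifferentiableAt ℂ Y z) :
    DifferentiableAt ℂ (fun y => coordMetric Θ y (X y) (Y y)) z := by
  have h : ∀ y, coordMetric Θ y (X y) (Y y) = (1 / 2) *
      (((X y).1 - frameShift Θ y (X y).2) 0 * (Y y).2 1
        - ((X y).1 - frameShift Θ y (X y).2) 1 * (Y y).2 0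
      + (((Y y).1 - frameShift Θ y (Y y).2) 0 * (X y).2 1
        - ((Y y).1 - frameShift Θ y (Y y).2) 1 * (X y).2 0)) := fun y => by
    rw [← shear_shear_neg (frameShift Θ y) (X y), ← shear_shear_neg (frameShift Θ y) (Y y),
      coordMetric_shear, shear_shear_neg, shear_shear_neg]
    simp [shear_apply, sub_eq_add_neg]
  have hL := (AnalyticAt.frameShift hΘ).differentiableAt
  have h1 : DifferentiableAt ℂ (fun y => (X y).1 - frameShift Θ y (X y).2) z := by fun_prop
  have h2 : DifferentiableAt ℂ (fun y => (Y y).1 - frameShift Θ y (Y y).2) z := by fun_prop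
  refine DifferentiableAt.congr_of_eventuallyEq ?_ (Eventually.of_forall h)
  fun_prop

end FlatModel

/-! ### Testing holomorphy of bundle maps on sections -/

section BundleTest

open Filter Topology

variable {B : Type*} [TopologicalSpace B] [ChartedSpace C4 B]
  {F₁ F₂ : Type*} [NormedAddCommGroup F₁] [NormedSpace ℂ F₁] [FiniteDimensional ℂ F₁]
  [NormedAddCommGroup F₂] [NormedSpace ℂ F₂]

theorem mdifferentiableAt_clm_of_apply {A : B → F₁ →L[ℂ] F₂} {x : B}
    (h : ∀ v, MDifferentiableAt 𝓘(ℂ, C4) 𝓘(ℂ, F₂) (fun y => A y v) x) :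
    MDifferentiableAt 𝓘(ℂ, C4) 𝓘(ℂ, F₁ →L[ℂ] F₂) A x := by
  let b := Module.finBasis ℂ F₁
  let c : Fin (Module.finrank ℂ F₁) → F₁ →L[ℂ] ℂ := fun i =>
    LinearMap.toContinuousLinearMap (b.coord i)
  have hT : A = ∑ i, fun y => ContinuousLinearMap.smulRightL ℂ F₁ F₂ (c i) (A y (b i)) := by
    ext y v
    have hv : A y v = A y (∑ i, b.coord i v • b i) := by
      congr 1
      exact (b.sum_repr v).symm
    rw [hv, map_sum]
    simp [c]
  rw [hT]
  exact MDifferentiableAt.sum fun i _ =>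
    (ContinuousLinearMap.smulRightL ℂ F₁ F₂ (c i)).differentiableAt.mdifferentiableAt.comp x
      (h (b i))

variable {E₁ : B → Type*} {E₂ : B → Type*}
  [∀ x, AddCommGroup (E₁ x)] [∀ x, Module ℂ (E₁ x)] [∀ x, TopologicalSpace (E₁ x)]
  [TopologicalSpace (TotalSpace F₁ E₁)]
  [∀ x, AddCommGroup (E₂ x)] [∀ x, Module ℂ (E₂ x)] [∀ x, TopologicalSpace (E₂ x)]
  [TopologicalSpace (TotalSpace F₂ E₂)]
  [FiberBundle F₁ E₁] [VectorBundle ℂ F₁ E₁] [FiberBundle F₂ E₂] [VectorBundle ℂ F₂ E₂]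
  [∀ x, IsTopologicalAddGroup (E₂ x)] [∀ x, ContinuousSMul ℂ (E₂ x)]

/-- It suffices to test on sections that are constant in a local trivialization: their images are
the columns of the local matrix of φ, and there are finitely many of them. -/
theorem mdifferentiableAt_hom_of_apply {φ : ∀ x, E₁ x →L[ℂ] E₂ x} {p : B}
    (h : ∀ X : ∀ x, E₁ x,
      MDifferentiableAt 𝓘(ℂ, C4) (𝓘(ℂ, C4).prod 𝓘(ℂ, F₁)) (fun x => TotalSpace.mk' F₁ x (X x)) p →
      MDifferentiableAt 𝓘(ℂ, C4) (𝓘(ℂ, C4).prod 𝓘(ℂ, F₂))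
        (fun x => TotalSpace.mk' F₂ x (φ x (X x))) p) :
    MDifferentiableAt 𝓘(ℂ, C4) (𝓘(ℂ, C4).prod 𝓘(ℂ, F₁ →L[ℂ] F₂))
      (fun x => TotalSpace.mk' (F₁ →L[ℂ] F₂) (E := fun x => E₁ x →L[ℂ] E₂ x) x (φ x)) p := by
  rw [mdifferentiableAt_hom_bundle]
  refine ⟨mdifferentiableAt_id, mdifferentiableAt_clm_of_apply fun v => ?_⟩
  let t := trivializationAt F₁ E₁ p
  have hX : MDifferentiableAt 𝓘(ℂ, C4) (𝓘(ℂ, C4).prod 𝓘(ℂ, F₁))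
      (fun x => TotalSpace.mk' F₁ x (t.symmL ℂ x v)) p := by
    rw [mdifferentiableAt_totalSpace]
    refine ⟨mdifferentiableAt_id, ?_⟩
    refine (mdifferentiableAt_const (c := v)).congr_of_eventuallyEq ?_
    filter_upwards [t.open_baseSet.mem_nhds (mem_baseSet_trivializationAt F₁ E₁ p)] with y hy
    have := congrArg Prod.snd (t.apply_mk_symm hy v)
    rwa [← t.symmL_apply (R := ℂ) hy] at this
  have h2 := ((mdifferentiableAt_totalSpace _ _).1 (h _ hX)).2
  refine h2.congr_of_eventuallyEq ?_
  filter_upwards [(trivializationAt F₂ E₂ p).open_baseSet.mem_nhds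
    (mem_baseSet_trivializationAt F₂ E₂ p)] with y hy
  simp [ContinuousLinearMap.inCoordinates, t, hy]

end BundleTest

/-! ### Passage between the manifold and a chart -/

section ChartTransfer

open Filter Topology VectorField

variable {M : Type*} [TopologicalSpace M] [ChartedSpace C4 M]

theorem mdifferentiable_of_mem_maximalAtlas {e : OpenPartialHomeomorph M C4}
    (he : e ∈ IsManifold.maximalAtlas 𝓘(ℂ, C4) ω M) : e.MDifferentiable 𝓘(ℂ, C4) 𝓘(ℂ, C4) :=
  ⟨(contMDiffOn_of_mem_maximalAtlas he).mdifferentiableOn (by simp),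
    (contMDiffOn_symm_of_mem_maximalAtlas he).mdifferentiableOn (by simp)⟩

/-- The differential of a chart. -/
def chartD (e : OpenPartialHomeomorph M C4) (p : M) : TangentSpace 𝓘(ℂ, C4) p →L[ℂ] C4 :=
  mfderiv 𝓘(ℂ, C4) 𝓘(ℂ, C4) e p

/-- The inverse of the differential of a chart. -/
def chartDInv (e : OpenPartialHomeomorph M C4) (p : M) : C4 →L[ℂ] TangentSpace 𝓘(ℂ, C4) p :=
  mfderiv 𝓘(ℂ, C4) 𝓘(ℂ, C4) e.symm (e p)

variable {e : OpenPartialHomeomorph M C4}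

theorem chartDInv_chartD (he : e ∈ IsManifold.maximalAtlas 𝓘(ℂ, C4) ω M)
    {p : M} (hp : p ∈ e.source) (v : TangentSpace 𝓘(ℂ, C4) p) :
    chartDInv e p (chartD e p v) = v :=
  DFunLike.congr_fun ((mdifferentiable_of_mem_maximalAtlas he).symm_comp_deriv hp) v

theorem chartD_chartDInv (he : e ∈ IsManifold.maximalAtlas 𝓘(ℂ, C4) ω M)
    {p : M} (hp : p ∈ e.source) (v : C4) :
    chartD e p (chartDInv e p v) = v := by
  have h := (mdifferentiable_of_mem_maximalAtlas he).comp_symm_deriv (e.map_source hp)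
  rw [e.left_inv hp] at h
  exact DFunLike.congr_fun h v

theorem inverse_mfderiv_chart (he : e ∈ IsManifold.maximalAtlas 𝓘(ℂ, C4) ω M)
    {p : M} (hp : p ∈ e.source) :
    (mfderiv 𝓘(ℂ, C4) 𝓘(ℂ, C4) e p).IsInvertible ∧
      (mfderiv 𝓘(ℂ, C4) 𝓘(ℂ, C4) e p).inverse = chartDInv e p := by
  have h1 : (chartD e p).comp (chartDInv e p) = ContinuousLinearMap.id ℂ C4 := by
    exact ContinuousLinearMap.ext fun v => chartD_chartDInv he hp v
  have h2 : (chartDInv e p).comp (chartD e p) = ContinuousLinearMap.id ℂ _ := by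
    exact ContinuousLinearMap.ext fun v => chartDInv_chartD he hp v
  exact ⟨ContinuousLinearMap.IsInvertible.of_inverse h1 h2, ContinuousLinearMap.inverse_eq h1 h2⟩

theorem mpullback_chart_apply (he : e ∈ IsManifold.maximalAtlas 𝓘(ℂ, C4) ω M)
    {p : M} (hp : p ∈ e.source) (Y : C4 → C4) :
    mpullback 𝓘(ℂ, C4) 𝓘(ℂ, C4) e Y p = chartDInv e p (Y (e p)) :=
  DFunLike.congr_fun (inverse_mfderiv_chart he hp).2 (Y (e p))

theorem inverse_mfderiv_chart_symm (he : e ∈ IsManifold.maximalAtlas 𝓘(ℂ, C4) ω M)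
    {z : C4} (hz : z ∈ e.target) :
    (mfderiv 𝓘(ℂ, C4) 𝓘(ℂ, C4) e.symm z).IsInvertible ∧
      (mfderiv 𝓘(ℂ, C4) 𝓘(ℂ, C4) e.symm z).inverse = chartD e (e.symm z) := by
  have h1 := (mdifferentiable_of_mem_maximalAtlas he).comp_symm_deriv hz
  have h2 := (mdifferentiable_of_mem_maximalAtlas he).symm_comp_deriv (e.map_target hz)
  rw [e.right_inv hz] at h2
  exact ⟨ContinuousLinearMap.IsInvertible.of_inverse h2 h1, ContinuousLinearMap.inverse_eq h2 h1⟩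

theorem mdifferentiableAt_trivial_section {f : M → ℂ} {p : M} :
    MDifferentiableAt 𝓘(ℂ, C4) (𝓘(ℂ, C4).prod 𝓘(ℂ, ℂ))
      (fun x => TotalSpace.mk' ℂ (E := Bundle.Trivial M ℂ) x (f x)) p ↔
    MDifferentiableAt 𝓘(ℂ, C4) 𝓘(ℂ, ℂ) f p := by
  rw [mdifferentiableAt_totalSpace]
  exact ⟨fun h => h.2, fun h => ⟨mdifferentiableAt_id, h⟩⟩

/-- The coordinate representation of a vector field. -/
def coordRep (e : OpenPartialHomeomorph M C4) (X : VecField M) (y : C4) : C4 :=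
  chartD e (e.symm y) (X (e.symm y))

theorem coordRep_apply (e : OpenPartialHomeomorph M C4) (X : VecField M) {p : M}
    (hp : p ∈ e.source) : coordRep e X (e p) = chartD e p (X p) := by
  rw [coordRep, e.left_inv hp]

theorem chartDInv_coordRep_eventuallyEq (he : e ∈ IsManifold.maximalAtlas 𝓘(ℂ, C4) ω M)
    (X : VecField M) {p : M} (hp : p ∈ e.source) :
    X =ᶠ[𝓝 p] fun q => chartDInv e q (coordRep e X (e q)) := by
  filter_upwards [e.open_source.mem_nhds hp] with q hq
  rw [coordRep_apply e X hq]
  exact (chartDInv_chartD he hq (X q)).symm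

variable [IsManifold 𝓘(ℂ, C4) ω M]

/-- The vector field `X` is complex differentiable at `p`. -/
def HolVecAt (X : VecField M) (p : M) : Prop :=
  MDifferentiableAt 𝓘(ℂ, C4) (𝓘(ℂ, C4)).tangent
    (fun p => (⟨p, X p⟩ : TangentBundle 𝓘(ℂ, C4) M)) p

theorem differentiableAt_coordRep (he : e ∈ IsManifold.maximalAtlas 𝓘(ℂ, C4) ω M)
    {X : VecField M} {z : C4} (hz : z ∈ e.target)
    (hX : HolVecAt X (e.symm z)) :
    DifferentiableAt ℂ (coordRep e X) z := by
  have : IsManifold 𝓘(ℂ, C4) 2 M := IsManifold.of_le (n := ω) le_top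
  have h := MDifferentiableAt.mpullback_vectorField (I := 𝓘(ℂ, C4)) (I' := 𝓘(ℂ, C4)) (V := X)
    (f := e.symm) (x₀ := z) (n := ω) hX
    ((contMDiffOn_symm_of_mem_maximalAtlas he).contMDiffAt (e.open_target.mem_nhds hz))
    (inverse_mfderiv_chart_symm he hz).1 le_top
  have h2 := (((contMDiff_snd_tangentBundle_modelSpace (n := 1) C4 𝓘(ℂ, C4)).mdifferentiable
    one_ne_zero).mdifferentiableAt.comp z h).differentiableAt
  refine h2.congr_of_eventuallyEq ?_
  filter_upwards [e.open_target.mem_nhds hz] with y hy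
  exact (DFunLike.congr_fun (inverse_mfderiv_chart_symm he hy).2 _).symm

theorem holVecAt_chartDInv (he : e ∈ IsManifold.maximalAtlas 𝓘(ℂ, C4) ω M)
    {Y : C4 → C4} {p : M} (hp : p ∈ e.source)
    (hY : DifferentiableAt ℂ Y (e p)) : HolVecAt (fun q => chartDInv e q (Y (e q))) p := by
  have : IsManifold 𝓘(ℂ, C4) 2 M := IsManifold.of_le (n := ω) le_top
  have hY' : MDifferentiableAt 𝓘(ℂ, C4) (𝓘(ℂ, C4)).tangent
      (fun y => (⟨y, Y y⟩ : TangentBundle 𝓘(ℂ, C4) C4)) (e p) := by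
    rw [mdifferentiableAt_totalSpace]
    exact ⟨mdifferentiableAt_id, by simpa using hY.mdifferentiableAt⟩
  have h := MDifferentiableAt.mpullback_vectorField (I := 𝓘(ℂ, C4)) (I' := 𝓘(ℂ, C4))
    (f := e) (x₀ := p) (n := ω) hY'
    ((contMDiffOn_of_mem_maximalAtlas he).contMDiffAt (e.open_source.mem_nhds hp))
    (inverse_mfderiv_chart he hp).1 le_top
  refine h.congr_of_eventuallyEq ?_
  filter_upwards [e.open_source.mem_nhds hp] with y hy
  rw [mpullback_chart_apply he hy]

theorem mlieBracket_chartDInv (he : e ∈ IsManifold.maximalAtlas 𝓘(ℂ, C4) ω M)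
    {X Y : C4 → C4} {p : M} (hp : p ∈ e.source)
    (hX : DifferentiableAt ℂ X (e p)) (hY : DifferentiableAt ℂ Y (e p)) :
    mlieBracket 𝓘(ℂ, C4) (fun q => chartDInv e q (X (e q))) (fun q => chartDInv e q (Y (e q))) p
      = chartDInv e p (lieBracket ℂ X Y (e p)) := by
  have : IsManifold 𝓘(ℂ, C4) (minSmoothness ℂ 2) M := IsManifold.of_le (n := ω) le_top
  have hT : ∀ {Y : C4 → C4}, DifferentiableAt ℂ Y (e p) →
      MDifferentiableAt 𝓘(ℂ, C4) (𝓘(ℂ, C4)).tangent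
      (fun y => (⟨y, Y y⟩ : TangentBundle 𝓘(ℂ, C4) C4)) (e p) := fun hY => by
    rw [mdifferentiableAt_totalSpace]
    exact ⟨mdifferentiableAt_id, by simpa using hY.mdifferentiableAt⟩
  have h := mpullback_mlieBracket (I := 𝓘(ℂ, C4)) (I' := 𝓘(ℂ, C4)) (hT hX) (hT hY) (n := ω)
    ((contMDiffOn_of_mem_maximalAtlas he).contMDiffAt (e.open_source.mem_nhds hp)) le_top
  have hb : mlieBracket 𝓘(ℂ, C4) (M := C4) X Y = lieBracket ℂ X Y := by
    have hw := mlieBracketWithin_eq_lieBracketWithin (𝕜 := ℂ) (E := C4) (V := X) (W := Y)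
      (s := univ)
    exact (mlieBracketWithin_univ.symm.trans hw).trans lieBracketWithin_univ
  refine Eq.trans ?_ (h.symm.trans ?_)
  swap
  · rw [hb]
    exact mpullback_chart_apply he hp _
  refine EventuallyEq.mlieBracket_vectorField_eq ?_ ?_ <;>
  filter_upwards [e.open_source.mem_nhds hp] with y hy
  · exact (mpullback_chart_apply he hy X).symm
  · exact (mpullback_chart_apply he hy Y).symm

theorem mlieBracket_eq_chartDInv (he : e ∈ IsManifold.maximalAtlas 𝓘(ℂ, C4) ω M)
    {X Y : VecField M} {p : M} (hp : p ∈ e.source) (hX : HolVecAt X p) (hY : HolVecAt Y p) :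
    mlieBracket 𝓘(ℂ, C4) X Y p
      = chartDInv e p (lieBracket ℂ (coordRep e X) (coordRep e Y) (e p)) := by
  rw [← e.left_inv hp] at hX hY
  rw [← mlieBracket_chartDInv he hp (differentiableAt_coordRep he (e.map_source hp) hX)
    (differentiableAt_coordRep he (e.map_source hp) hY)]
  exact EventuallyEq.mlieBracket_vectorField_eq (chartDInv_coordRep_eventuallyEq he X hp)
    (chartDInv_coordRep_eventuallyEq he Y hp)

theorem holEndOn_of_apply {J : EndField M} {U : Set M}
    (h : ∀ p ∈ U, ∀ X : VecField M, HolVecAt X p → HolVecAt (fun q => J q (X q)) p) :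
    HolEndOn J U := fun p hp =>
  (mdifferentiableAt_hom_of_apply (φ := J) (h p hp)).mdifferentiableWithinAt

theorem HolEndOn.holVecAt_apply {J : EndField M} {U : Set M} (hJ : HolEndOn J U) (hU : IsOpen U)
    {p : M} (hp : p ∈ U) {X : VecField M} (hX : HolVecAt X p) :
    HolVecAt (fun q => J q (X q)) p :=
  ((hJ p hp).mdifferentiableAt (hU.mem_nhds hp)).clm_bundle_apply hX

theorem holBilinOn_of_apply {g : BilinField M} {U : Set M}
    (h : ∀ p ∈ U, ∀ X Y : VecField M, HolVecAt X p → HolVecAt Y p →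
      MDifferentiableAt 𝓘(ℂ, C4) 𝓘(ℂ, ℂ) (fun q => g q (X q) (Y q)) p) :
    HolBilinOn g U := fun p hp => by
  refine (mdifferentiableAt_hom_of_apply (E₂ := fun x : M => TangentSpace 𝓘(ℂ, C4) x →L[ℂ] ℂ)
    (F₂ := C4 →L[ℂ] ℂ) (φ := g) fun X hX => ?_).mdifferentiableWithinAt
  refine mdifferentiableAt_hom_of_apply (E₂ := Bundle.Trivial M ℂ) (F₂ := ℂ)
    (φ := fun x => g x (X x)) fun Y hY => ?_
  exact mdifferentiableAt_trivial_section.2 (h p hp X Y hX hY)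

theorem HolBilinOn.mdifferentiableAt_apply {g : BilinField M} {U : Set M} (hg : HolBilinOn g U)
    (hU : IsOpen U) {p : M} (hp : p ∈ U) {X Y : VecField M} (hX : HolVecAt X p)
    (hY : HolVecAt Y p) : MDifferentiableAt 𝓘(ℂ, C4) 𝓘(ℂ, ℂ) (fun q => g q (X q) (Y q)) p :=
  mdifferentiableAt_trivial_section.1
    (MDifferentiableAt.clm_bundle_apply₂ (E₃ := Bundle.Trivial M ℂ) (F₃ := ℂ)
      ((hg p hp).mdifferentiableAt (hU.mem_nhds hp)) hX hY)

end ChartTransfer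

/-! ### From a solution of the system to a hyper-Hermitian metric -/

section ChartHyperHermitian

open Filter Topology VectorField

variable {M : Type*} [TopologicalSpace M] [ChartedSpace C4 M]

theorem chartDInv_zero (e : OpenPartialHomeomorph M C4) (m : M) : chartDInv e m 0 = 0 :=
  ContinuousLinearMap.map_zero _

theorem chartDInv_neg (e : OpenPartialHomeomorph M C4) (m : M) (v : C4) :
    chartDInv e m (-v) = -chartDInv e m v :=
  ContinuousLinearMap.map_neg _ _

theorem chartDInv_add (e : OpenPartialHomeomorph M C4) (m : M) (u v : C4) :
    chartDInv e m (u + v) = chartDInv e m u + chartDInv e m v :=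
  ContinuousLinearMap.map_add _ _ _

theorem chartDInv_sub (e : OpenPartialHomeomorph M C4) (m : M) (u v : C4) :
    chartDInv e m (u - v) = chartDInv e m u - chartDInv e m v :=
  ContinuousLinearMap.map_sub _ _ _

theorem chartDInv_smul (e : OpenPartialHomeomorph M C4) (m : M) (c : ℂ) (v : C4) :
    chartDInv e m (c • v) = c • chartDInv e m v :=
  ContinuousLinearMap.map_smul _ _ _

/-- The endomorphism field `flatEnd` in a chart. -/
def chartEnd (e : OpenPartialHomeomorph M C4) (Θ : Fin 2 → C4 → ℂ) (p q r : ℂ) : EndField M :=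
  fun m => ((chartDInv e m).comp (flatEnd Θ p q r (e m))).comp (chartD e m)

theorem chartEnd_apply (e : OpenPartialHomeomorph M C4) (Θ : Fin 2 → C4 → ℂ) (p q r : ℂ) (m : M)
    (v : TangentSpace 𝓘(ℂ, C4) m) :
    chartEnd e Θ p q r m v = chartDInv e m (flatEnd Θ p q r (e m) (chartD e m v)) := rfl

theorem chartMetric_apply (e : OpenPartialHomeomorph M C4) (Θ : Fin 2 → C4 → ℂ) (m : M)
    (u v : TangentSpace 𝓘(ℂ, C4) m) :
    chartMetric e Θ m u v = coordMetric Θ (e m) (chartD e m u) (chartD e m v) := rfl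

theorem flatEnd_combination (Θ : Fin 2 → C4 → ℂ) (z v : C4) (a b c : ℂ) :
    a • flatEnd Θ (-Complex.I) 0 0 z v + b • flatEnd Θ 0 1 (-1) z v
      + c • flatEnd Θ 0 Complex.I Complex.I z v
      = flatEnd Θ (-(a * Complex.I)) (b + c * Complex.I) (-b + c * Complex.I) z v := by
  have h : ∀ u : C4, a • frameEnd (-Complex.I) 0 0 u + b • frameEnd 0 1 (-1) u
      + c • frameEnd 0 Complex.I Complex.I u
      = frameEnd (-(a * Complex.I)) (b + c * Complex.I) (-b + c * Complex.I) u := fun u => by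
    refine Prod.ext ?_ ?_
    · simp only [frameEnd_apply, Prod.smul_mk, Prod.mk_add_mk]
      module
    · simp only [frameEnd_apply, Prod.smul_mk, Prod.mk_add_mk]
      module
  simp only [flatEnd_apply]
  rw [← h, map_add, map_add, map_smul, map_smul, map_smul]

theorem flatEnd_comp (Θ : Fin 2 → C4 → ℂ) (p q r p' q' r' : ℂ) (z v : C4) :
    flatEnd Θ p q r z (flatEnd Θ p' q' r' z v)
      = shear (frameShift Θ z)
        (frameEnd p q r (frameEnd p' q' r' (shear (-frameShift Θ z) v))) := by
  rw [flatEnd_apply Θ p', flatEnd_shear]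

/-- All members of the quaternionic family belong to the same three-parameter family of frame
endomorphisms, with p² + qr = -(a² + b² + c²). Integrability and invariance thus need to be proved
only once. -/
theorem quatComb_chartEnd (e : OpenPartialHomeomorph M C4) (Θ : Fin 2 → C4 → ℂ) (a b c : ℂ) :
    quatComb (chartEnd e Θ (-Complex.I) 0 0) (chartEnd e Θ 0 1 (-1))
      (chartEnd e Θ 0 Complex.I Complex.I) a b c
      = chartEnd e Θ (-(a * Complex.I)) (b + c * Complex.I) (-b + c * Complex.I) := by
  funext m
  refine ContinuousLinearMap.ext fun v => ?_
  rw [chartEnd_apply, ← flatEnd_combination, chartDInv_add, chartDInv_add, chartDInv_smul,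
    chartDInv_smul, chartDInv_smul]
  rfl

variable {e : OpenPartialHomeomorph M C4} {Θ : Fin 2 → C4 → ℂ}

theorem chartD_chartEnd (he : e ∈ IsManifold.maximalAtlas 𝓘(ℂ, C4) ω M) {m : M}
    (hm : m ∈ e.source) (p q r : ℂ) (v : TangentSpace 𝓘(ℂ, C4) m) :
    chartD e m (chartEnd e Θ p q r m v) = flatEnd Θ p q r (e m) (chartD e m v) := by
  rw [chartEnd_apply, chartD_chartDInv he hm]

theorem chartEnd_chartEnd (he : e ∈ IsManifold.maximalAtlas 𝓘(ℂ, C4) ω M) {m : M}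
    (hm : m ∈ e.source) {p q r : ℂ} (h : p ^ 2 + q * r = -1) (v : TangentSpace 𝓘(ℂ, C4) m) :
    chartEnd e Θ p q r m (chartEnd e Θ p q r m v) = -v := by
  rw [chartEnd_apply e Θ p q r m (chartEnd e Θ p q r m v), chartD_chartEnd he hm,
    flatEnd_flatEnd Θ p q r h, chartDInv_neg, chartDInv_chartD he hm]

variable [IsManifold 𝓘(ℂ, C4) ω M]

theorem holEndOn_chartEnd (he : e ∈ IsManifold.maximalAtlas 𝓘(ℂ, C4) ω M)
    (hΘ : ∀ z ∈ e.target, ∀ C, AnalyticAt ℂ (Θ C) z) (p q r : ℂ) :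
    HolEndOn (chartEnd e Θ p q r) e.source := by
  refine holEndOn_of_apply fun m hm X hX => ?_
  rw [← e.left_inv hm] at hX
  refine (holVecAt_chartDInv he hm (differentiableAt_flatEnd (hΘ _ (e.map_source hm)) p q r
    (differentiableAt_coordRep he (e.map_source hm) hX))).congr_of_eventuallyEq ?_
  filter_upwards [e.open_source.mem_nhds hm] with y hy
  rw [coordRep_apply e X hy, chartEnd_apply]

theorem chartEnd_integrable (he : e ∈ IsManifold.maximalAtlas 𝓘(ℂ, C4) ω M)
    (hΘ : ∀ z ∈ e.target, ∀ C, AnalyticAt ℂ (Θ C) z) (hV : SolvesHyperEq Θ e.target)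
    {p q r : ℂ} (h : p ^ 2 + q * r = -1) :
    IntegrableOnSet (chartEnd e Θ p q r) e.source := by
  intro V hVo hVs X Y hX hY m hmV
  have hm := hVs hmV
  have hz := e.map_source hm
  have hXm : HolVecAt X m := (hX m hmV).mdifferentiableAt (hVo.mem_nhds hmV)
  have hYm : HolVecAt Y m := (hY m hmV).mdifferentiableAt (hVo.mem_nhds hmV)
  have hhol := holEndOn_chartEnd he hΘ p q r
  have hJX := hhol.holVecAt_apply e.open_source hm hXm
  have hJY := hhol.holVecAt_apply e.open_source hm hYm
  have hrep : ∀ X : VecField M, coordRep e (fun n => chartEnd e Θ p q r n (X n)) =ᶠ[𝓝 (e m)]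
      fun y => flatEnd Θ p q r y (coordRep e X y) := fun X => by
    filter_upwards [e.open_target.mem_nhds hz] with y hy
    rw [coordRep, chartD_chartEnd he (e.map_target hy), e.right_inv hy]
    rfl
  have hdX := differentiableAt_coordRep (X := X) he hz (by rwa [e.left_inv hm])
  have hdY := differentiableAt_coordRep (X := Y) he hz (by rwa [e.left_inv hm])
  have key := congrArg (chartDInv e m) (flatEnd_nijenhuis hV hz (hΘ _ hz) h (X := coordRep e X)
    (Y := coordRep e Y) hdX hdY)
  rw [nijenhuis, mlieBracket_eq_chartDInv he hm hXm hYm, mlieBracket_eq_chartDInv he hm hJX hYm,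
    mlieBracket_eq_chartDInv he hm hXm hJY, mlieBracket_eq_chartDInv he hm hJX hJY,
    (hrep X).lieBracket_vectorField_eq EventuallyEq.rfl,
    EventuallyEq.rfl.lieBracket_vectorField_eq (hrep Y),
    (hrep X).lieBracket_vectorField_eq (hrep Y)]
  simp only [chartEnd_apply, chartD_chartDInv he hm, ← chartDInv_sub, ← chartDInv_add]
  rw [key, chartDInv_zero]

/-- A solution of the system defines a hyper-Hermitian metric. -/
theorem isHyperHermitianOn_chartMetric (he : e ∈ IsManifold.maximalAtlas 𝓘(ℂ, C4) ω M)
    (hΘ : ∀ A, DifferentiableOn ℂ (Θ A) e.target) (hV : SolvesHyperEq Θ e.target) :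
    IsHyperHermitianOn (chartMetric e Θ) e.source := by
  have hΘ' : ∀ z ∈ e.target, ∀ C, AnalyticAt ℂ (Θ C) z := fun z hz C =>
    DifferentiableOn.analyticAt_complex e.open_target (hΘ C) hz
  have hII := Complex.I_mul_I
  have hone : ∀ a b c : ℂ, a ^ 2 + b ^ 2 + c ^ 2 = 1 →
      (-(a * Complex.I)) ^ 2 + (b + c * Complex.I) * (-b + c * Complex.I) = -1 := fun a b c h => by
    linear_combination (a ^ 2 + c ^ 2) * hII - h
  refine ⟨?_, ?_, ?_, ?_⟩
  · refine holBilinOn_of_apply fun m hm X Y hX hY => ?_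
    have hz := e.map_source hm
    rw [← e.left_inv hm] at hX hY
    have h1 := (differentiableAt_coordMetric (hΘ' _ hz) (differentiableAt_coordRep he hz hX)
      (differentiableAt_coordRep he hz hY)).mdifferentiableAt.comp m
      ((mdifferentiable_of_mem_maximalAtlas he).mdifferentiableAt hm)
    refine h1.congr_of_eventuallyEq ?_
    filter_upwards [e.open_source.mem_nhds hm] with y hy
    rw [Function.comp_apply, coordRep_apply e X hy, coordRep_apply e Y hy, chartMetric_apply]
  · intro m _ u v
    rw [chartMetric_apply, chartMetric_apply, coordMetric_symm]
  · intro m hm u h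
    have h0 : chartD e m u = 0 := by
      refine coordMetric_nondegenerate Θ (e m) _ fun v => ?_
      have := h (chartDInv e m v)
      rwa [chartMetric_apply, chartD_chartDInv he hm] at this
    rw [← chartDInv_chartD he hm u, h0, chartDInv_zero]
  · refine ⟨chartEnd e Θ (-Complex.I) 0 0, chartEnd e Θ 0 1 (-1),
      chartEnd e Θ 0 Complex.I Complex.I, ⟨holEndOn_chartEnd he hΘ' _ _ _,
        holEndOn_chartEnd he hΘ' _ _ _, holEndOn_chartEnd he hΘ' _ _ _,
        fun m hm v => chartEnd_chartEnd he hm (by simp) v,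
        fun m hm v => chartEnd_chartEnd he hm (by simp) v,
        fun m hm v => chartEnd_chartEnd he hm (by simp) v, ?_, ?_, ?_⟩, ?_⟩
    · intro m hm v
      rw [chartEnd_apply e Θ (-Complex.I), chartD_chartEnd he hm, chartEnd_apply, flatEnd_comp,
        flatEnd_apply]
      congr 2
      refine Prod.ext ?_ ?_ <;> simp [frameEnd_apply]
    · intro m hm v
      rw [chartEnd_apply e Θ 0 1, chartD_chartEnd he hm, chartEnd_apply, flatEnd_comp,
        flatEnd_apply, ← chartDInv_neg, ← map_neg]
      congr 2
      refine Prod.ext ?_ ?_ <;> simp [frameEnd_apply]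
    · intro a b c h
      rw [quatComb_chartEnd]
      exact chartEnd_integrable he hΘ' hV (hone a b c h)
    · intro a b c h m hm u v
      rw [quatComb_chartEnd, chartMetric_apply, chartD_chartEnd he hm, chartD_chartEnd he hm,
        coordMetric_flatEnd Θ (hone a b c h), chartMetric_apply]

end ChartHyperHermitian

/-! ### Hypercomplex structures read in a chart -/

section AdaptedCharts

open Filter Topology VectorField

/-- A quaternionic pair on `ℂ⁴` is linearly equivalent to the standard one. -/
theorem IsQuaternionicPair.exists_standard_form {I J : C4 →L[ℂ] C4} (h : IsQuaternionicPair I J) :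
    ∃ T : C4 ≃L[ℂ] C4, (∀ v, I (T v) = T (Complex.I • v.1, -(Complex.I • v.2))) ∧
      ∀ v, J (T v) = T (-v.2, v.1) := by
  let Q : Submodule ℂ C4 := LinearMap.ker (I - Complex.I • ContinuousLinearMap.id ℂ C4).toLinearMap
  have hQ : ∀ q, q ∈ Q ↔ I q = Complex.I • q := fun q => by
    simp [Q, LinearMap.mem_ker, sub_eq_zero]
  -- ℂ⁴ is the direct sum of the i-eigenspace `Q` and its image under J, so `Q` has dimension two; a
  -- basis of it together with its J-image is the required frame.
  let F : Q × Q →ₗ[ℂ] C4 := Q.subtype.coprod (J.toLinearMap ∘ₗ Q.subtype)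
  have hF : ∀ u, F u = u.1 + J u.2 := fun u => by simp [F]
  have hsurj : Function.Surjective F := fun ξ => by
    obtain ⟨q, q', hq, hq', e⟩ := h.exists_eq_add ξ
    exact ⟨(⟨q, (hQ q).2 hq⟩, ⟨q', (hQ q').2 hq'⟩), by rw [hF, e]⟩
  have hinj : Function.Injective F := by
    rw [← LinearMap.ker_eq_bot, LinearMap.ker_eq_bot']
    rintro ⟨⟨q, hq⟩, ⟨q', hq'⟩⟩ he
    rw [hQ] at hq hq'
    rw [hF] at he
    simp only at he
    have h1 : Complex.I • (q - J q') = 0 := by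
      have h2 := congrArg I he
      have h3 := h.anticomm q'
      rw [hq', map_smul] at h3
      rw [map_add, hq, map_zero, ← neg_neg (I (J q')), ← h3] at h2
      rw [smul_sub, sub_eq_add_neg, h2]
    have h2 : q - J q' = 0 := by simpa using h1
    have h3 : (2 : ℂ) • q = 0 := by
      have h7 : (2 : ℂ) • q = (q + J q') + (q - J q') := by module
      rw [h7, he, h2, add_zero]
    have h4 : q = 0 := by simpa using h3
    have h5 : J q' = 0 := by simpa [h4] using he
    have h6 : q' = 0 := by
      have := h.sq_J q'
      rw [h5, map_zero] at this
      exact (neg_eq_zero.1 this.symm)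
    simp [h4, h6]
  let F' := LinearEquiv.ofBijective F ⟨hinj, hsurj⟩
  have hdim : Module.finrank ℂ Q = 2 := by
    have h1 := F'.finrank_eq
    rw [Module.finrank_prod, Module.finrank_prod, Module.finrank_fin_fun] at h1
    omega
  let φ : (Fin 2 → ℂ) ≃ₗ[ℂ] Q := LinearEquiv.ofFinrankEq _ _ (by rw [hdim]; simp)
  let T := ((φ.prodCongr φ).trans F').toContinuousLinearEquiv
  have hT : ∀ v : C4, T v = (φ v.1 : C4) + J (φ v.2) := fun v => hF (φ v.1, φ v.2)
  have hφ : ∀ x, I (φ x) = Complex.I • (φ x : C4) := fun x => (hQ _).1 (φ x).2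
  refine ⟨T, fun v => ?_, fun v => ?_⟩
  · have h3 := h.anticomm (φ v.2)
    rw [hφ, map_smul] at h3
    rw [hT, hT, map_add, hφ, ← neg_neg (I (J _)), ← h3]
    simp
  · rw [hT, hT, map_add, h.sq_J]
    simp [add_comm]

variable {M : Type*} [TopologicalSpace M] [ChartedSpace C4 M]

theorem trans_mem_maximalAtlas {e : OpenPartialHomeomorph M C4}
    (he : e ∈ IsManifold.maximalAtlas 𝓘(ℂ, C4) ω M) {φ : OpenPartialHomeomorph C4 C4}
    (hφ : φ ∈ contDiffGroupoid ω 𝓘(ℂ, C4)) : e.trans φ ∈ IsManifold.maximalAtlas 𝓘(ℂ, C4) ω M := by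
  rw [IsManifold.mem_maximalAtlas_iff, mem_maximalAtlas_iff] at he ⊢
  intro e' he'
  obtain ⟨h1, h2⟩ := he e' he'
  constructor
  · rw [OpenPartialHomeomorph.trans_symm_eq_symm_trans_symm, OpenPartialHomeomorph.trans_assoc]
    exact (contDiffGroupoid ω 𝓘(ℂ, C4)).trans ((contDiffGroupoid ω 𝓘(ℂ, C4)).symm hφ) h1
  · rw [← OpenPartialHomeomorph.trans_assoc]
    exact (contDiffGroupoid ω 𝓘(ℂ, C4)).trans h2 hφ

theorem chartD_trans {e : OpenPartialHomeomorph M C4}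
    (he : e ∈ IsManifold.maximalAtlas 𝓘(ℂ, C4) ω M) {φ : OpenPartialHomeomorph C4 C4} {m : M}
    (hm : m ∈ e.source) (hφ : DifferentiableAt ℂ φ (e m)) (v : TangentSpace 𝓘(ℂ, C4) m) :
    chartD (e.trans φ) m v = fderiv ℂ φ (e m) (chartD e m v) := by
  have h := mfderiv_comp m (I'' := 𝓘(ℂ, C4)) hφ.mdifferentiableAt
    ((mdifferentiable_of_mem_maximalAtlas he).mdifferentiableAt hm)
  rw [mfderiv_eq_fderiv] at h
  exact DFunLike.congr_fun h v

/-- The coordinate representation of an endomorphism field. -/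
def coordEnd (e : OpenPartialHomeomorph M C4) (J : EndField M) (z : C4) : C4 →L[ℂ] C4 :=
  (chartD e (e.symm z)).comp ((J (e.symm z)).comp (chartDInv e (e.symm z)))

theorem coordEnd_apply (e : OpenPartialHomeomorph M C4) (J : EndField M) (z v : C4) :
    coordEnd e J z v = chartD e (e.symm z) (J (e.symm z) (chartDInv e (e.symm z) v)) := rfl

theorem chartDInv_coordEnd {e : OpenPartialHomeomorph M C4}
    (he : e ∈ IsManifold.maximalAtlas 𝓘(ℂ, C4) ω M) (J : EndField M) {m : M} (hm : m ∈ e.source)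
    (v : C4) : chartDInv e m (coordEnd e J (e m) v) = J m (chartDInv e m v) := by
  rw [coordEnd_apply, e.left_inv hm, chartDInv_chartD he hm]

theorem coordEnd_coordEnd {e : OpenPartialHomeomorph M C4}
    (he : e ∈ IsManifold.maximalAtlas 𝓘(ℂ, C4) ω M) (I J : EndField M) {z : C4}
    (hz : z ∈ e.target) (v : C4) : coordEnd e I z (coordEnd e J z v)
      = chartD e (e.symm z) (I (e.symm z) (J (e.symm z) (chartDInv e (e.symm z) v))) := by
  rw [coordEnd_apply, coordEnd_apply, chartDInv_chartD he (e.map_target hz)]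

theorem chartD_neg (e : OpenPartialHomeomorph M C4) (m : M) (v : TangentSpace 𝓘(ℂ, C4) m) :
    chartD e m (-v) = -chartD e m v :=
  ContinuousLinearMap.map_neg _ _

variable [IsManifold 𝓘(ℂ, C4) ω M] {e : OpenPartialHomeomorph M C4} {U : Set M}

theorem analyticAt_coordEnd (he : e ∈ IsManifold.maximalAtlas 𝓘(ℂ, C4) ω M) (hU : IsOpen U)
    (heU : e.source ⊆ U) {J : EndField M} (hJ : HolEndOn J U) {z : C4} (hz : z ∈ e.target) :
    AnalyticAt ℂ (coordEnd e J) z := by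
  refine DifferentiableOn.analyticAt_complex e.open_target
    (differentiableOn_clm_of_apply fun v y hy => ?_) hz
  have hm := e.map_target hy
  have h1 := holVecAt_chartDInv (Y := fun _ => v) he hm (differentiableAt_const v)
  have h2 := hJ.holVecAt_apply hU (heU hm) h1
  exact (differentiableAt_coordRep he hy h2).differentiableWithinAt

theorem isQuaternionicPair_coordEnd (he : e ∈ IsManifold.maximalAtlas 𝓘(ℂ, C4) ω M)
    (heU : e.source ⊆ U) {I J K : EndField M} (h : IsHypercomplexOn I J K U) {z : C4}
    (hz : z ∈ e.target) : IsQuaternionicPair (coordEnd e I z) (coordEnd e J z) := by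
  have hm := e.map_target hz
  have hr : ∀ v, chartD e (e.symm z) (chartDInv e (e.symm z) v) = v := chartD_chartDInv he hm
  refine ⟨fun v => ?_, fun v => ?_, fun v => ?_⟩
  · rw [coordEnd_coordEnd he I I hz, h.sq_I _ (heU hm), chartD_neg, hr]
  · rw [coordEnd_coordEnd he J J hz, h.sq_J _ (heU hm), chartD_neg, hr]
  · rw [coordEnd_coordEnd he J I hz, coordEnd_coordEnd he I J hz, h.mul_JI _ (heU hm),
      h.mul_IJ _ (heU hm), chartD_neg]

/-- For fields X, Y in the i-eigenbundle of N with bracket L, the Nijenhuis expression is N²L - 2iNL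
- L = -2i(NL - iL); its vanishing says that L is again in the eigenbundle. -/
theorem IsHypercomplexOn.pencilInvolutiveAt_coordEnd
    (he : e ∈ IsManifold.maximalAtlas 𝓘(ℂ, C4) ω M)
    (heU : e.source ⊆ U) {I J K : EndField M} (h : IsHypercomplexOn I J K U) {z : C4}
    (hz : z ∈ e.target) : PencilInvolutiveAt (coordEnd e I) (coordEnd e J) z := by
  intro μ X Y hX hY
  set N := nullPencil (coordEnd e I) (coordEnd e J) μ with hN
  set 𝒥 := quatComb I J K 1 (Complex.I * μ) (-μ) with h𝒥
  have hrep : ∀ y ∈ e.target, ∀ v, 𝒥 (e.symm y) (chartDInv e (e.symm y) v)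
      = chartDInv e (e.symm y) (N y v) := by
    intro y hy v
    have hm := e.map_target hy
    have hI := chartDInv_coordEnd he I hm
    have hJ := chartDInv_coordEnd he J hm
    rw [e.right_inv hy] at hI hJ
    have e1 : N y v = coordEnd e I y v + (Complex.I * μ) • coordEnd e J y v
        - μ • coordEnd e I y (coordEnd e J y v) := rfl
    rw [e1, chartDInv_sub, chartDInv_add, chartDInv_smul, chartDInv_smul, hI, hI, hJ,
      h.mul_IJ _ (heU hm)]
    change (1 : ℂ) • I _ _ + (Complex.I * μ) • J _ _ + (-μ) • K _ _ = _
    rw [one_smul, neg_smul, sub_eq_add_neg]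
  have hsq : ∀ v, N z (N z v) = -v := (isQuaternionicPair_coordEnd he heU h hz).pencil_sq μ
  obtain ⟨V, hV, hVo, hzV⟩ := _root_.eventually_nhds_iff.1 (hX.and hY)
  set m := e.symm z with hmdef
  have hm : m ∈ e.source := e.map_target hz
  have hem : e m = z := e.right_inv hz
  let S : Set M := e.source ∩ e ⁻¹' V
  have hS : IsOpen S := e.isOpen_inter_preimage hVo
  have hmS : m ∈ S := ⟨hm, by rw [mem_preimage, hem]; exact hzV⟩
  have hhol : ∀ X : C4 → C4, (∀ y ∈ V, DifferentiableAt ℂ X y) →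
      HolVecOn (fun q => chartDInv e q (X (e q))) S := fun X hX q hq =>
    MDifferentiableAt.mdifferentiableWithinAt (holVecAt_chartDInv he hq.1 (hX _ hq.2))
  have hmul : ∀ X : C4 → C4, (∀ y ∈ V, N y (X y) = Complex.I • X y) →
      (fun q => 𝒥 q (chartDInv e q (X (e q)))) =ᶠ[𝓝 m]
        fun q => chartDInv e q ((Complex.I • X) (e q)) := fun X hX => by
    filter_upwards [hS.mem_nhds hmS] with q hq
    have h1 := hrep (e q) (e.map_source hq.1) (X (e q))
    rw [e.left_inv hq.1] at h1
    rw [h1, hX _ hq.2]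
    rfl
  have hdX : DifferentiableAt ℂ X (e m) := by rw [hem]; exact (hV z hzV).1.1
  have hdY : DifferentiableAt ℂ Y (e m) := by rw [hem]; exact (hV z hzV).2.1
  have hmX := hmul X fun y hy => (hV y hy).1.2
  have hmY := hmul Y fun y hy => (hV y hy).2.2
  have key := h.integrable 1 (Complex.I * μ) (-μ)
    (by linear_combination μ ^ 2 * Complex.I_sq) S hS
    (fun q hq => heU hq.1) _ _ (hhol X fun y hy => (hV y hy).1.1)
    (hhol Y fun y hy => (hV y hy).2.1) m hmS
  have hb : mlieBracket 𝓘(ℂ, C4) (fun q => chartDInv e q (X (e q)))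
      (fun q => chartDInv e q (Y (e q))) m = chartDInv e m (lieBracket ℂ X Y z) := by
    rw [mlieBracket_chartDInv he hm hdX hdY, hem]
  have hbX : mlieBracket 𝓘(ℂ, C4) (fun q => 𝒥 q (chartDInv e q (X (e q))))
      (fun q => chartDInv e q (Y (e q))) m
      = chartDInv e m (Complex.I • lieBracket ℂ X Y z) := by
    rw [← hem, ← lieBracket_const_smul_left hdX,
      ← mlieBracket_chartDInv he hm (hdX.const_smul _) hdY]
    exact EventuallyEq.mlieBracket_vectorField_eq hmX EventuallyEq.rfl
  have hbY : mlieBracket 𝓘(ℂ, C4) (fun q => chartDInv e q (X (e q)))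
      (fun q => 𝒥 q (chartDInv e q (Y (e q)))) m
      = chartDInv e m (Complex.I • lieBracket ℂ X Y z) := by
    rw [← hem, ← lieBracket_const_smul_right hdY,
      ← mlieBracket_chartDInv he hm hdX (hdY.const_smul _)]
    exact EventuallyEq.mlieBracket_vectorField_eq EventuallyEq.rfl hmY
  have hbXY : mlieBracket 𝓘(ℂ, C4) (fun q => 𝒥 q (chartDInv e q (X (e q))))
      (fun q => 𝒥 q (chartDInv e q (Y (e q)))) m
      = chartDInv e m (Complex.I • Complex.I • lieBracket ℂ X Y z) := by
    rw [← hem, ← lieBracket_const_smul_right hdY, ← lieBracket_const_smul_left hdX,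
      ← mlieBracket_chartDInv he hm (hdX.const_smul _) (hdY.const_smul _)]
    exact EventuallyEq.mlieBracket_vectorField_eq hmX hmY
  have hrm : ∀ v, 𝒥 m (chartDInv e m v) = chartDInv e m (N z v) := hrep z hz
  rw [nijenhuis, ← h𝒥, hb, hbX, hbY, hbXY, hrm, hrm, hrm, hsq, ← chartDInv_sub,
    ← chartDInv_sub, ← chartDInv_add] at key
  have key2 := congrArg (chartD e m) key
  rw [chartD_chartDInv he hm] at key2
  set L := lieBracket ℂ X Y z
  have key3 : N z L = Complex.I • L := by
    have h0 : -L - N z (Complex.I • L) - N z (Complex.I • L) + Complex.I • Complex.I • L = 0 :=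
      key2.trans (ContinuousLinearMap.map_zero _)
    rw [map_smul, smul_smul, Complex.I_mul_I] at h0
    have h1 : (-(2 * Complex.I)) • (N z L - Complex.I • L) = 0 := by
      rw [← h0]
      match_scalars
      · ring
      · linear_combination 2 * Complex.I_sq
    have h2 : N z L - Complex.I • L = 0 := by simpa using h1
    exact sub_eq_zero.1 h2
  exact key3

end AdaptedCharts

/-! ### The conformal factor -/

section ConformalForm

open Filter Topology VectorField

variable {M : Type*} [TopologicalSpace M] [ChartedSpace C4 M] [IsManifold 𝓘(ℂ, C4) ω M]

/-- Around each point there is a chart in which `I` and `J` are standard at the origin. -/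
theorem exists_centered_chart {U : Set M} (hU : IsOpen U) {I J K : EndField M}
    (h : IsHypercomplexOn I J K U) {p : M} (hp : p ∈ U) :
    ∃ e ∈ IsManifold.maximalAtlas 𝓘(ℂ, C4) ω M, p ∈ e.source ∧ e.source ⊆ U ∧ e p = 0 ∧
      (∀ v, coordEnd e I 0 v = (Complex.I • v.1, -(Complex.I • v.2))) ∧
      ∀ v, coordEnd e J 0 v = (-v.2, v.1) := by
  let e₀ := (chartAt C4 p).restr U
  have he₀ : e₀ ∈ IsManifold.maximalAtlas 𝓘(ℂ, C4) ω M :=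
    restr_mem_maximalAtlas _ (IsManifold.chart_mem_maximalAtlas p) hU
  have hs₀ : e₀.source = (chartAt C4 p).source ∩ U := (chartAt C4 p).restr_source' U hU
  have hp₀ : p ∈ e₀.source := by rw [hs₀]; exact ⟨mem_chart_source C4 p, hp⟩
  have hU₀ : e₀.source ⊆ U := by rw [hs₀]; exact inter_subset_right
  obtain ⟨T, hTI, hTJ⟩ := (isQuaternionicPair_coordEnd he₀ hU₀ h
    (e₀.map_source hp₀)).exists_standard_form
  let φ : OpenPartialHomeomorph C4 C4 :=
    ((Homeomorph.addRight (-e₀ p)).trans T.symm.toHomeomorph).toOpenPartialHomeomorph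
  have hφ : ∀ z, φ z = T.symm (z + -e₀ p) := fun z => rfl
  have hφs : ∀ z, φ.symm z = T z + e₀ p := fun z => by
    change T z + - -e₀ p = _
    rw [neg_neg]
  have hφm : φ ∈ contDiffGroupoid ω 𝓘(ℂ, C4) := by
    refine mem_contDiffGroupoid_of_analyticAt φ (fun z _ => ?_) (fun z _ => ?_)
    · exact (T.symm.toContinuousLinearMap.analyticAt _).comp (analyticAt_id.add analyticAt_const)
    · have h1 : (φ.symm : C4 → C4) = fun z => T z + e₀ p := funext hφs
      rw [h1]
      exact (T.toContinuousLinearMap.analyticAt _).add analyticAt_const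
  have hφd : HasFDerivAt φ T.symm.toContinuousLinearMap (e₀ p) :=
    T.symm.toContinuousLinearMap.hasFDerivAt.comp (e₀ p) ((hasFDerivAt_id (e₀ p)).add_const _)
  have he := trans_mem_maximalAtlas he₀ hφm
  have hpe : p ∈ (e₀.trans φ).source := by
    rw [OpenPartialHomeomorph.trans_source]; exact ⟨hp₀, mem_univ _⟩
  have he0 : (e₀.trans φ) p = 0 := by
    rw [OpenPartialHomeomorph.coe_trans, Function.comp_apply, hφ]
    simp
  have hsub : (e₀.trans φ).source ⊆ U := fun q hq => hU₀ (by
    rw [OpenPartialHomeomorph.trans_source] at hq; exact hq.1)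
  have hD : ∀ v, chartD (e₀.trans φ) p v = T.symm (chartD e₀ p v) := fun v => by
    rw [chartD_trans he₀ hp₀ hφd.differentiableAt, hφd.fderiv]
    rfl
  have hDi : ∀ v, chartDInv (e₀.trans φ) p v = chartDInv e₀ p (T v) := fun v => by
    rw [← chartDInv_chartD he hpe (chartDInv e₀ p (T v)), hD, chartD_chartDInv he₀ hp₀,
      T.symm_apply_apply]
  have hconj : ∀ (L : EndField M) v, coordEnd (e₀.trans φ) L 0 v
      = T.symm (coordEnd e₀ L (e₀ p) (T v)) := fun L v => by
    have h1 : coordEnd (e₀.trans φ) L ((e₀.trans φ) p) v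
        = chartD (e₀.trans φ) p (L p (chartDInv (e₀.trans φ) p v)) := by
      rw [coordEnd_apply, (e₀.trans φ).left_inv hpe]
    rw [he0] at h1
    rw [h1, hD, hDi, coordEnd_apply, e₀.left_inv hp₀]
  refine ⟨e₀.trans φ, he, hpe, hsub, he0, fun v => ?_, fun v => ?_⟩
  · rw [hconj, hTI, T.symm_apply_apply]
  · rw [hconj, hTJ, T.symm_apply_apply]

/-- A bilinear form that is invariant under the structures `I`, `J` is proportional to the
standard one in an adapted frame. -/
theorem bilin_eq_smul_coordMetric {V : Type*} [AddCommGroup V] [Module ℂ V]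
    {g : V → V → ℂ} (hadd : ∀ u v w, g (u + v) w = g u w + g v w)
    (hsmul : ∀ (c : ℂ) u w, g (c • u) w = c * g u w) (hsymm : ∀ u v, g u v = g v u)
    {I J : V → V} (hI : ∀ u v, g (I u) (I v) = g u v) (hJ : ∀ u v, g (J u) (J v) = g u v)
    (hJJ : ∀ u, J (J u) = -u) {q : Fin 2 → V} (hq : ∀ A, I (q A) = Complex.I • q A)
    {a b c d : Fin 2 → ℂ} {ξ η : V}
    (hξ : ξ = ∑ A, a A • q A + ∑ A, b A • -J (q A))
    (hη : η = ∑ A, c A • q A + ∑ A, d A • -J (q A)) :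
    g ξ η = 2 * g (q 0) (-J (q 1)) *
      ((1 / 2) * (a 0 * d 1 - a 1 * d 0 + (c 0 * b 1 - c 1 * b 0))) := by
  have hadd' : ∀ u v w, g w (u + v) = g w u + g w v := fun u v w => by
    rw [hsymm, hadd, hsymm w, hsymm w]
  have hsmul' : ∀ (c : ℂ) u w, g w (c • u) = c * g w u := fun c u w => by
    rw [hsymm, hsmul, hsymm w]
  have hneg : ∀ u w, g (-u) w = -g u w := fun u w => by
    rw [← neg_one_smul ℂ u, hsmul]; ring
  have hneg' : ∀ u w, g w (-u) = -g w u := fun u w => by rw [hsymm, hneg, hsymm w]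
  -- Invariance under I makes its i-eigenspace null, and invariance under J carries this over to the
  -- J-image. By J² = -1 the cross terms g(q_A, Jq_B) are antisymmetric in A and B, so one scalar
  -- determines g.
  have hqq : ∀ A B, g (q A) (q B) = 0 := fun A B => by
    have h := hI (q A) (q B)
    rw [hq, hq, hsmul, hsmul'] at h
    linear_combination (-1 / 2) * h + (1 / 2) * g (q A) (q B) * Complex.I_sq
  have hpp : ∀ A B, g (J (q A)) (J (q B)) = 0 := fun A B => (hJ _ _).trans (hqq A B)
  have hqp : ∀ A B, g (q A) (J (q B)) = -g (q B) (J (q A)) := fun A B => by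
    rw [← hJ (q A), hJJ, hneg', hsymm]
  have h00 : g (q 0) (J (q 0)) = 0 := by linear_combination (1 / 2) * hqp 0 0
  have h11 : g (q 1) (J (q 1)) = 0 := by linear_combination (1 / 2) * hqp 1 1
  rw [hξ, hη]
  simp only [Fin.sum_univ_two, hadd, hadd', hsmul, hsmul', hneg, hneg', hqq, hpp,
    hsymm (J (q _)) (q _), h00, h11, hqp 1 0]
  ring

/-- Every hyper-Hermitian metric is locally conformal to one given by a solution of the system. -/
theorem exists_conformal_chartMetric {U : Set M} {g : BilinField M} (hU : IsOpen U)
    (hg : IsHyperHermitianOn g U) {p : M} (hp : p ∈ U) :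
    ∃ e ∈ IsManifold.maximalAtlas 𝓘(ℂ, C4) ω M, p ∈ e.source ∧ e.source ⊆ U ∧
      ∃ Θ : Fin 2 → C4 → ℂ,
        (∀ A, DifferentiableOn ℂ (Θ A) e.target) ∧ SolvesHyperEq Θ e.target ∧
        ∃ Ω : M → ℂ, MDifferentiableOn 𝓘(ℂ, C4) 𝓘(ℂ, ℂ) Ω e.source ∧
          ∀ q ∈ e.source, Ω q ≠ 0 ∧ g q = Ω q • chartMetric e Θ q := by
  obtain ⟨I, J, K, h, hinv⟩ := hg.exists_hypercomplex
  obtain ⟨e₁, he₁, hp₁, hU₁, hp0, hI0, hJ0⟩ := exists_centered_chart hU h hp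
  have h0 : (0 : C4) ∈ e₁.target := hp0 ▸ e₁.map_source hp₁
  have hN : e₁.target ∈ 𝓝 (0 : C4) := e₁.open_target.mem_nhds h0
  obtain ⟨ψ, hψ0, hψN, hψa, hψs, Θ, hΘ, hΘe, hframe⟩ := exists_adapted_coordinates
    (analyticAt_coordEnd he₁ hU hU₁ h.hol_I h0) (analyticAt_coordEnd he₁ hU hU₁ h.hol_J h0)
    (by filter_upwards [hN] with z hz using isQuaternionicPair_coordEnd he₁ hU₁ h hz) hI0 hJ0
    (by filter_upwards [hN] with z hz using h.pencilInvolutiveAt_coordEnd he₁ hU₁ hz) hN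
  have he := trans_mem_maximalAtlas he₁ (mem_contDiffGroupoid_of_analyticAt ψ hψa hψs)
  set e := e₁.trans ψ with hedef
  have hsrc : ∀ m ∈ e.source, m ∈ e₁.source ∧ e₁ m ∈ ψ.source := fun m hm => by
    rwa [hedef, OpenPartialHomeomorph.trans_source] at hm
  have heU : e.source ⊆ U := fun m hm => hU₁ (hsrc m hm).1
  have htgt : e.target ⊆ ψ.target := by
    rw [hedef, OpenPartialHomeomorph.trans_target]; exact inter_subset_left
  have hΘa : ∀ z ∈ e.target, ∀ C, AnalyticAt ℂ (Θ C) z := fun z hz C =>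
    DifferentiableOn.analyticAt_complex ψ.open_target (hΘ C) (htgt hz)
  have hq : ∀ m ∈ e.source, ∀ A : Fin 2,
      I m (chartDInv e m (Pi.single A 1, 0)) = Complex.I • chartDInv e m (Pi.single A 1, 0) ∧
      chartDInv e m (hyperFrame Θ A (e m)) = -J m (chartDInv e m (Pi.single A 1, 0)) := by
    intro m hm A
    obtain ⟨hm₁, hmψ⟩ := hsrc m hm
    obtain ⟨q, hq1, hq2, hq3⟩ := hframe (e₁ m) hmψ A
    have hD : ∀ v, chartD e m v = fderiv ℂ ψ (e₁ m) (chartD e₁ m v) := fun v =>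
      chartD_trans he₁ hm₁ (hψa _ hmψ).differentiableAt v
    have h1 : chartDInv e m (Pi.single A 1, 0) = chartDInv e₁ m q := by
      rw [← chartDInv_chartD he hm (chartDInv e₁ m q), hD, chartD_chartDInv he₁ hm₁, hq2]
    constructor
    · rw [h1, ← chartDInv_coordEnd he₁ I hm₁, hq1, chartDInv_smul]
    · rw [h1, ← chartDInv_coordEnd he₁ J hm₁, ← chartDInv_neg,
        ← chartDInv_chartD he hm (chartDInv e₁ m _), hD, chartD_chartDInv he₁ hm₁, map_neg, hq3,
        neg_neg]
      rfl
  -- The form ds² takes the value 1/2 on (∂_0, W_1), because products of covectors are symmetrised;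
  -- hence Ω = 2 g(∂_0, W_1).
  let Ω : M → ℂ := fun m => g m (chartDInv e m ((2 : ℂ) • (Pi.single 0 1, 0)))
    (chartDInv e m (hyperFrame Θ 1 (e m)))
  have hΩ : ∀ m ∈ e.source, g m = Ω m • chartMetric e Θ m := by
    intro m hm
    have hmU := heU hm
    have hexp : ∀ ξ : TangentSpace 𝓘(ℂ, C4) m, ∃ a b : Fin 2 → ℂ,
        chartD e m ξ = shear (frameShift Θ (e m)) (a, b) ∧
        ξ = ∑ A, a A • chartDInv e m (Pi.single A 1, 0)
          + ∑ A, b A • -J m (chartDInv e m (Pi.single A 1, 0)) := by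
      intro ξ
      obtain ⟨⟨a, b⟩, hab⟩ : ∃ u, chartD e m ξ = shear (frameShift Θ (e m)) u :=
        ⟨_, (shear_shear_neg _ _).symm⟩
      refine ⟨a, b, hab, ?_⟩
      rw [← chartDInv_chartD he hm ξ, hab]
      simp only [Fin.sum_univ_two, ← (hq m hm _).2, ← chartDInv_smul, ← chartDInv_add]
      congr 1
      rw [hyperFrame_eq_frameShift, hyperFrame_eq_frameShift, shear_apply]
      conv_lhs => rw [pi_fin_two_eq a, pi_fin_two_eq b]
      simp
    refine ContinuousLinearMap.ext fun ξ => ContinuousLinearMap.ext fun η => ?_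
    obtain ⟨a, b, h1, h2⟩ := hexp ξ
    obtain ⟨c, d, h3, h4⟩ := hexp η
    have hI : ∀ u v, g m (I m u) (I m v) = g m u v := fun u v => by
      simpa [quatComb] using hinv 1 0 0 (by simp) m hmU u v
    have hJ : ∀ u v, g m (J m u) (J m v) = g m u v := fun u v => by
      simpa [quatComb] using hinv 0 1 0 (by simp) m hmU u v
    have key := bilin_eq_smul_coordMetric (g := fun u v => g m u v)
      (fun u v w => by rw [ContinuousLinearMap.map_add]; rfl)
      (fun c u w => by rw [ContinuousLinearMap.map_smul]; rfl)
      (hg.symm m hmU) hI hJ (h.sq_J m hmU) (q := fun A => chartDInv e m (Pi.single A 1, 0))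
      (fun A => (hq m hm A).1) h2 h4
    have hΩm : Ω m = 2 * g m (chartDInv e m (Pi.single 0 1, 0))
        (-J m (chartDInv e m (Pi.single 1 1, 0))) := by
      simp only [Ω]
      rw [chartDInv_smul, (hq m hm 1).2, ContinuousLinearMap.map_smul]
      rfl
    refine key.trans ?_
    change _ = Ω m • chartMetric e Θ m ξ η
    rw [chartMetric_apply, h1, h3, coordMetric_shear, hΩm, smul_eq_mul]
  refine ⟨e, he, ?_, heU, Θ, fun A => (hΘ A).mono htgt, fun z hz => hΘe z (htgt hz), Ω, ?_,
    fun m hm => ⟨fun hz => ?_, hΩ m hm⟩⟩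
  · rw [hedef, OpenPartialHomeomorph.trans_source]
    exact ⟨hp₁, by rw [mem_preimage, hp0]; exact hψ0⟩
  · intro m hm
    have hW : DifferentiableAt ℂ (hyperFrame Θ 1) (e m) := by
      have h1 := (AnalyticAt.frameShift (hΘa _ (e.map_source hm))).differentiableAt
      have h2 : hyperFrame Θ 1 = fun z => (frameShift Θ z (Pi.single 1 1), Pi.single 1 1) :=
        funext fun z => hyperFrame_eq_frameShift Θ 1 z
      rw [h2]
      fun_prop
    exact (hg.hol.mdifferentiableAt_apply hU (heU hm)
      (holVecAt_chartDInv (Y := fun _ => (2 : ℂ) • (Pi.single 0 1, 0)) he hm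
        (differentiableAt_const _))
      (holVecAt_chartDInv he hm hW)).mdifferentiableWithinAt
  -- A zero of Ω would make g vanish there, so nondegeneracy would force ∂_0 = 0.
  · have h1 : chartDInv e m (Pi.single 0 1, 0) = 0 :=
      hg.nondegenerate m (heU hm) _ fun v => by
        rw [hΩ m hm, hz]
        exact zero_mul (chartMetric e Θ m (chartDInv e m (Pi.single 0 1, 0)) v)
    have h2 := chartD_chartDInv he hm (Pi.single 0 1, 0)
    rw [h1] at h2
    have h3 : (0 : C4) = (Pi.single 0 1, 0) := (ContinuousLinearMap.map_zero _).symm.trans h2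
    simpa using congrFun (congrArg Prod.fst h3) 0

end ConformalForm

end

theorem proposition3 {M : Type*} [TopologicalSpace M] [ChartedSpace C4 M]
    [IsManifold 𝓘(ℂ, C4) ω M] :
    (∀ e ∈ IsManifold.maximalAtlas 𝓘(ℂ, C4) ω M, ∀ Θ : Fin 2 → C4 → ℂ,
      (∀ A, DifferentiableOn ℂ (Θ A) e.target) → SolvesHyperEq Θ e.target →
        IsHyperHermitianOn (chartMetric e Θ) e.source) ∧
    (∀ (U : Set M) (g : BilinField M), IsOpen U → IsHyperHermitianOn g U → ∀ p ∈ U,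
      ∃ e ∈ IsManifold.maximalAtlas 𝓘(ℂ, C4) ω M, p ∈ e.source ∧ e.source ⊆ U ∧
        ∃ Θ : Fin 2 → C4 → ℂ,
          (∀ A, DifferentiableOn ℂ (Θ A) e.target) ∧ SolvesHyperEq Θ e.target ∧
          ∃ Ω : M → ℂ, MDifferentiableOn 𝓘(ℂ, C4) 𝓘(ℂ, ℂ) Ω e.source ∧
            ∀ q ∈ e.source, Ω q ≠ 0 ∧ g q = Ω q • chartMetric e Θ q) :=
  ⟨fun _ he _ hΘ hV => isHyperHermitianOn_chartMetric he hΘ hV,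
    fun _ _ hU hg _ hp => exists_conformal_chartMetric hU hg hp⟩
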